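/- **Setup.** Write $\mathbf e(x)=e^{2\pi i x}$, $q=\mathbf e(\tau)$, $\mathbb H$ for the upper half-plane. Let $p$ be an odd prime and $(A,Q)$ a finite quadratic module (a finite abelian group with a nondegenerate $\mathbb Q/\mathbb Z$-valued quadratic form) with $|A|=2p$. Put $\langle\beta,\gamma\rangle=Q(\beta+\gamma)-Q(\beta)-Q(\gamma)$ and define $\mathrm{sig}=\mathrm{sig}(A,Q)\in\mathbb Z/8\mathbb Z$ by $\mathbf e(\mathrm{sig}/8)=|A|^{-1/2}\sum_{\gamma\in A}\mathbf e(Q(\gamma))$. Then there are an isomorphism $A\cong\mathbb Z/2p\mathbb Z$, a $\delta\in\{\pm1\}$ and an $\alpha\in\mathbb Z$ with $p\nmid\alpha$ such that $Q(p\gamma_1+\gamma_2)=\delta\gamma_1^2/4+\alpha\gamma_2^2/p$ for $\gamma_1\in\mathbb Z/2\mathbb Z$ and $\gamma_2\in\mathbb Z/p\mathbb Z$, where $\mathbb Z/p\mathbb Z$ is embedded in $\mathbb Z/2p\mathbb Z$ as the even residue classes. Fix any such data. Let $k\in\frac12+\mathbb Z$ and let $\chi$ be a Dirichlet character mod $p$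 with $\chi(-1)=(-1)^{k+\mathrm{sig}/2}$. Characters mod $p$ are evaluated on $\mathbb Z/2p\mathbb Z$ by reduction mod $p$. Powers of complex numbers use the principal branch, and $i^k=e^{\pi i k/2}$. **Vector-valued forms.** Let $\rho^*$ be the dual Weil representation of $\mathrm{Mp}_2(\mathbb Z)$ on $\mathbb C[A]$, determined by $\rho^*(T)\mathfrak e_\gamma=\mathbf e(-Q(\gamma))\mathfrak e_\gamma$ and $\rho^*(S)\mathfrak e_\gamma=\mathbf e(\mathrm{sig}/8)|A|^{-1/2}\sum_\beta\mathbf e(\langle\beta,\gamma\rangle)\mathfrak e_\beta$, where $T=\left(\left(\begin{smallmatrix}1&1\\0&1\end{smallmatrix}\right),1\right)$ and $S=\left(\left(\begin{smallmatrix}0&-1\\1&0\end{smallmatrix}\right),\sqrt\tau\right)$. Let $A_k(\rho^*)$ be the space of holomorphic $F=\sum_\gamma F_\gamma\mathfrak e_\gamma:\mathbb H\to\mathbb C[A]$ with $F(M\tau)=\phi(\tau)^{2k}\rho^*(M,\phi)F(\tau)$ for all $(M,\phi)\in\mathrm{Mp}_2(\mathbb Z)$ and with Fourier expansions $F_\gamma=\sum_{n\in\mathbb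 Z-Q(\gamma),\,n\gg-\infty}c(n,\gamma)q^n$. **Scalar-valued forms.** Let $\nu_\vartheta(M)=\left(\frac cd\right)\varepsilon_d^{-1}$ be the theta multiplier on $\Gamma_0(4)$ ($\varepsilon_d=1$ if $d\equiv1$ and $\varepsilon_d=i$ if $d\equiv3$ mod $4$; $\left(\frac cd\right)=\left(\frac c{|d|}\right)$ unless $c,d<0$, when it is $-\left(\frac c{|d|}\right)$). Let $A_k(16p^2,\chi)$ be the space of holomorphic $G:\mathbb H\to\mathbb C$, meromorphic at the cusps, with $G(M\tau)=\chi(d)\nu_\vartheta(M)^{\pm1}(c\tau+d)^kG(\tau)$ for $M=\left(\begin{smallmatrix}a&b\\c&d\end{smallmatrix}\right)\in\Gamma_0(16p^2)$, where the sign is chosen so that $\nu_\vartheta(-1)^{\pm1}\chi(-1)i^{2k}=1$. Let $A_k^\epsilon(16p^2,\chi)$ be the subspace of the $G=\sum_{n\in\mathbb Z,\,n\gg-\infty}c(n)q^n$ with $c(n)=0$ unless $n\in4p(\mathbb Z-Q(\gamma))$ for some $\gamma\in(\mathbb Z/2p\mathbb Z)\setminus\{0,p\}$. For such $G$ and a Dirichlet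 character $\psi$ mod $p$ put $$G_\gamma=\tfrac12\sum_{n\in4p(\mathbb Z-Q(\gamma))}c(n)q^n,\qquad G_\psi=\sum_{\gamma(2p)}\psi(\gamma)G_\gamma,$$ and let $G_\psi^{\mathrm{even}}$, $G_\psi^{\mathrm{odd}}$ be the sums of $\psi(\gamma)G_\gamma$ over the $\gamma$ with $4pQ(\gamma)$ even, respectively odd. Put $(G|_kW_{16p^2})(\tau)=(4p)^{-k}(-i\tau)^{-k}G(-1/16p^2\tau)$ and $g(\psi\chi)=\sum_{n(p)^*}\psi\chi(n)\mathbf e(n/p)$. Let $A_k^{\epsilon,\mathrm{AL}}(16p^2,\chi)$ be the subspace of the $G\in A_k^\epsilon(16p^2,\chi)$ with $$G_\psi|_kW_{16p^2}=\overline{\psi\chi(2\alpha)}\,\frac{\sqrt2\,g(\psi\chi)}{\sqrt p}\,\mathbf e(\mathrm{sig}/8)\,i^k\,G^{\mathrm{even}}_{\overline\psi\,\overline\chi^2}\qquad\text{for all }\psi\ne\overline\chi\text{ mod }p.$$ **Statement.** The map $\varphi_\chi(F)(\tau)=\sum_{\gamma(2p)}\chi(\gamma)F_\gamma(4p\tau)$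 is an injective linear map $A_k(\rho^*)\to A_k^{\epsilon,\mathrm{AL}}(16p^2,\chi)$, with left inverse $$G\mapsto\sum_{\gamma\ne0,p}\overline{\chi(\gamma)}\,G_\gamma(\tau/4p)\,\mathfrak e_\gamma+G_0(\tau/4p)\,\mathfrak e_0+G_p(\tau/4p)\,\mathfrak e_p,$$ where, in this formula only, $G_0$ and $G_p$ denote $$G_0=\tfrac{\sqrt p}{\sqrt2(p-1)}\mathbf e(-\mathrm{sig}/8)\,i^{-k}\,(G^{\mathrm{even}}_{\overline\chi}+G^{\mathrm{odd}}_{\overline\chi})|_kW_{16p^2}+\tfrac1{p-1}G^{\mathrm{even}}_{\overline\chi},$$ $$G_p=\tfrac{\sqrt p}{\sqrt2(p-1)}\mathbf e(-\mathrm{sig}/8)\,i^{-k}\,(G^{\mathrm{even}}_{\overline\chi}-G^{\mathrm{odd}}_{\overline\chi})|_kW_{16p^2}+\tfrac1{p-1}G^{\mathrm{odd}}_{\overline\chi}.$$ If $p\ge5$, or if $p=3$ and $\chi(-1)=-1$, then $\varphi_\chi:A_k(\rho^*)\to A_k^{\epsilon,\mathrm{AL}}(16p^2,\chi)$ is an isomorphism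 and the displayed map is its inverse. -/

import Mathlib

open scoped UpperHalfPlane MatrixGroups Manifold

noncomputable section

namespace TwistedSum

/-! ### Exponentials and `ℚ/ℤ` -/

/-- `e(x) = exp(2πix)`. -/
def e (z : ℂ) : ℂ := Complex.exp (2 * Real.pi * Complex.I * z)

lemma e_add (z w : ℂ) : e (z + w) = e z * e w := by
  simp only [e, mul_add, Complex.exp_add]

lemma e_periodic : Function.Periodic (fun x : ℚ => e (x : ℂ)) 1 := by
  intro x
  have h : e 1 = 1 := by simp [e]
  simp only [Rat.cast_add, Rat.cast_one, e_add, h, mul_one]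

/-- `e` as a function on `ℚ/ℤ`. -/
def eQZ (x : AddCircle (1 : ℚ)) : ℂ := e_periodic.lift x

/-! ### Finite quadratic modules

A finite quadratic module is a finite abelian group `A` with a nondegenerate quadratic form
`Q : QuadraticMap ℤ A (AddCircle (1 : ℚ))`, where `AddCircle (1 : ℚ) = ℚ/ℤ`. The associated bilinear
form `⟨β, γ⟩ = Q(β + γ) - Q(β) - Q(γ)` is `QuadraticMap.polar Q β γ`. -/

section FQM

variable {A : Type*} [AddCommGroup A]

/-- The bilinear form of `Q` is nondegenerate. -/
def Nondegenerate (Q : QuadraticMap ℤ A (AddCircle (1 : ℚ))) : Prop :=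
  ∀ β : A, (∀ γ : A, QuadraticMap.polar Q β γ = 0) → β = 0

variable [Fintype A]

/-- The signature in `ℤ/8ℤ`, determined by `e(sig/8) = |A|^(-1/2) ∑ e(Q(γ))`. -/
def signature (Q : QuadraticMap ℤ A (AddCircle (1 : ℚ))) : ZMod 8 :=
  Classical.epsilon fun s : ZMod 8 =>
    e ((s.val : ℂ) / 8) = ((Real.sqrt (Fintype.card A) : ℝ) : ℂ)⁻¹ * ∑ γ : A, eQZ (Q γ)

/-- `e(sig(A,Q)/8)`. -/
def eSig (Q : QuadraticMap ℤ A (AddCircle (1 : ℚ))) : ℂ := e (((signature Q).val : ℂ) / 8)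

end FQM

/-! ### The metaplectic group -/

/-- `cτ + d` for `M = (a, b; c, d)`. -/
def cd (M : SL(2, ℤ)) (τ : ℍ) : ℂ := (M 1 0 : ℂ) * (τ : ℂ) + (M 1 1 : ℂ)

lemma cd_eq_denom (M : SL(2, ℤ)) (τ : ℍ) : cd M τ = UpperHalfPlane.denom M τ := by
  simp [cd, UpperHalfPlane.denom]

lemma cd_ne_zero (M : SL(2, ℤ)) (τ : ℍ) : cd M τ ≠ 0 := by
  rw [cd_eq_denom]; exact UpperHalfPlane.denom_ne_zero _ _

lemma cd_mul (M N : SL(2, ℤ)) (τ : ℍ) : cd (M * N) τ = cd M (N • τ) * cd N τ := by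
  simp only [cd_eq_denom]
  have := UpperHalfPlane.denom_cocycle (M : GL (Fin 2) ℝ) (N : GL (Fin 2) ℝ) τ.im_ne_zero
  rw [← UpperHalfPlane.coe_smul_of_det_pos (by simp)] at this
  simpa using this

/-- The integral metaplectic group `Mp₂(ℤ)`: pairs of a matrix `M = (a, b; c, d)` and one of the two
continuous (equivalently holomorphic) square roots of `cτ + d` on the upper half-plane. -/
@[ext]
structure Mp2Z where
  mat : SL(2, ℤ)
  root : ℍ → ℂ
  continuous_root : Continuous root
  root_sq : ∀ τ, root τ ^ 2 = cd mat τ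

namespace Mp2Z

lemma root_ne_zero (g : Mp2Z) (τ : ℍ) : g.root τ ≠ 0 := by
  intro h
  apply cd_ne_zero g.mat τ
  rw [← g.root_sq, h]; simp

lemma continuous_smul (M : SL(2, ℤ)) : Continuous (fun τ : ℍ => M • τ) :=
  continuous_const_smul (M : GL (Fin 2) ℝ)

/-- `(M, φ)(N, ψ) = (MN, φ(Nτ)ψ(τ))`. -/
instance : Mul Mp2Z where
  mul g h :=
    { mat := g.mat * h.mat
      root := fun τ => g.root (h.mat • τ) * h.root τ
      continuous_root := (g.continuous_root.comp (continuous_smul _)).mul h.continuous_root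
      root_sq := fun τ => by rw [mul_pow, g.root_sq, h.root_sq, cd_mul] }

instance : One Mp2Z where
  one :=
    { mat := 1
      root := fun _ => 1
      continuous_root := continuous_const
      root_sq := fun τ => by simp [cd] }

instance : Inv Mp2Z where
  inv g :=
    { mat := g.mat⁻¹
      root := fun τ => (g.root (g.mat⁻¹ • τ))⁻¹
      continuous_root := (g.continuous_root.comp (continuous_smul _)).inv₀
        fun τ => g.root_ne_zero _
      root_sq := fun τ => by
        have h := cd_mul g.mat g.mat⁻¹ τ
        have h1 : cd (1 : SL(2, ℤ)) τ = 1 := by simp [cd]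
        rw [mul_inv_cancel, h1] at h
        rw [inv_pow, g.root_sq]
        exact (eq_inv_of_mul_eq_one_right h.symm).symm }

@[simp] lemma mul_mat (g h : Mp2Z) : (g * h).mat = g.mat * h.mat := rfl
@[simp] lemma mul_root (g h : Mp2Z) (τ : ℍ) :
    (g * h).root τ = g.root (h.mat • τ) * h.root τ := rfl
@[simp] lemma one_mat : (1 : Mp2Z).mat = 1 := rfl
@[simp] lemma one_root (τ : ℍ) : (1 : Mp2Z).root τ = 1 := rfl
@[simp] lemma inv_mat (g : Mp2Z) : (g⁻¹).mat = g.mat⁻¹ := rfl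
@[simp] lemma inv_root (g : Mp2Z) (τ : ℍ) :
    (g⁻¹).root τ = (g.root (g.mat⁻¹ • τ))⁻¹ := rfl

instance : Group Mp2Z :=
  Group.ofLeftAxioms
    (fun f g h => by
      ext τ
      · simp [mul_assoc]
      · simp only [mul_root, mul_mat, mul_assoc, mul_smul])
    (fun g => by
      ext τ
      · simp
      · simp)
    (fun g => by
      ext τ
      · simp
      · simp only [mul_root, inv_root, one_root, ← mul_smul, inv_mul_cancel, one_smul]
        exact inv_mul_cancel₀ (g.root_ne_zero τ))

/-- The generator `S = ((0, -1; 1, 0), √τ)` with the principal square root. -/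
def S : Mp2Z where
  mat := ModularGroup.S
  root := fun τ => (τ : ℂ) ^ (1 / 2 : ℂ)
  continuous_root := by
    refine continuous_iff_continuousAt.mpr fun τ => ?_
    refine ContinuousAt.cpow UpperHalfPlane.continuous_coe.continuousAt continuousAt_const ?_
    exact Or.inr τ.im_ne_zero
  root_sq := fun τ => by
    rw [← Complex.cpow_nat_mul]
    simp [cd, ModularGroup.S]

/-- The generator `T = ((1, 1; 0, 1), 1)`. -/
def T : Mp2Z where
  mat := ModularGroup.T
  root := fun _ => 1
  continuous_root := continuous_const
  root_sq := fun τ => by simp [cd, ModularGroup.T]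

end Mp2Z

/-! ### The dual Weil representation

An element `∑ v_γ 𝔢_γ` of the group algebra `ℂ[A]` is written as the vector `v : A → ℂ`, and an
operator on `ℂ[A]` as the matrix whose column with index `γ` is the image of `𝔢_γ`. -/

section Weil

variable {A : Type*} [AddCommGroup A] [Fintype A] [DecidableEq A]

/-- `ρ*(T) 𝔢_γ = e(-Q(γ)) 𝔢_γ`. -/
def weilT (Q : QuadraticMap ℤ A (AddCircle (1 : ℚ))) : Matrix A A ℂ :=
  Matrix.diagonal fun γ => eQZ (-Q γ)

/-- `ρ*(S) 𝔢_γ = e(sig(A,Q)/8) |A|^(-1/2) ∑_β e(⟨β, γ⟩) 𝔢_β`. -/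
def weilS (Q : QuadraticMap ℤ A (AddCircle (1 : ℚ))) : Matrix A A ℂ :=
  Matrix.of fun β γ =>
    eSig Q / ((Real.sqrt (Fintype.card A) : ℝ) : ℂ) * eQZ (QuadraticMap.polar Q β γ)

/-- `DualWeil Q g L` says that `ρ*(g) = L`: the graph of the representation `ρ*` of `Mp₂(ℤ)`, which
is defined by its values on the generators `S` and `T`, is the subgroup that these generate. -/
inductive DualWeil (Q : QuadraticMap ℤ A (AddCircle (1 : ℚ))) : Mp2Z → Matrix A A ℂ → Prop
  | one : DualWeil Q 1 1
  | S : DualWeil Q Mp2Z.S (weilS Q)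
  | T : DualWeil Q Mp2Z.T (weilT Q)
  | mul {g h : Mp2Z} {L L' : Matrix A A ℂ} :
      DualWeil Q g L → DualWeil Q h L' → DualWeil Q (g * h) (L * L')
  | inv {g : Mp2Z} {L L' : Matrix A A ℂ} :
      DualWeil Q g L → L * L' = 1 → L' * L = 1 → DualWeil Q g⁻¹ L'

/-- Every homomorphism with the prescribed values on the generators has this graph. -/
lemma DualWeil.eq_of_hom {Q : QuadraticMap ℤ A (AddCircle (1 : ℚ))} (ρ : Mp2Z →* Matrix A A ℂ)
    (hS : ρ Mp2Z.S = weilS Q) (hT : ρ Mp2Z.T = weilT Q) {g : Mp2Z} {L : Matrix A A ℂ}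
    (h : DualWeil Q g L) : ρ g = L := by
  induction h with
  | one => exact map_one ρ
  | S => exact hS
  | T => exact hT
  | mul _ _ h1 h2 => rw [map_mul, h1, h2]
  | @inv g L L' _ h1 h2 h3 =>
    have h4 : L * ρ g⁻¹ = 1 := by rw [← h3, ← map_mul, mul_inv_cancel, map_one]
    calc ρ g⁻¹ = L' * (L * ρ g⁻¹) := by rw [← mul_assoc, h2, one_mul]
      _ = L' := by rw [h4, mul_one]

end Weil

/-! ### Vector-valued forms

Half-integral weights `k` are given by the integer `κ = 2k`. -/

/-- `f(τ) = ∑_{n ≫ -∞} c(n) q^n` with rational exponents `n`. -/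
def HasRatExpansion (f : ℍ → ℂ) (c : ℚ → ℂ) : Prop :=
  (∃ B : ℚ, ∀ n < B, c n = 0) ∧ ∀ τ : ℍ, HasSum (fun n : ℚ => c n * e (n * (τ : ℂ))) (f τ)

lemma HasRatExpansion.zero : HasRatExpansion 0 0 :=
  ⟨⟨0, fun _ _ => rfl⟩, fun τ => by simp⟩

lemma HasRatExpansion.add {f g : ℍ → ℂ} {c d : ℚ → ℂ} (hf : HasRatExpansion f c)
    (hg : HasRatExpansion g d) : HasRatExpansion (f + g) (c + d) := by
  obtain ⟨⟨B, hB⟩, hs⟩ := hf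
  obtain ⟨⟨B', hB'⟩, hs'⟩ := hg
  refine ⟨⟨min B B', fun n hn => ?_⟩, fun τ => ?_⟩
  · simp [hB n (lt_of_lt_of_le hn (min_le_left _ _)), hB' n (lt_of_lt_of_le hn (min_le_right _ _))]
  · simpa [add_mul] using (hs τ).add (hs' τ)

lemma HasRatExpansion.smul {f : ℍ → ℂ} {c : ℚ → ℂ} (a : ℂ) (hf : HasRatExpansion f c) :
    HasRatExpansion (a • f) (a • c) := by
  obtain ⟨⟨B, hB⟩, hs⟩ := hf
  refine ⟨⟨B, fun n hn => by simp [hB n hn]⟩, fun τ => ?_⟩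
  simpa [mul_assoc] using (hs τ).mul_left a

section Vector

variable {A : Type*} [AddCommGroup A] [Fintype A] [DecidableEq A]

/-- The space `A_k(ρ*)`, `k = κ/2`, of weakly holomorphic modular forms for the dual Weil
representation. For `(M, φ)` in `Mp₂(ℤ)`, the factor `(cτ + d)^k` is `φ(τ)^(2k)`. -/
def vectorForms (Q : QuadraticMap ℤ A (AddCircle (1 : ℚ))) (κ : ℤ) :
    Submodule ℂ (ℍ → A → ℂ) where
  carrier := {F |
    (∀ γ, MDiff (fun τ => F τ γ)) ∧
    (∀ (g : Mp2Z) (L : Matrix A A ℂ), DualWeil Q g L →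
      ∀ τ : ℍ, F (g.mat • τ) = g.root τ ^ κ • L.mulVec (F τ)) ∧
    ∀ γ, ∃ c : ℚ → ℂ, (∀ n : ℚ, c n ≠ 0 → (n : AddCircle (1 : ℚ)) = -Q γ) ∧
      HasRatExpansion (fun τ => F τ γ) c}
  zero_mem' := by
    refine ⟨fun γ => mdifferentiable_const, fun g L _ τ => ?_, fun γ => ?_⟩
    · simp
    · exact ⟨0, fun n hn => absurd rfl hn, HasRatExpansion.zero⟩
  add_mem' := by
    rintro F G ⟨h1, h2, h3⟩ ⟨h1', h2', h3'⟩
    refine ⟨fun γ => (h1 γ).add (h1' γ), fun g L hg τ => ?_, fun γ => ?_⟩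
    · simp only [Pi.add_apply, h2 g L hg, h2' g L hg, Matrix.mulVec_add, smul_add]
    · obtain ⟨c, hc, hs⟩ := h3 γ
      obtain ⟨c', hc', hs'⟩ := h3' γ
      refine ⟨c + c', fun n hn => ?_, hs.add hs'⟩
      by_cases h : c n = 0
      · by_cases h' : c' n = 0
        · simp [h, h'] at hn
        · exact hc' n h'
      · exact hc n h
  smul_mem' := by
    rintro a F ⟨h1, h2, h3⟩
    refine ⟨fun γ => (h1 γ).const_smul a, fun g L hg τ => ?_, fun γ => ?_⟩
    · simp only [Pi.smul_apply, h2 g L hg, Matrix.mulVec_smul, smul_comm a]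
    · obtain ⟨c, hc, hs⟩ := h3 γ
      refine ⟨a • c, fun n hn => hc n fun h => hn ?_, hs.smul a⟩
      simp [h]

end Vector

/-! ### Scalar-valued forms of half-integral weight -/

/-- The quadratic residue symbol `(c/d)` for odd `d`, possibly negative, in the normalization used
for the theta multiplier: `(c/d) = (c/|d|)` unless `c, d < 0`, when it is `-(c/|d|)`. -/
def thetaSymbol (c d : ℤ) : ℤ :=
  if c < 0 ∧ d < 0 then -jacobiSym c d.natAbs else jacobiSym c d.natAbs

/-- `ε_d = 1` for `d ≡ 1 mod 4` and `ε_d = i` for `d ≡ 3 mod 4`. -/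
def epsd (d : ℤ) : ℂ := if d % 4 = 1 then 1 else Complex.I

/-- The theta multiplier `ν_ϑ(M) = (c/d) ε_d⁻¹` on `Γ₀(4)`. -/
def thetaMult (M : SL(2, ℤ)) : ℂ := (thetaSymbol (M 1 0) (M 1 1) : ℂ) * (epsd (M 1 1))⁻¹

/-- Meromorphic at the cusps: for all `M = (a, b; c, d)` in `SL₂(ℤ)`, the function
`(cτ + d)^(-k) G(Mτ)` has an expansion `∑_{n ≫ -∞} c(n) q^n`, `n ∈ (1/h)ℤ`. -/
def MeromorphicAtCusps (κ : ℤ) (G : ℍ → ℂ) : Prop :=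
  ∀ M : SL(2, ℤ), ∃ (h : ℕ) (c : ℚ → ℂ), 0 < h ∧
    (∀ n : ℚ, c n ≠ 0 → ∃ m : ℤ, n = (m : ℚ) / (h : ℚ)) ∧
    HasRatExpansion (fun τ => cd M τ ^ (-((κ : ℂ) / 2)) * G (M • τ)) c

/-- The space `A_k(N, χ)`, `k = κ/2` with `κ` odd, of weakly holomorphic modular forms for `Γ₀(N)`,
`4 ∣ N`, where the character `χ mod N` comes from a character mod `p ∣ N`. The sign `s = ±1` in
`ν_ϑ^s` is the one with `ν_ϑ(-1)^s χ(-1) i^(2k) = 1` (for odd `κ` there is exactly one). -/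
def scalarForms (N : ℕ) {p : ℕ} (χ : DirichletCharacter ℂ p) (κ : ℤ) :
    Submodule ℂ (ℍ → ℂ) where
  carrier := {G | MDiff G ∧
    (∀ s : ℤ, (s = 1 ∨ s = -1) → thetaMult (-1) ^ s * χ (-1) * Complex.I ^ κ = 1 →
      ∀ M ∈ CongruenceSubgroup.Gamma0 N, ∀ τ : ℍ,
        G (M • τ) = χ ((M 1 1 : ℤ) : ZMod p) * thetaMult M ^ s * cd M τ ^ ((κ : ℂ) / 2) * G τ) ∧
    MeromorphicAtCusps κ G}
  zero_mem' := by
    refine ⟨mdifferentiable_const, fun s _ _ M _ τ => by simp, fun M => ?_⟩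
    refine ⟨1, 0, one_pos, fun n hn => absurd rfl hn, ?_⟩
    convert HasRatExpansion.zero using 1
    ext τ
    simp
  add_mem' := by
    rintro F G ⟨h1, h2, h3⟩ ⟨h1', h2', h3'⟩
    refine ⟨h1.add h1', fun s hs hs' M hM τ => ?_, fun M => ?_⟩
    · simp only [Pi.add_apply, h2 s hs hs' M hM τ, h2' s hs hs' M hM τ, mul_add]
    · obtain ⟨h, c, hh, hc, hs⟩ := h3 M
      obtain ⟨h', c', hh', hc', hs'⟩ := h3' M
      refine ⟨h * h', c + c', mul_pos hh hh', fun n hn => ?_, ?_⟩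
      · have e1 : (h : ℚ) ≠ 0 := by exact_mod_cast hh.ne'
        have e2 : (h' : ℚ) ≠ 0 := by exact_mod_cast hh'.ne'
        by_cases h0 : c n = 0
        · by_cases h0' : c' n = 0
          · simp [h0, h0'] at hn
          · obtain ⟨m, rfl⟩ := hc' n h0'
            exact ⟨m * h, by push_cast; field_simp⟩
        · obtain ⟨m, rfl⟩ := hc n h0
          exact ⟨m * h', by push_cast; field_simp⟩
      · convert hs.add hs' using 1
        ext τ
        simp [mul_add]
  smul_mem' := by
    rintro a F ⟨h1, h2, h3⟩
    refine ⟨h1.const_smul a, fun s hs hs' M hM τ => ?_, fun M => ?_⟩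
    · simp only [Pi.smul_apply, h2 s hs hs' M hM τ, smul_eq_mul]; ring
    · obtain ⟨h, c, hh, hc, hs⟩ := h3 M
      refine ⟨h, a • c, hh, fun n hn => hc n fun h => hn (by simp [h]), ?_⟩
      convert hs.smul a using 1
      ext τ
      simp only [Pi.smul_apply, smul_eq_mul]; ring

/-! ### Fourier coefficients of scalar-valued forms -/

/-- `G(τ) = ∑_{n ∈ ℤ, n ≫ -∞} c(n) q^n`. -/
def HasQExpansion (G : ℍ → ℂ) (c : ℤ → ℂ) : Prop :=
  (∃ B : ℤ, ∀ n < B, c n = 0) ∧ ∀ τ : ℍ, HasSum (fun n : ℤ => c n * e (n * (τ : ℂ))) (G τ)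

lemma HasQExpansion.zero : HasQExpansion 0 0 :=
  ⟨⟨0, fun _ _ => rfl⟩, fun τ => by simp⟩

lemma HasQExpansion.add {f g : ℍ → ℂ} {c d : ℤ → ℂ} (hf : HasQExpansion f c)
    (hg : HasQExpansion g d) : HasQExpansion (f + g) (c + d) := by
  obtain ⟨⟨B, hB⟩, hs⟩ := hf
  obtain ⟨⟨B', hB'⟩, hs'⟩ := hg
  refine ⟨⟨min B B', fun n hn => ?_⟩, fun τ => ?_⟩
  · simp [hB n (lt_of_lt_of_le hn (min_le_left _ _)), hB' n (lt_of_lt_of_le hn (min_le_right _ _))]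
  · simpa [add_mul] using (hs τ).add (hs' τ)

lemma HasQExpansion.smul {f : ℍ → ℂ} {c : ℤ → ℂ} (a : ℂ) (hf : HasQExpansion f c) :
    HasQExpansion (a • f) (a • c) := by
  obtain ⟨⟨B, hB⟩, hs⟩ := hf
  refine ⟨⟨B, fun n hn => by simp [hB n hn]⟩, fun τ => ?_⟩
  simpa [mul_assoc] using (hs τ).mul_left a

lemma HasQExpansion.eq_zero {c : ℤ → ℂ} (h : HasQExpansion 0 c) : c = 0 := by
  obtain ⟨⟨B, hB⟩, hs⟩ := h
  suffices key : ∀ k : ℕ, ∀ n : ℤ, n < B + k → c n = 0 by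
    funext n
    refine key (n - B + 1).toNat n ?_
    have := Int.self_le_toNat (n - B + 1)
    omega
  intro k
  induction k with
  | zero => intro n hn; exact hB n (by simpa using hn)
  | succ k ih =>
    intro n hn
    by_cases hlt : n < B + k
    · exact ih n hlt
    have hlow : ∀ m < n, c m = 0 := fun m hm => ih m (by push_cast at hn; omega)
    have hnorm : ∀ (m : ℤ) (t : ℝ), ‖c m * e (((m - n : ℤ) : ℂ) * (Complex.I * t))‖ =
        ‖c m‖ * Real.exp (-(2 * Real.pi * (m - n) * t)) := by
      intro m t
      rw [norm_mul, e, Complex.norm_exp]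
      congr 2
      simp [mul_assoc]
    have hsum : ∀ t : ℝ, 0 < t →
        HasSum (fun m : ℤ => c m * e (((m - n : ℤ) : ℂ) * (Complex.I * t))) 0 := by
      intro t ht
      have h1 := (hs ⟨Complex.I * t, by simpa using ht⟩).mul_right (e (-(n : ℂ) * (Complex.I * t)))
      simp only [Pi.zero_apply, zero_mul] at h1
      refine h1.congr_fun ?_ |> id
      intro m
      rw [mul_assoc, ← e_add]
      congr 2
      push_cast
      ring
    have hlim : Filter.Tendsto
        (fun t : ℝ => ∑' m : ℤ, c m * e (((m - n : ℤ) : ℂ) * (Complex.I * t))) Filter.atTop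
        (nhds (∑' m : ℤ, if m = n then c n else 0)) := by
      refine tendsto_tsum_of_dominated_convergence
        (bound := fun m => ‖c m * e (((m - n : ℤ) : ℂ) * (Complex.I * (1 : ℝ)))‖)
        (hsum 1 one_pos).summable.norm ?_ ?_
      · intro m
        split_ifs with hm
        · subst hm
          simp [e]
        · rcases lt_or_gt_of_ne hm with hm | hm
          · simp [hlow m hm]
          · rw [tendsto_zero_iff_norm_tendsto_zero]
            simp only [hnorm]
            rw [← mul_zero ‖c m‖]
            refine Filter.Tendsto.const_mul _ (Real.tendsto_exp_neg_atTop_nhds_zero.comp ?_)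
            refine Filter.Tendsto.const_mul_atTop ?_ Filter.tendsto_id
            have : (0 : ℝ) < (m : ℝ) - n := by
              have : (n : ℝ) < m := by exact_mod_cast hm
              linarith
            positivity
      · filter_upwards [Filter.eventually_ge_atTop (1 : ℝ)] with t ht m
        rw [hnorm, hnorm]
        by_cases hm : m < n
        · simp [hlow m hm]
        · have h2 : (0 : ℝ) ≤ (m : ℝ) - n := by
            have : (n : ℝ) ≤ m := by exact_mod_cast not_lt.mp hm
            linarith
          have h3 : 0 ≤ 2 * Real.pi * ((m : ℝ) - n) := by positivity
          gcongr
    have hz : (fun t : ℝ => ∑' m : ℤ, c m * e (((m - n : ℤ) : ℂ) * (Complex.I * t)))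
        =ᶠ[Filter.atTop] fun _ => 0 := by
      filter_upwards [Filter.eventually_gt_atTop (0 : ℝ)] with t ht
      exact (hsum t ht).tsum_eq
    have := tendsto_nhds_unique (hlim.congr' hz) tendsto_const_nhds
    simpa using this

lemma HasQExpansion.unique {G : ℍ → ℂ} {c d : ℤ → ℂ} (hc : HasQExpansion G c)
    (hd : HasQExpansion G d) : c = d := by
  have h := hc.add (hd.smul (-1))
  have h0 : G + (-1 : ℂ) • G = 0 := by simp
  rw [h0] at h
  have := h.eq_zero
  simpa [sub_eq_zero, ← sub_eq_add_neg] using this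

open Classical in
/-- The Fourier coefficients `c(n)` of `G(τ) = ∑ c(n) q^n` (zero if there is no such expansion). -/
def qCoeff (G : ℍ → ℂ) : ℤ → ℂ :=
  if h : ∃ c, HasQExpansion G c then h.choose else 0

lemma HasQExpansion.qCoeff_eq {G : ℍ → ℂ} {c : ℤ → ℂ} (h : HasQExpansion G c) :
    qCoeff G = c := by
  have h' : ∃ c, HasQExpansion G c := ⟨c, h⟩
  rw [qCoeff, dif_pos h']
  exact h'.choose_spec.unique h

/-! ### Finite quadratic modules of order `2p` -/

section TwoP

variable {A : Type*} [AddCommGroup A] {p : ℕ}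

/-- `ι : A ≅ ℤ/2pℤ` identifies `Q` with
`Q(pγ₁ + γ₂) = δγ₁²/4 + αγ₂²/p`, `γ₁ ∈ ℤ/2ℤ`, `γ₂ ∈ ℤ/pℤ`, where `δ = ±1`, `p ∤ α`, and `ℤ/pℤ` is
embedded into `ℤ/2pℤ` as the subgroup of even residue classes (so `γ₂` is given by an even
representative). -/
def IsStandardForm (Q : QuadraticMap ℤ A (AddCircle (1 : ℚ))) (δ α : ℤ) (ι : A ≃+ ZMod (2 * p)) :
    Prop :=
  (δ = 1 ∨ δ = -1) ∧ ¬ (p : ℤ) ∣ α ∧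
    ∀ γ₁ γ₂ : ℤ, Even γ₂ →
      Q (ι.symm (((p : ℤ) * γ₁ + γ₂ : ℤ) : ZMod (2 * p))) =
        (((δ : ℚ) * (γ₁ : ℚ) ^ 2 / 4 + (α : ℚ) * (γ₂ : ℚ) ^ 2 / (p : ℚ) : ℚ) : AddCircle (1 : ℚ))

/-- `ψ(γ)` for a Dirichlet character `ψ` mod `p` and `γ ∈ A ≅ ℤ/2pℤ`. -/
def charAt (ι : A ≃+ ZMod (2 * p)) (ψ : DirichletCharacter ℂ p) (γ : A) : ℂ :=
  ψ (ZMod.castHom (dvd_mul_left p 2) (ZMod p) (ι γ))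

/-- `n ∈ 4p(ℤ - Q(γ))`. -/
def InSupport (p : ℕ) (Q : QuadraticMap ℤ A (AddCircle (1 : ℚ))) (γ : A) (n : ℤ) : Prop :=
  (((n : ℚ) / (4 * (p : ℚ)) : ℚ) : AddCircle (1 : ℚ)) = -Q γ

/-- `γ` is even: `4pQ(γ)` (an integer modulo `4p`) is even. -/
def IsEven (p : ℕ) (Q : QuadraticMap ℤ A (AddCircle (1 : ℚ))) (γ : A) : Prop :=
  ∃ m : ℤ, Even m ∧ Q γ = (((m : ℚ) / (4 * (p : ℚ)) : ℚ) : AddCircle (1 : ℚ))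

/-- `γ` is odd: `4pQ(γ)` (an integer modulo `4p`) is odd. -/
def IsOdd (p : ℕ) (Q : QuadraticMap ℤ A (AddCircle (1 : ℚ))) (γ : A) : Prop :=
  ∃ m : ℤ, Odd m ∧ Q γ = (((m : ℚ) / (4 * (p : ℚ)) : ℚ) : AddCircle (1 : ℚ))

/-- The subspace `A_k^ε(16p², χ)` of forms `∑_{n ≫ -∞} c(n) q^n` in `A_k(16p², χ)` such that
`c(n) = 0` unless `n ∈ 4p(ℤ - Q(γ))` for some `γ ≠ 0, p` in `ℤ/2pℤ`. -/
def epsForms (Q : QuadraticMap ℤ A (AddCircle (1 : ℚ))) (ι : A ≃+ ZMod (2 * p))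
    (χ : DirichletCharacter ℂ p) (κ : ℤ) : Submodule ℂ (ℍ → ℂ) where
  carrier := {G | G ∈ scalarForms (16 * p ^ 2) χ κ ∧ ∃ c : ℤ → ℂ, HasQExpansion G c ∧
    ∀ n : ℤ, c n ≠ 0 → ∃ γ : A, ι γ ≠ 0 ∧ ι γ ≠ (p : ZMod (2 * p)) ∧ InSupport p Q γ n}
  zero_mem' := ⟨zero_mem _, 0, HasQExpansion.zero, fun n hn => absurd rfl hn⟩
  add_mem' := by
    rintro F G ⟨h1, c, hc, h2⟩ ⟨h1', c', hc', h2'⟩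
    refine ⟨add_mem h1 h1', c + c', hc.add hc', fun n hn => ?_⟩
    by_cases h : c n = 0
    · by_cases h' : c' n = 0
      · simp [h, h'] at hn
      · exact h2' n h'
    · exact h2 n h
  smul_mem' := by
    rintro a F ⟨h1, c, hc, h2⟩
    exact ⟨Submodule.smul_mem _ a h1, a • c, hc.smul a, fun n hn => h2 n fun h => hn (by simp [h])⟩

open Classical in
/-- The component `G_γ = ½ ∑_{n ∈ 4p(ℤ - Q(γ))} c(n) q^n` of `G = ∑ c(n) q^n`. -/
def component (p : ℕ) (Q : QuadraticMap ℤ A (AddCircle (1 : ℚ))) (G : ℍ → ℂ) (γ : A) (τ : ℍ) : ℂ :=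
  1 / 2 * ∑' n : ℤ, if InSupport p Q γ n then qCoeff G n * e (n * (τ : ℂ)) else 0

lemma component_add (Q : QuadraticMap ℤ A (AddCircle (1 : ℚ))) {F G : ℍ → ℂ} {c d : ℤ → ℂ}
    (hF : HasQExpansion F c) (hG : HasQExpansion G d) (γ : A) (τ : ℍ) :
    component p Q (F + G) γ τ = component p Q F γ τ + component p Q G γ τ := by
  classical
  have key : ∀ (c : ℤ → ℂ), Summable (fun n : ℤ => c n * e (n * (τ : ℂ))) →
      Summable (fun n : ℤ => if InSupport p Q γ n then c n * e (n * (τ : ℂ)) else 0) := by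
    intro c hc
    exact (hc.indicator {n | InSupport p Q γ n}).congr fun n => by simp [Set.indicator_apply]
  have e1 := key c (hF.2 τ).summable
  have e2 := key d (hG.2 τ).summable
  rw [component, component, component, (hF.add hG).qCoeff_eq, hF.qCoeff_eq, hG.qCoeff_eq, ← mul_add,
    ← e1.tsum_add e2]
  congr 1
  refine tsum_congr fun n => ?_
  split_ifs <;> simp [add_mul]

lemma component_smul (Q : QuadraticMap ℤ A (AddCircle (1 : ℚ))) (a : ℂ) {F : ℍ → ℂ} {c : ℤ → ℂ}
    (hF : HasQExpansion F c) (γ : A) (τ : ℍ) :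
    component p Q (a • F) γ τ = a * component p Q F γ τ := by
  classical
  rw [component, component, (hF.smul a).qCoeff_eq, hF.qCoeff_eq, mul_left_comm,
    ← tsum_mul_left (a := a)]
  refine congrArg (fun x : ℂ => 1 / 2 * x) (tsum_congr fun n => ?_)
  split_ifs <;> simp [mul_assoc]

lemma component_zero (Q : QuadraticMap ℤ A (AddCircle (1 : ℚ))) (γ : A) (τ : ℍ) :
    component p Q (0 : ℍ → ℂ) γ τ = 0 := by
  simp [component, HasQExpansion.zero.qCoeff_eq]

/-- The positive real number `4p`. -/
def fourP (p : ℕ) [NeZero p] : {x : ℝ // 0 < x} :=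
  ⟨4 * (p : ℝ), mul_pos (by norm_num) (by exact_mod_cast Nat.pos_of_ne_zero (NeZero.ne p))⟩

/-- `G|_k W_{16p²} = (4p)^(-k) (-iτ)^(-k) G(-1/(16p²τ))`, with `S • (16p²τ) = -1/(16p²τ)`. -/
def atkinLehner (p : ℕ) [NeZero p] (κ : ℤ) (G : ℍ → ℂ) (τ : ℍ) : ℂ :=
  (4 * (p : ℂ)) ^ (-((κ : ℂ) / 2)) * (-Complex.I * (τ : ℂ)) ^ (-((κ : ℂ) / 2)) *
    G (ModularGroup.S • ((fourP p * fourP p) • τ))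

variable [Fintype A]

/-- The component-wise twist `G_ψ = ∑_γ ψ(γ) G_γ`. -/
def twist (Q : QuadraticMap ℤ A (AddCircle (1 : ℚ))) (ι : A ≃+ ZMod (2 * p))
    (ψ : DirichletCharacter ℂ p) (G : ℍ → ℂ) (τ : ℍ) : ℂ :=
  ∑ γ : A, charAt ι ψ γ * component p Q G γ τ

open Classical in
/-- The even part of the twist, `G_ψ^even = ∑_{γ even} ψ(γ) G_γ`. -/
def twistEven (Q : QuadraticMap ℤ A (AddCircle (1 : ℚ))) (ι : A ≃+ ZMod (2 * p))
    (ψ : DirichletCharacter ℂ p) (G : ℍ → ℂ) (τ : ℍ) : ℂ :=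
  ∑ γ : A with IsEven p Q γ, charAt ι ψ γ * component p Q G γ τ

open Classical in
/-- The odd part of the twist, `G_ψ^odd = ∑_{γ odd} ψ(γ) G_γ`. -/
def twistOdd (Q : QuadraticMap ℤ A (AddCircle (1 : ℚ))) (ι : A ≃+ ZMod (2 * p))
    (ψ : DirichletCharacter ℂ p) (G : ℍ → ℂ) (τ : ℍ) : ℂ :=
  ∑ γ : A with IsOdd p Q γ, charAt ι ψ γ * component p Q G γ τ

/-- The constant `conj(ψχ(2α)) · √2 g(ψχ)/√p · e(sig(A,Q)/8) · i^k` of the Atkin-Lehner condition,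
with the Gauss sum `g(ψχ) = ∑_{n mod p} ψχ(n) e(n/p)`. -/
def alConst [NeZero p] (Q : QuadraticMap ℤ A (AddCircle (1 : ℚ))) (α : ℤ)
    (χ ψ : DirichletCharacter ℂ p) (κ : ℤ) : ℂ :=
  starRingEnd ℂ ((ψ * χ) ((2 * α : ℤ) : ZMod p)) *
    (((Real.sqrt 2 : ℝ) : ℂ) * gaussSum (ψ * χ) ZMod.stdAddChar / ((Real.sqrt p : ℝ) : ℂ)) *
    eSig Q * Complex.I ^ ((κ : ℂ) / 2)

/-- The subspace `A_k^{ε,AL}(16p², χ)` of the forms in `A_k^ε(16p², χ)` satisfying the Atkin-Lehner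
condition `G_ψ|_k W_{16p²} = alConst · G^even_{conj(ψ) conj(χ)²}` for all `ψ ≠ conj(χ)` mod `p`. The
complex conjugate of a character is its inverse. -/
def alForms [NeZero p] (Q : QuadraticMap ℤ A (AddCircle (1 : ℚ))) (α : ℤ) (ι : A ≃+ ZMod (2 * p))
    (χ : DirichletCharacter ℂ p) (κ : ℤ) : Submodule ℂ (ℍ → ℂ) where
  carrier := {G | G ∈ epsForms Q ι χ κ ∧ ∀ ψ : DirichletCharacter ℂ p, ψ ≠ χ⁻¹ → ∀ τ : ℍ,
    atkinLehner p κ (twist Q ι ψ G) τ =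
      alConst Q α χ ψ κ * twistEven Q ι (ψ⁻¹ * (χ⁻¹) ^ 2) G τ}
  zero_mem' := by
    refine ⟨zero_mem _, fun ψ _ τ => ?_⟩
    simp [atkinLehner, twist, twistEven, component_zero]
  add_mem' := by
    rintro F G ⟨h1, h2⟩ ⟨h1', h2'⟩
    refine ⟨add_mem h1 h1', fun ψ hψ τ => ?_⟩
    obtain ⟨-, c, hc, -⟩ := h1
    obtain ⟨-, d, hd, -⟩ := h1'
    have e1 := h2 ψ hψ τ
    have e2 := h2' ψ hψ τ
    simp only [atkinLehner, twist, twistEven, component_add Q hc hd, mul_add,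
      Finset.sum_add_distrib] at e1 e2 ⊢
    rw [e1, e2]
  smul_mem' := by
    rintro a F ⟨h1, h2⟩
    refine ⟨Submodule.smul_mem _ a h1, fun ψ hψ τ => ?_⟩
    obtain ⟨-, c, hc, -⟩ := h1
    have e1 := h2 ψ hψ τ
    simp only [atkinLehner, twist, twistEven, component_smul Q a hc, mul_left_comm _ a,
      ← Finset.mul_sum] at e1 ⊢
    rw [e1]

/-- The twisted component sum `φ_χ(F)(τ) = ∑_γ χ(γ) F_γ(4pτ)`. -/
def twistedComponentSum [NeZero p] (ι : A ≃+ ZMod (2 * p)) (χ : DirichletCharacter ℂ p) :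
    (ℍ → A → ℂ) →ₗ[ℂ] (ℍ → ℂ) where
  toFun F := fun τ => ∑ γ : A, charAt ι χ γ * F (fourP p • τ) γ
  map_add' F G := by
    ext τ
    simp [mul_add, Finset.sum_add_distrib]
  map_smul' a F := by
    ext τ
    simp [mul_left_comm _ a, Finset.mul_sum]

/-- `√p / (√2 (p - 1)) · e(-sig(A,Q)/8) · i^(-k)`. -/
def invConst (p : ℕ) (Q : QuadraticMap ℤ A (AddCircle (1 : ℚ))) (κ : ℤ) : ℂ :=
  ((Real.sqrt p : ℝ) : ℂ) / (((Real.sqrt 2 : ℝ) : ℂ) * ((p : ℂ) - 1)) *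
    e (-((signature Q).val : ℂ) / 8) * Complex.I ^ (-((κ : ℂ) / 2))

/-- `G₀ = invConst · (G_{conj(χ)}^even + G_{conj(χ)}^odd)|_k W_{16p²} + G_{conj(χ)}^even/(p - 1)`. -/
def zeroPart [NeZero p] (Q : QuadraticMap ℤ A (AddCircle (1 : ℚ))) (ι : A ≃+ ZMod (2 * p))
    (χ : DirichletCharacter ℂ p) (κ : ℤ) (G : ℍ → ℂ) (τ : ℍ) : ℂ :=
  invConst p Q κ *
      atkinLehner p κ (fun z => twistEven Q ι χ⁻¹ G z + twistOdd Q ι χ⁻¹ G z) τ +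
    1 / ((p : ℂ) - 1) * twistEven Q ι χ⁻¹ G τ

/-- `G_p = invConst · (G_{conj(χ)}^even - G_{conj(χ)}^odd)|_k W_{16p²} + G_{conj(χ)}^odd/(p - 1)`. -/
def pPart [NeZero p] (Q : QuadraticMap ℤ A (AddCircle (1 : ℚ))) (ι : A ≃+ ZMod (2 * p))
    (χ : DirichletCharacter ℂ p) (κ : ℤ) (G : ℍ → ℂ) (τ : ℍ) : ℂ :=
  invConst p Q κ *
      atkinLehner p κ (fun z => twistEven Q ι χ⁻¹ G z - twistOdd Q ι χ⁻¹ G z) τ +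
    1 / ((p : ℂ) - 1) * twistOdd Q ι χ⁻¹ G τ

open Classical in
/-- The inverse map `G ↦ ∑_{γ ≠ 0, p} conj(χ(γ)) G_γ(τ/4p) 𝔢_γ + G₀(τ/4p) 𝔢₀ + G_p(τ/4p) 𝔢_p`. -/
def inverseMap [NeZero p] (Q : QuadraticMap ℤ A (AddCircle (1 : ℚ))) (ι : A ≃+ ZMod (2 * p))
    (χ : DirichletCharacter ℂ p) (κ : ℤ) (G : ℍ → ℂ) : ℍ → A → ℂ := fun τ γ =>
  if ι γ = 0 then zeroPart Q ι χ κ G ((fourP p)⁻¹ • τ)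
  else if ι γ = (p : ZMod (2 * p)) then pPart Q ι χ κ G ((fourP p)⁻¹ • τ)
  else starRingEnd ℂ (charAt ι χ γ) * component p Q G γ ((fourP p)⁻¹ • τ)

end TwoP

end TwistedSum

end

/-!
For an odd prime `p` the module is an orthogonal sum of a form `δx²/4` on `ℤ/2ℤ` and a form `αy²/p`
on `ℤ/pℤ`, and the dual Weil representation is the tensor product of a small representation on
`ℂ[ℤ/2ℤ]` with the Weil representation of `SL₂(ℤ/pℤ)` on `ℂ[ℤ/pℤ]` (`IsCoord.weilS_eq`,
`IsCoord.weilT_eq`, `weilMat_mul`). All computations take place in these coordinates.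

From vector-valued to scalar-valued forms. Conjugation by `diag(4p, 1)` takes `Γ₀(16p²)` into the
matrices with lower left entry divisible by `4p` and upper right entry divisible by `4p`, on which
the representation is monomial up to a scalar. On `Γ₀(4)` the scalar coming from the `2`-part is a
power of the theta multiplier; this follows by Euclid's algorithm on generators
(`IsCoord.thetaLift`). The quadratic character mod `p` coming from the `p`-part is absorbed by
quadratic reciprocity (`thetaMult_reciprocity`), and `χ` comes from the twist
(`IsCoord.twistedComponentSum_smul`). As `Q(γ) = Q(γ')` only for `γ' = ±γ`, the components of
`φ_χ(F)` are `χ(γ) F_γ(4pτ)` (`IsCoord.hasComponents_of_mem_vectorForms`). Rescaled by `4p`, the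
operator `W_{16p²}` becomes the slash operator of `S` (`atkinLehner_comp_fourP`), so the Atkin-Lehner
condition and the formula for the left inverse are obtained by summing the transformation under `S`
against characters mod `p` (`IsCoord.sum_char_weilS_mulVec`, `IsCoord.punctSum_weilS`).

From scalar-valued to vector-valued forms. The components of `G` away from `0` and `p` give a
function `f`, and the formula for the inverse map completes it to a function `F`. Let
`v = F|S - ρ*(S)F`. Since `S²` acts by a scalar on functions of the parity of `χ`, this defect
satisfies `v|S = -ρ*(S)v` (`IsCoord.slashV_defectS`). The Atkin-Lehner conditions and orthogonality
of characters show that the defect of `f` is constant on each parity class away from `0` and `p`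
(`IsCoord.eq_of_sum_char`). The values of `F` at `0` and `p` are those that make `v` vanish away from
`0` and `p`, and an anti-equivariant function with this support is zero
(`IsCoord.eq_zero_of_support`). Equivariance under `T` is clear away from `0` and `p`. In the
relation `TST = ST⁻¹S` of `PSL₂(ℤ)`, the remaining defect `w` enters through
`e(-Q(γ)) (w_0 ± w_p)`, which has to be independent of `γ ≠ 0, p` in a parity class. For `p ≥ 5` this
forces `w = 0`, and for `χ(-1) = -1` the components of index `0` and `p` vanish by parity
(`IsCoord.map_T`).
-/

noncomputable section

set_option linter.unusedSectionVars false

namespace TwistedSum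

/-! ### The Weil representation of `SL₂` of a finite field -/

lemma SL2_mul_entries {R : Type*} [CommRing R] (M N : SL(2, R)) :
    (M * N) 0 0 = M 0 0 * N 0 0 + M 0 1 * N 1 0 ∧ (M * N) 0 1 = M 0 0 * N 0 1 + M 0 1 * N 1 1 ∧
    (M * N) 1 0 = M 1 0 * N 0 0 + M 1 1 * N 1 0 ∧
    (M * N) 1 1 = M 1 0 * N 0 1 + M 1 1 * N 1 1 := by
  simp [Matrix.mul_apply, Fin.sum_univ_two]

lemma SL2_det {R : Type*} [CommRing R] (M : SL(2, R)) : M 0 0 * M 1 1 - M 0 1 * M 1 0 = 1 := by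
  rw [← Matrix.det_fin_two]; exact M.det_coe

section FiniteField

variable {F : Type*} [Field F] [Fintype F] [DecidableEq F]

/-- The quadratic character of `F` with complex values. -/
def quadChar (F : Type*) [Field F] [Fintype F] [DecidableEq F] : MulChar F ℂ :=
  (quadraticChar F).ringHomComp (Int.castRingHom ℂ)

lemma quadChar_apply (a : F) : quadChar F a = (quadraticChar F a : ℂ) := rfl

lemma quadChar_mul_self {a : F} (ha : a ≠ 0) : quadChar F a * quadChar F a = 1 := by
  rw [quadChar_apply, ← Int.cast_mul, ← pow_two, quadraticChar_sq_one ha, Int.cast_one]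

lemma quadChar_inv (a : F) : quadChar F a⁻¹ = quadChar F a := by
  by_cases ha : a = 0
  · simp [ha]
  · have h : quadChar F a * quadChar F a⁻¹ = 1 := by
      rw [← map_mul, mul_inv_cancel₀ ha, map_one]
    calc quadChar F a⁻¹ = quadChar F a * quadChar F a * quadChar F a⁻¹ := by
          rw [quadChar_mul_self ha, one_mul]
      _ = quadChar F a := by rw [mul_assoc, h, mul_one]

lemma sum_addChar_mul_sq (hF : ringChar F ≠ 2) {ψ : AddChar F ℂ} (hψ : ψ.IsPrimitive) {u : F}
    (hu : u ≠ 0) :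
    ∑ y : F, ψ (u * y ^ 2) = quadChar F u * gaussSum (quadChar F) ψ := by
  have h1 : ∑ y : F, ψ (u * y ^ 2) = ∑ x : F, ((quadraticChar F x : ℂ) + 1) * ψ (u * x) := by
    rw [← Finset.sum_fiberwise (s := Finset.univ) (g := fun y : F => y ^ 2)]
    refine Finset.sum_congr rfl fun x _ => ?_
    rw [Finset.sum_congr rfl (g := fun _ => ψ (u * x))
      (fun y hy => by rw [(Finset.mem_filter.mp hy).2]), Finset.sum_const, nsmul_eq_mul]
    congr 1
    have h := quadraticChar_card_sqrts hF x
    have h' : ((Finset.univ.filter fun y : F => y ^ 2 = x).card : ℤ) = quadraticChar F x + 1 := by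
      rw [← h]
      congr 2
      ext y
      simp
    exact_mod_cast h'
  have h2 : ∑ x : F, ψ (u * x) = 0 := by
    have := AddChar.sum_mulShift u hψ
    simp only [hu, if_false, mul_comm _ u] at this
    exact_mod_cast this
  have h3 := gaussSum_mulShift (quadChar F) ψ (Units.mk0 u hu)
  rw [h1]
  simp only [add_mul, one_mul, Finset.sum_add_distrib, h2, add_zero]
  have h4 : gaussSum (quadChar F) (ψ.mulShift u) = ∑ x : F, (quadraticChar F x : ℂ) * ψ (u * x) := by
    simp [gaussSum, quadChar_apply]
  rw [← h4, ← h3, Units.val_mk0, ← mul_assoc, quadChar_mul_self hu, one_mul]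

lemma quadGauss_sq (hF : ringChar F ≠ 2) {ψ : AddChar F ℂ} (hψ : ψ.IsPrimitive) :
    gaussSum (quadChar F) ψ ^ 2 = quadChar F (-1) * Fintype.card F := by
  refine gaussSum_sq ?_ ?_ hψ
  · intro h
    obtain ⟨a, ha⟩ := quadraticChar_exists_neg_one hF
    have ha0 : IsUnit a := by
      rw [isUnit_iff_ne_zero]; rintro rfl; simp at ha
    have := MulChar.one_apply (R' := ℂ) ha0
    rw [← h, quadChar_apply, ha] at this
    norm_num at this
  · exact (quadraticChar_isQuadratic F).comp _

/-- The constant `χ(-1) g / |F|` in the action of `S`, where `χ` is the quadratic character and `g`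
its Gauss sum. -/
def weilConst (ψ : AddChar F ℂ) : ℂ :=
  quadChar F (-1) * gaussSum (quadChar F) ψ / Fintype.card F

lemma weilConst_mul_gaussSum (hF : ringChar F ≠ 2) {ψ : AddChar F ℂ} (hψ : ψ.IsPrimitive) :
    weilConst ψ * gaussSum (quadChar F) ψ = 1 := by
  have hq : (Fintype.card F : ℂ) ≠ 0 := by exact_mod_cast Fintype.card_ne_zero
  have h1 : quadChar F (-1) * quadChar F (-1) = 1 := quadChar_mul_self (by simp)
  rw [weilConst, div_mul_eq_mul_div, mul_assoc, ← pow_two, quadGauss_sq hF hψ, ← mul_assoc, h1,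
    one_mul, div_self hq]

lemma weilConst_sq (hF : ringChar F ≠ 2) {ψ : AddChar F ℂ} (hψ : ψ.IsPrimitive) :
    weilConst ψ ^ 2 * Fintype.card F = quadChar F (-1) := by
  have hq : (Fintype.card F : ℂ) ≠ 0 := by exact_mod_cast Fintype.card_ne_zero
  have h1 : quadChar F (-1) * quadChar F (-1) = 1 := quadChar_mul_self (by simp)
  rw [weilConst, div_pow, mul_pow, quadGauss_sq hF hψ, pow_two, h1]
  field_simp

/-- The matrix of `M = (a, b; c, d)` in the Weil representation of `SL₂(F)` on the functions on `F`
that belongs to the quadratic form `x²` and the additive character `ψ`, in its explicit form on the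
two Bruhat cells `c = 0` and `c ≠ 0`. -/
def weilMat (ψ : AddChar F ℂ) (M : SL(2, F)) : Matrix F F ℂ :=
  Matrix.of fun x y =>
    if M 1 0 = 0 then
      if y = M 0 0 * x then quadChar F (M 0 0) * ψ (M 0 0 * M 0 1 * x ^ 2) else 0
    else weilConst ψ * quadChar F (M 1 0) * ψ ((M 0 0 * x ^ 2 - 2 * x * y + M 1 1 * y ^ 2) / M 1 0)

lemma weilMat_of_eq_zero (ψ : AddChar F ℂ) {M : SL(2, F)} (h : M 1 0 = 0) (x y : F) :
    weilMat ψ M x y =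
      if y = M 0 0 * x then quadChar F (M 0 0) * ψ (M 0 0 * M 0 1 * x ^ 2) else 0 := by
  simp [weilMat, h]

lemma weilMat_of_ne_zero (ψ : AddChar F ℂ) {M : SL(2, F)} (h : M 1 0 ≠ 0) (x y : F) :
    weilMat ψ M x y = weilConst ψ * quadChar F (M 1 0) *
      ψ ((M 0 0 * x ^ 2 - 2 * x * y + M 1 1 * y ^ 2) / M 1 0) := by
  simp [weilMat, h]

lemma weilMat_one (ψ : AddChar F ℂ) : weilMat ψ 1 = 1 := by
  ext x y
  rw [weilMat_of_eq_zero ψ (by simp)]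
  simp [Matrix.one_apply, eq_comm]

/-- `∑_y ψ(uy² - 2vy)` by completing the square. -/
lemma sum_addChar_quadratic (hF : ringChar F ≠ 2) {ψ : AddChar F ℂ} (hψ : ψ.IsPrimitive) {u : F}
    (hu : u ≠ 0) (v : F) :
    ∑ y : F, ψ (u * y ^ 2 - 2 * v * y) =
      ψ (-v ^ 2 / u) * (quadChar F u * gaussSum (quadChar F) ψ) := by
  rw [← sum_addChar_mul_sq hF hψ hu, Finset.mul_sum,
    ← Equiv.sum_comp (Equiv.addRight (v / u)) fun y => ψ (u * y ^ 2 - 2 * v * y)]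
  refine Finset.sum_congr rfl fun y _ => ?_
  rw [← AddChar.map_add_eq_mul]
  congr 1
  simp only [Equiv.coe_addRight]
  field_simp
  ring

/-- The Weil representation of `SL₂(F)` is a genuine representation. When neither factor is upper
triangular, the sum over the middle index is a quadratic Gauss sum with leading coefficient
`u = P₁₀ / (M₁₀ N₁₀)`, `P = MN`, which degenerates to an orthogonality relation when `P₁₀ = 0`. -/
lemma weilMat_mul (hF : ringChar F ≠ 2) {ψ : AddChar F ℂ} (hψ : ψ.IsPrimitive) (M N : SL(2, F)) :
    weilMat ψ (M * N) = weilMat ψ M * weilMat ψ N := by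
  have h2 : (2 : F) ≠ 0 := Ring.two_ne_zero hF
  obtain ⟨e00, e01, e10, e11⟩ := SL2_mul_entries M N
  have dM := SL2_det M
  have dN := SL2_det N
  have dMN := SL2_det (M * N)
  ext x z
  rw [Matrix.mul_apply]
  generalize hMN : M * N = P at *
  by_cases hM : M 1 0 = 0
  · -- the sum over `y` has the single term `y = ax`
    have ha : M 0 0 ≠ 0 := by rintro h; simp [h, hM] at dM
    have hd : M 0 0 * M 1 1 = 1 := by simpa [hM] using dM
    have hd0 : M 1 1 ≠ 0 := by rintro h; simp [h] at hd
    have hs : ∑ y : F, weilMat ψ M x y * weilMat ψ N y z =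
        quadChar F (M 0 0) * ψ (M 0 0 * M 0 1 * x ^ 2) * weilMat ψ N (M 0 0 * x) z := by
      rw [Finset.sum_eq_single (M 0 0 * x)]
      · rw [weilMat_of_eq_zero ψ hM, if_pos rfl]
      · intro y _ hy
        rw [weilMat_of_eq_zero ψ hM, if_neg hy, zero_mul]
      · simp
    rw [hs]
    by_cases hN : N 1 0 = 0
    · have hP : P 1 0 = 0 := by rw [e10, hM, hN]; ring
      have e00' : P 0 0 = N 0 0 * M 0 0 := by rw [e00, hN]; ring
      rw [weilMat_of_eq_zero ψ hP, weilMat_of_eq_zero ψ hN, e00', e01, mul_assoc (N 0 0)]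
      split_ifs with hz
      · rw [mul_mul_mul_comm, ← map_mul, ← AddChar.map_add_eq_mul, mul_comm (M 0 0) (N 0 0)]
        congr 2
        have : N 0 0 * N 1 1 = 1 := by simpa [hN] using dN
        linear_combination (M 0 0 * M 0 1 * x ^ 2) * this
      · simp
    · have hP : P 1 0 ≠ 0 := by
        rw [e10, hM, zero_mul, zero_add]; exact mul_ne_zero hd0 hN
      have e10' : P 1 0 = (M 0 0)⁻¹ * N 1 0 := by
        rw [e10, hM, zero_mul, zero_add, ← mul_eq_one_iff_eq_inv₀ ha |>.mp (by rw [mul_comm]; exact hd)]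
      have e11' : P 1 1 = (M 0 0)⁻¹ * N 1 1 := by
        rw [e11, hM, zero_mul, zero_add, ← mul_eq_one_iff_eq_inv₀ ha |>.mp (by rw [mul_comm]; exact hd)]
      rw [weilMat_of_ne_zero ψ hP, weilMat_of_ne_zero ψ hN, e10', map_mul, quadChar_inv]
      have : ψ ((P 0 0 * x ^ 2 - 2 * x * z + P 1 1 * z ^ 2) / ((M 0 0)⁻¹ * N 1 0)) =
          ψ (M 0 0 * M 0 1 * x ^ 2) *
          ψ ((N 0 0 * (M 0 0 * x) ^ 2 - 2 * (M 0 0 * x) * z + N 1 1 * z ^ 2) / N 1 0) := by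
        rw [← AddChar.map_add_eq_mul, e00, e11']
        congr 1
        field_simp
        ring
      rw [this]
      ring
  · by_cases hN : N 1 0 = 0
    · have ha : N 0 0 ≠ 0 := by rintro h; simp [h, hN] at dN
      have hd : N 0 0 * N 1 1 = 1 := by simpa [hN] using dN
      have hP : P 1 0 ≠ 0 := by
        rw [e10, hN, mul_zero, add_zero]; exact mul_ne_zero hM ha
      have hs : ∑ y : F, weilMat ψ M x y * weilMat ψ N y z =
          weilMat ψ M x (z / N 0 0) * (quadChar F (N 0 0) * ψ (N 0 0 * N 0 1 * (z / N 0 0) ^ 2)) := by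
        rw [Finset.sum_eq_single (z / N 0 0)]
        · rw [weilMat_of_eq_zero ψ hN, if_pos (by field_simp)]
        · intro y _ hy
          rw [weilMat_of_eq_zero ψ hN, if_neg (fun h => hy (by rw [h]; field_simp)), mul_zero]
        · simp
      rw [hs, weilMat_of_ne_zero ψ hP, weilMat_of_ne_zero ψ hM]
      have e10' : P 1 0 = M 1 0 * N 0 0 := by rw [e10, hN]; ring
      have hd' : N 1 1 = (N 0 0)⁻¹ := eq_inv_of_mul_eq_one_right hd
      have : ψ ((P 0 0 * x ^ 2 - 2 * x * z + P 1 1 * z ^ 2) / P 1 0) =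
          ψ ((M 0 0 * x ^ 2 - 2 * x * (z / N 0 0) + M 1 1 * (z / N 0 0) ^ 2) / M 1 0) *
          ψ (N 0 0 * N 0 1 * (z / N 0 0) ^ 2) := by
        rw [← AddChar.map_add_eq_mul, e00, e11, e10', hN, hd']
        congr 1
        field_simp
        ring
      rw [this, e10', map_mul]
      ring
    · set v : F := x / M 1 0 + z / N 1 0 with hv
      set u : F := P 1 0 / (M 1 0 * N 1 0) with hu
      have hs : ∑ y : F, weilMat ψ M x y * weilMat ψ N y z =
          weilConst ψ ^ 2 * quadChar F (M 1 0 * N 1 0) *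
            ψ (M 0 0 * x ^ 2 / M 1 0 + N 1 1 * z ^ 2 / N 1 0) *
            ∑ y : F, ψ (u * y ^ 2 - 2 * v * y) := by
        rw [Finset.mul_sum]
        refine Finset.sum_congr rfl fun y _ => ?_
        rw [weilMat_of_ne_zero ψ hM, weilMat_of_ne_zero ψ hN, mul_mul_mul_comm,
          ← AddChar.map_add_eq_mul, mul_assoc (_ * _) (ψ _) (ψ _), ← AddChar.map_add_eq_mul, map_mul]
        congr 1
        · ring
        · congr 1
          rw [hu, hv, e10]
          field_simp
          ring
      rw [hs]
      by_cases hP : P 1 0 = 0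
      · have e00' : P 0 0 = -N 1 0 / M 1 0 := by
          rw [hP] at e10
          rw [e00, eq_div_iff hM]
          linear_combination (-M 0 0) * e10 - N 1 0 * dM
        have hsum : ∑ y : F, ψ (u * y ^ 2 - 2 * v * y) =
            if z = P 0 0 * x then (Fintype.card F : ℂ) else 0 := by
          have hu0 : u = 0 := by rw [hu, hP, zero_div]
          have h := AddChar.sum_mulShift (-2 * v) hψ
          rw [Nat.cast_ite, Nat.cast_zero] at h
          have hiff : z = P 0 0 * x ↔ -2 * v = 0 := by
            rw [hv, e00', mul_eq_zero, or_iff_right (neg_ne_zero.mpr h2)]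
            constructor
            · rintro rfl; field_simp; ring
            · intro h
              field_simp at h ⊢
              linear_combination h
          simp only [hu0, hiff]
          rw [← h]
          refine Finset.sum_congr rfl fun y _ => congrArg ψ (by ring)
        rw [hsum, weilMat_of_eq_zero ψ hP]
        split_ifs with hz
        · have e1 : quadChar F (P 0 0) = quadChar F (-1) * quadChar F (M 1 0 * N 1 0) := by
            rw [e00', ← map_mul, neg_div, ← neg_one_mul, map_mul, map_mul, div_eq_mul_inv,
              map_mul, map_mul, quadChar_inv, mul_comm (quadChar F (N 1 0))]
          have e2 : P 0 0 * P 0 1 * x ^ 2 =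
              M 0 0 * x ^ 2 / M 1 0 + N 1 1 * z ^ 2 / N 1 0 := by
            have hN00 : N 0 0 = -(M 1 1 * N 1 0) / M 1 0 := by
              rw [eq_div_iff hM]; linear_combination e10.symm.trans hP
            rw [hz, e00', e01]
            have hx : N 0 1 * N 1 0 = N 0 0 * N 1 1 - 1 := by linear_combination -dN
            have hy : M 0 1 * M 1 0 = M 0 0 * M 1 1 - 1 := by linear_combination -dM
            rw [hN00] at hx
            field_simp at hx ⊢
            linear_combination (-(M 0 0) * x ^ 2) * hx - (N 1 0 * x ^ 2 * N 1 1) * hy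
          rw [e1, e2, ← weilConst_sq hF hψ]
          ring
        · simp
      · have hu0 : u ≠ 0 := div_ne_zero hP (mul_ne_zero hM hN)
        rw [sum_addChar_quadratic hF hψ hu0, weilMat_of_ne_zero ψ hP]
        have e1 : quadChar F (P 1 0) = quadChar F (M 1 0 * N 1 0) * quadChar F u := by
          rw [← map_mul]; congr 1; rw [hu]; field_simp
        have e2 : (P 0 0 * x ^ 2 - 2 * x * z + P 1 1 * z ^ 2) / P 1 0 =
            (M 0 0 * x ^ 2 / M 1 0 + N 1 1 * z ^ 2 / N 1 0) + (-v ^ 2 / u) := by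
          have h3 : P 0 0 * M 1 0 = M 0 0 * P 1 0 - N 1 0 := by
            rw [e00, e10]; linear_combination (-N 1 0) * dM
          have h4 : P 1 1 * N 1 0 = N 1 1 * P 1 0 - M 1 0 := by
            rw [e11, e10]; linear_combination (-M 1 0) * dN
          rw [hv, hu]
          field_simp
          linear_combination (N 1 0 * x ^ 2) * h3 + (M 1 0 * z ^ 2) * h4
        rw [e1, e2, AddChar.map_add_eq_mul]
        have h5 := weilConst_mul_gaussSum hF hψ
        linear_combination (-(weilConst ψ * quadChar F (M 1 0 * N 1 0) * quadChar F u *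
          ψ (M 0 0 * x ^ 2 / M 1 0 + N 1 1 * z ^ 2 / N 1 0) * ψ (-v ^ 2 / u))) * h5

end FiniteField

/-! ### The exponential on `ℚ/ℤ` -/

lemma e_zero : e 0 = 1 := by simp [e]

lemma e_ne_zero (z : ℂ) : e z ≠ 0 := Complex.exp_ne_zero _

lemma e_neg (z : ℂ) : e (-z) = (e z)⁻¹ := by simp [e, Complex.exp_neg]

lemma e_int (n : ℤ) : e n = 1 := by
  rw [e, mul_comm]; exact Complex.exp_int_mul_two_pi_mul_I n

lemma e_nat_mul (n : ℕ) (z : ℂ) : e (n * z) = e z ^ n := by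
  rw [e, e, ← Complex.exp_nat_mul]; congr 1; ring

lemma e_eq_one_iff (r : ℚ) : e (r : ℂ) = 1 ↔ ∃ n : ℤ, r = n := by
  rw [e, Complex.exp_eq_one_iff]
  have h : (2 * Real.pi * Complex.I : ℂ) ≠ 0 := Complex.two_pi_I_ne_zero
  constructor
  · rintro ⟨n, hn⟩
    refine ⟨n, ?_⟩
    rw [mul_comm] at hn
    exact_mod_cast mul_right_cancel₀ h hn
  · rintro ⟨n, rfl⟩
    exact ⟨n, by push_cast; ring⟩

lemma e_half : e (1 / 2) = -1 := by
  rw [e, show (2 * Real.pi * Complex.I * (1 / 2) : ℂ) = Real.pi * Complex.I by ring,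
    Complex.exp_pi_mul_I]

lemma e_quarter : e (1 / 4) = Complex.I := by
  rw [e, show (2 * Real.pi * Complex.I * (1 / 4) : ℂ) = Real.pi / 2 * Complex.I by ring,
    Complex.exp_pi_div_two_mul_I]

lemma eQZ_coe (r : ℚ) : eQZ (r : AddCircle (1 : ℚ)) = e (r : ℂ) := rfl

lemma eQZ_add (x y : AddCircle (1 : ℚ)) : eQZ (x + y) = eQZ x * eQZ y := by
  induction x using QuotientAddGroup.induction_on with | _ x
  induction y using QuotientAddGroup.induction_on with | _ y
  rw [← AddCircle.coe_add, eQZ_coe, eQZ_coe, eQZ_coe, ← e_add]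
  push_cast; rfl

lemma eQZ_zero : eQZ 0 = 1 := by
  have := eQZ_coe 0
  rw [AddCircle.coe_zero] at this
  simpa [e_zero] using this

lemma eQZ_ne_zero (x : AddCircle (1 : ℚ)) : eQZ x ≠ 0 := by
  induction x using QuotientAddGroup.induction_on with | _ x
  exact e_ne_zero _

lemma eQZ_neg (x : AddCircle (1 : ℚ)) : eQZ (-x) = (eQZ x)⁻¹ := by
  rw [eq_comm, inv_eq_iff_eq_inv, eq_comm, ← one_div, div_eq_iff (eQZ_ne_zero _), ← eQZ_add,
    add_neg_cancel, eQZ_zero]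

lemma eQZ_eq_one_iff (x : AddCircle (1 : ℚ)) : eQZ x = 1 ↔ x = 0 := by
  induction x using QuotientAddGroup.induction_on with | _ x
  rw [eQZ_coe, e_eq_one_iff, AddCircle.coe_eq_zero_iff]
  simp [eq_comm]

/-! ### Coordinates on the discriminant form -/

section Coordinates

variable {A : Type*} [AddCommGroup A] {p : ℕ} [Fact p.Prime]

/-- The value `e(δx²/4)` for `x ∈ ℤ/2ℤ` and `δ = ±1`. -/
def quart (δ : ℤ) (x : ZMod 2) : ℂ := if x = 0 then 1 else δ * Complex.I

/-- The value `(-1)^(xy)` for `x, y ∈ ℤ/2ℤ`. -/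
def sgnTwo (x y : ZMod 2) : ℂ := if x = 0 ∨ y = 0 then 1 else -1

/-- `E : A ≅ ℤ/2ℤ × ℤ/pℤ` identifies `Q` with `δx²/4 + αy²/p`. -/
structure IsCoord (Q : QuadraticMap ℤ A (AddCircle (1 : ℚ))) (δ α : ℤ)
    (E : A ≃+ ZMod 2 × ZMod p) : Prop where
  odd : p ≠ 2
  delta : δ = 1 ∨ δ = -1
  alpha : (α : ZMod p) ≠ 0
  form : ∀ γ, Q γ =
    (((δ : ℚ) * ((E γ).1.val : ℚ) ^ 2 / 4 + (α : ℚ) * ((E γ).2.val : ℚ) ^ 2 / (p : ℚ) : ℚ) :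
      AddCircle (1 : ℚ))

/-- The additive character `x ↦ e(-αx/p)`. -/
def psi (p : ℕ) [Fact p.Prime] (α : ℤ) : AddChar (ZMod p) ℂ :=
  (ZMod.stdAddChar (N := p)).mulShift (-(α : ZMod p))

lemma psi_apply (α : ℤ) (x : ZMod p) : psi p α x = ZMod.stdAddChar (-(α : ZMod p) * x) := rfl

lemma psi_primitive {α : ℤ} (hα : (α : ZMod p) ≠ 0) : (psi p α).IsPrimitive := by
  have h := ZMod.isPrimitive_stdAddChar p (neg_ne_zero.mpr hα)
  exact AddChar.IsPrimitive.of_ne_one h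

lemma stdAddChar_val (p : ℕ) [Fact p.Prime] (j : ℤ) :
    (ZMod.stdAddChar (j : ZMod p) : ℂ) = e ((((j : ℚ) / (p : ℚ) : ℚ)) : ℂ) := by
  rw [ZMod.stdAddChar_coe, e]
  congr 1
  push_cast
  ring

variable {Q : QuadraticMap ℤ A (AddCircle (1 : ℚ))} {δ α : ℤ} {E : A ≃+ ZMod 2 × ZMod p}

/-- The coordinates `γ ↦ (γ mod 2, γ mod p)`. -/
def coordEquiv (hp : p ≠ 2) (ι : A ≃+ ZMod (2 * p)) : A ≃+ ZMod 2 × ZMod p :=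
  ι.trans (ZMod.chineseRemainder
    ((Nat.coprime_primes Nat.prime_two (Fact.out (p := p.Prime))).mpr hp.symm)).toAddEquiv

lemma coordEquiv_fst (hp : p ≠ 2) (ι : A ≃+ ZMod (2 * p)) (γ : A) :
    (coordEquiv hp ι γ).1 = ZMod.castHom (dvd_mul_right 2 p) (ZMod 2) (ι γ) := by
  have : (RingHom.fst (ZMod 2) (ZMod p)).comp (ZMod.chineseRemainder
    ((Nat.coprime_primes Nat.prime_two (Fact.out (p := p.Prime))).mpr hp.symm)).toRingHom =
    ZMod.castHom (dvd_mul_right 2 p) (ZMod 2) := Subsingleton.elim _ _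
  exact congrArg (fun f => f (ι γ)) this

lemma coordEquiv_snd (hp : p ≠ 2) (ι : A ≃+ ZMod (2 * p)) (γ : A) :
    (coordEquiv hp ι γ).2 = ZMod.castHom (dvd_mul_left p 2) (ZMod p) (ι γ) := by
  have : (RingHom.snd (ZMod 2) (ZMod p)).comp (ZMod.chineseRemainder
    ((Nat.coprime_primes Nat.prime_two (Fact.out (p := p.Prime))).mpr hp.symm)).toRingHom =
    ZMod.castHom (dvd_mul_left p 2) (ZMod p) := Subsingleton.elim _ _
  exact congrArg (fun f => f (ι γ)) this

lemma charAt_eq (hp : p ≠ 2) (ι : A ≃+ ZMod (2 * p)) (χ : DirichletCharacter ℂ p) (γ : A) :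
    charAt ι χ γ = χ (coordEquiv hp ι γ).2 := by
  rw [charAt, coordEquiv_snd]

lemma coord_int (hp : p ≠ 2) (ι : A ≃+ ZMod (2 * p)) (n : ℤ) :
    coordEquiv hp ι (ι.symm (n : ZMod (2 * p))) = ((n : ZMod 2), (n : ZMod p)) := by
  ext
  · rw [coordEquiv_fst]; simp
  · rw [coordEquiv_snd]; simp

lemma coord_eq_zero (hp : p ≠ 2) (ι : A ≃+ ZMod (2 * p)) (γ : A) :
    ι γ = 0 ↔ coordEquiv hp ι γ = 0 := by
  simp

lemma odd_of_ne_two (hp : p ≠ 2) : Odd p := (Fact.out (p := p.Prime)).odd_of_ne_two hp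

lemma zmodTwo_cast_odd {n : ℤ} (hn : Odd n) : (n : ZMod 2) = 1 := by
  obtain ⟨k, rfl⟩ := hn
  have h : (2 : ZMod 2) = 0 := rfl
  push_cast
  rw [h]; ring

lemma coord_eq_p (hp : p ≠ 2) (ι : A ≃+ ZMod (2 * p)) (γ : A) :
    ι γ = (p : ZMod (2 * p)) ↔ coordEquiv hp ι γ = (1, 0) := by
  have h := coord_int hp ι (p : ℤ)
  rw [zmodTwo_cast_odd (by exact_mod_cast odd_of_ne_two hp)] at h
  simp only [Int.cast_natCast, CharP.cast_eq_zero] at h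
  rw [← h, (coordEquiv hp ι).apply_eq_iff_eq, AddEquiv.eq_symm_apply]

lemma isCoord_of_standardForm (hp : p ≠ 2) {ι : A ≃+ ZMod (2 * p)} (h : IsStandardForm Q δ α ι) :
    IsCoord Q δ α (coordEquiv hp ι) := by
  obtain ⟨hδ, hα, hQ⟩ := h
  have hp0 : (p : ℚ) ≠ 0 := by exact_mod_cast (Fact.out (p := p.Prime)).ne_zero
  have hodd := odd_of_ne_two hp
  refine ⟨hp, hδ, fun h => hα ((ZMod.intCast_zmod_eq_zero_iff_dvd α p).mp h), fun γ => ?_⟩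
  set x := (coordEquiv hp ι γ).1 with hx
  set y := (coordEquiv hp ι γ).2 with hy
  -- an even representative of `y`
  obtain ⟨n, k, hn, hnk⟩ : ∃ n k : ℤ, Even n ∧ n = y.val + p * k := by
    rcases Nat.even_or_odd y.val with h | h
    · exact ⟨y.val, 0, by exact_mod_cast h, by ring⟩
    · exact ⟨(y.val + p : ℕ), 1, by exact_mod_cast h.add_odd hodd, by push_cast; ring⟩
  have hγ : γ = ι.symm (((p : ℤ) * (x.val : ℤ) + n : ℤ) : ZMod (2 * p)) := by
    apply (coordEquiv hp ι).injective
    rw [coord_int]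
    ext
    · have h1 : ((n : ℤ) : ZMod 2) = 0 := by
        rw [ZMod.intCast_zmod_eq_zero_iff_dvd]; exact_mod_cast hn.two_dvd
      have h2 : ((p : ℤ) : ZMod 2) = 1 := zmodTwo_cast_odd (by exact_mod_cast hodd)
      rw [Int.cast_add, Int.cast_mul, h1, h2]
      simp [hx]
    · simp [hnk, hy]
  conv_lhs => rw [hγ]
  rw [hQ _ _ hn, ← sub_eq_zero, ← AddCircle.coe_sub, AddCircle.coe_eq_zero_iff]
  refine ⟨α * (2 * y.val * k + p * k ^ 2), ?_⟩
  rw [hnk]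
  push_cast
  simp only [zsmul_eq_mul, mul_one]
  push_cast
  field_simp
  ring

lemma IsCoord.delta_sq (h : IsCoord Q δ α E) : ((δ : ℂ) * Complex.I) * (δ * Complex.I) = -1 := by
  rcases h.delta with rfl | rfl <;> simp

lemma zmodTwo_cases (x : ZMod 2) : x = 0 ∨ x = 1 := by
  revert x; decide

lemma quart_zero (δ : ℤ) : quart δ 0 = 1 := by simp [quart]

lemma quart_one (δ : ℤ) : quart δ 1 = δ * Complex.I := by simp [quart]

/-- `e(Q(γ))` in coordinates. -/
lemma IsCoord.eQZ_form (h : IsCoord Q δ α E) (γ : A) :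
    eQZ (Q γ) = quart δ (E γ).1 * psi p α (-(E γ).2 ^ 2) := by
  rw [h.form γ, AddCircle.coe_add, eQZ_add]
  congr 1
  · rw [eQZ_coe]
    rcases zmodTwo_cases (E γ).1 with h0 | h0
    · rw [h0]; simp [quart_zero, e_zero]
    · rw [h0, quart_one, ZMod.val_one]
      rcases h.delta with rfl | rfl
      · have := e_quarter
        norm_num at this ⊢
        exact this
      · have := e_quarter
        norm_num at this ⊢
        rw [e_neg, this, Complex.inv_I]
  · rw [eQZ_coe, psi_apply, neg_mul_neg]
    have := stdAddChar_val p (α * ((E γ).2.val : ℤ) ^ 2)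
    push_cast at this ⊢
    rw [← this]
    simp

lemma IsCoord.neg_snd_sq (h : IsCoord Q δ α E) (γ : A) :
    eQZ (-Q γ) = (quart δ (E γ).1)⁻¹ * psi p α ((E γ).2 ^ 2) := by
  rw [eQZ_neg, h.eQZ_form, mul_inv, ← AddChar.map_neg_eq_inv, neg_neg]

lemma IsCoord.quart_add (h : IsCoord Q δ α E) (x y : ZMod 2) :
    quart δ (x + y) = quart δ x * quart δ y * sgnTwo x y := by
  have h11 : (1 + 1 : ZMod 2) = 0 := rfl
  rcases zmodTwo_cases x with rfl | rfl <;> rcases zmodTwo_cases y with rfl | rfl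
  · simp [sgnTwo, quart_zero]
  · simp [sgnTwo, quart_zero]
  · simp [sgnTwo, quart_zero]
  · rw [h11, quart_zero, quart_one, h.delta_sq]; simp [sgnTwo]

/-- `e(⟨β, γ⟩)` in coordinates. -/
lemma IsCoord.eQZ_polar (h : IsCoord Q δ α E) (β γ : A) :
    eQZ (QuadraticMap.polar Q β γ) =
      sgnTwo (E β).1 (E γ).1 * psi p α (-2 * (E β).2 * (E γ).2) := by
  have h1 : eQZ (QuadraticMap.polar Q β γ) * eQZ (Q γ) * eQZ (Q β) = eQZ (Q (β + γ)) := by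
    rw [← eQZ_add, ← eQZ_add, QuadraticMap.polar]; congr 1; abel
  have h2 : eQZ (Q (β + γ)) =
      sgnTwo (E β).1 (E γ).1 * psi p α (-2 * (E β).2 * (E γ).2) * eQZ (Q γ) * eQZ (Q β) := by
    rw [h.eQZ_form, h.eQZ_form, h.eQZ_form, map_add, Prod.fst_add, Prod.snd_add, h.quart_add,
      show -((E β).2 + (E γ).2) ^ 2 = (-2 * (E β).2 * (E γ).2) + (-(E γ).2 ^ 2) + (-(E β).2 ^ 2)
        by ring, AddChar.map_add_eq_mul, AddChar.map_add_eq_mul]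
    ring
  rw [h2] at h1
  exact mul_right_cancel₀ (eQZ_ne_zero _) (mul_right_cancel₀ (eQZ_ne_zero _) h1)

lemma ringChar_ne_two (hp : p ≠ 2) : ringChar (ZMod p) ≠ 2 := by
  rwa [ZMod.ringChar_zmod_n]

lemma IsCoord.two_ne_zero (h : IsCoord Q δ α E) : (2 : ZMod p) ≠ 0 :=
  Ring.two_ne_zero (ringChar_ne_two h.odd)

lemma IsCoord.four_ne_zero (h : IsCoord Q δ α E) : (4 : ZMod p) ≠ 0 := by
  rw [show (4 : ZMod p) = 2 * 2 by norm_num]; exact mul_ne_zero h.two_ne_zero h.two_ne_zero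

lemma IsCoord.quart_pow_four (h : IsCoord Q δ α E) (x : ZMod 2) : quart δ x ^ 4 = 1 := by
  rcases zmodTwo_cases x with rfl | rfl
  · simp [quart_zero]
  · rw [quart_one, show ((δ : ℂ) * Complex.I) ^ 4 =
      ((δ * Complex.I) * (δ * Complex.I)) * ((δ * Complex.I) * (δ * Complex.I)) by ring,
      h.delta_sq]; norm_num

lemma IsCoord.quart_injective (h : IsCoord Q δ α E) : Function.Injective (quart δ) := by
  have hne : (δ : ℂ) * Complex.I ≠ 1 := by
    intro h'
    have := h.delta_sq
    rw [h'] at this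
    norm_num at this
  intro x y hxy
  rcases zmodTwo_cases x with rfl | rfl <;> rcases zmodTwo_cases y with rfl | rfl
  · rfl
  · rw [quart_zero, quart_one] at hxy; exact absurd hxy.symm hne
  · rw [quart_zero, quart_one] at hxy; exact absurd hxy hne
  · rfl

lemma psi_injective {α : ℤ} (hα : (α : ZMod p) ≠ 0) : Function.Injective (psi p α) := by
  intro x y hxy
  rw [psi_apply, psi_apply] at hxy
  exact mul_left_cancel₀ (neg_ne_zero.mpr hα) (ZMod.injective_stdAddChar hxy)

/-- `Q` takes the same value at `γ` and `γ'` only if `γ' = ±γ`. -/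
lemma IsCoord.eq_or_eq_neg (h : IsCoord Q δ α E) {γ γ' : A} (hQ : Q γ' = Q γ) :
    γ' = γ ∨ γ' = -γ := by
  have h1 : quart δ (E γ').1 * psi p α (-(E γ').2 ^ 2) =
      quart δ (E γ).1 * psi p α (-(E γ).2 ^ 2) := by
    rw [← h.eQZ_form, ← h.eQZ_form, hQ]
  have h2 : (E γ').2 ^ 2 = (E γ).2 ^ 2 := by
    have h3 := congrArg (· ^ 4) h1
    simp only [mul_pow, h.quart_pow_four, one_mul, ← AddChar.map_nsmul_eq_pow] at h3
    have h4 := psi_injective h.alpha h3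
    simp only [nsmul_eq_mul, Nat.cast_ofNat] at h4
    exact neg_injective (mul_left_cancel₀ h.four_ne_zero h4)
  have h5 : (E γ').1 = (E γ).1 := by
    rw [h2] at h1
    exact h.quart_injective (mul_right_cancel₀ (AddChar.val_isUnit _ _).ne_zero h1)
  rcases sq_eq_sq_iff_eq_or_eq_neg.mp h2 with h6 | h6
  · exact Or.inl (E.injective (Prod.ext h5 h6))
  · refine Or.inr (E.injective ?_)
    rw [map_neg]
    refine Prod.ext ?_ h6
    rw [h5, Prod.fst_neg, ZMod.neg_eq_self_mod_two]

/-- `pQ(γ)` determines the parity of `γ`. -/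
lemma IsCoord.parity (h : IsCoord Q δ α E) {γ : A} {m : ℤ}
    (hm : Q γ = (((m : ℚ) / (4 * (p : ℚ)) : ℚ) : AddCircle (1 : ℚ))) :
    Even m ↔ (E γ).1 = 0 := by
  have hp0 : (p : ℂ) ≠ 0 := by exact_mod_cast (Fact.out (p := p.Prime)).ne_zero
  have h1 : eQZ (Q γ) ^ (2 * p) = (-1) ^ m := by
    rw [hm, eQZ_coe, ← e_nat_mul, ← e_half, e, e, ← Complex.exp_int_mul]
    congr 1
    push_cast
    field_simp
    ring
  have h2 : eQZ (Q γ) ^ (2 * p) = if (E γ).1 = 0 then 1 else -1 := by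
    rw [h.eQZ_form, mul_pow, ← AddChar.map_nsmul_eq_pow]
    have h3 : (2 * p) • (-(E γ).2 ^ 2) = 0 := by simp
    rw [h3, AddChar.map_zero_eq_one, mul_one]
    rcases zmodTwo_cases (E γ).1 with h0 | h0
    · simp [h0, quart_zero]
    · rw [h0, quart_one, pow_mul, pow_two, h.delta_sq, Odd.neg_one_pow (odd_of_ne_two h.odd)]
      simp
  rw [h1] at h2
  constructor
  · intro he
    by_contra hne
    rw [if_neg hne, he.neg_one_zpow] at h2
    norm_num at h2
  · intro h0
    by_contra hne
    rw [if_pos h0, (Int.not_even_iff_odd.mp hne).neg_one_zpow] at h2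
    norm_num at h2

lemma IsCoord.exists_num (h : IsCoord Q δ α E) (γ : A) :
    ∃ m : ℤ, Q γ = (((m : ℚ) / (4 * (p : ℚ)) : ℚ) : AddCircle (1 : ℚ)) := by
  have hp0 : (p : ℚ) ≠ 0 := by exact_mod_cast (Fact.out (p := p.Prime)).ne_zero
  refine ⟨δ * (E γ).1.val ^ 2 * p + 4 * α * (E γ).2.val ^ 2, ?_⟩
  rw [h.form γ]
  congr 1
  push_cast
  field_simp

lemma IsCoord.isEven_iff (h : IsCoord Q δ α E) (γ : A) : IsEven p Q γ ↔ (E γ).1 = 0 := by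
  constructor
  · rintro ⟨m, hm, hQ⟩
    exact (h.parity hQ).mp hm
  · intro h0
    obtain ⟨m, hm⟩ := h.exists_num γ
    exact ⟨m, (h.parity hm).mpr h0, hm⟩

lemma IsCoord.isOdd_iff (h : IsCoord Q δ α E) (γ : A) : IsOdd p Q γ ↔ (E γ).1 = 1 := by
  have hx : (E γ).1 = 1 ↔ ¬ (E γ).1 = 0 := by
    rcases zmodTwo_cases (E γ).1 with h0 | h0 <;> simp [h0]
  rw [hx]
  constructor
  · rintro ⟨m, hm, hQ⟩
    rw [← h.parity hQ]; exact Int.not_even_iff_odd.mpr hm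
  · intro h0
    obtain ⟨m, hm⟩ := h.exists_num γ
    rw [← h.parity hm, Int.not_even_iff_odd] at h0
    exact ⟨m, h0, hm⟩

/-! ### The signature -/

/-- The sign `(-1/p)`. -/
def eta (p : ℕ) [Fact p.Prime] : ℂ := quadChar (ZMod p) (-1)

lemma eta_mul_self (p : ℕ) [Fact p.Prime] : eta p * eta p = 1 := quadChar_mul_self (by simp)

lemma IsCoord.weilConst_sq (h : IsCoord Q δ α E) : weilConst (psi p α) ^ 2 * p = eta p := by
  have := TwistedSum.weilConst_sq (ringChar_ne_two h.odd) (psi_primitive (p := p) h.alpha)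
  rwa [ZMod.card] at this

variable [Fintype A]

lemma IsCoord.card (_h : IsCoord Q δ α E) : Fintype.card A = 2 * p := by
  rw [Fintype.card_congr E.toEquiv, Fintype.card_prod, ZMod.card, ZMod.card]

lemma sum_coord (E : A ≃+ ZMod 2 × ZMod p) (f : ZMod 2 → ZMod p → ℂ) :
    ∑ γ : A, f (E γ).1 (E γ).2 = ∑ y : ZMod p, (f 0 y + f 1 y) := by
  refine (Equiv.sum_comp E.toEquiv (fun z => f z.1 z.2)).trans ?_
  rw [Fintype.sum_prod_type_right]
  refine Finset.sum_congr rfl fun y _ => ?_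
  exact Fin.sum_univ_two (fun x : ZMod 2 => f x y)

lemma IsCoord.sum_eQZ (h : IsCoord Q δ α E) :
    ∑ γ : A, eQZ (Q γ) = (1 + δ * Complex.I) * (p * weilConst (psi p α)) := by
  simp only [h.eQZ_form]
  rw [sum_coord E (fun x y => quart δ x * psi p α (-y ^ 2))]
  simp only [← add_mul, ← Finset.mul_sum, quart_zero, quart_one]
  congr 1
  have := sum_addChar_mul_sq (ringChar_ne_two h.odd) (psi_primitive (p := p) h.alpha)
    (u := -1) (by simp)
  simp only [neg_one_mul] at this
  have hp0 : (p : ℂ) ≠ 0 := by exact_mod_cast (Fact.out (p := p.Prime)).ne_zero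
  rw [this, weilConst, ZMod.card]
  field_simp

lemma sqrt_sq_complex (n : ℕ) : ((Real.sqrt n : ℝ) : ℂ) ^ 2 = n := by
  rw [← Complex.ofReal_pow, Real.sq_sqrt (Nat.cast_nonneg n)]; simp

lemma sqrt_ne_zero_complex {n : ℕ} (hn : n ≠ 0) : ((Real.sqrt n : ℝ) : ℂ) ≠ 0 := by
  intro h
  have := sqrt_sq_complex n
  rw [h] at this
  simp at this
  exact hn (by exact_mod_cast this.symm)

lemma IsCoord.gauss_sq (h : IsCoord Q δ α E) :
    (((Real.sqrt (Fintype.card A) : ℝ) : ℂ)⁻¹ * ∑ γ : A, eQZ (Q γ)) ^ 2 =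
      δ * Complex.I * eta p := by
  have hp0 : (p : ℂ) ≠ 0 := by exact_mod_cast (Fact.out (p := p.Prime)).ne_zero
  rw [mul_pow, inv_pow, sqrt_sq_complex, h.sum_eQZ, h.card, ← h.weilConst_sq]
  have h1 : (1 + δ * Complex.I) ^ 2 = 2 * (δ * Complex.I) := by
    linear_combination h.delta_sq
  rw [mul_pow, h1]
  push_cast
  field_simp

/-- The normalized Gauss sum of `Q` is an eighth root of unity, hence the signature exists. -/
lemma IsCoord.eSig_eq_gauss (h : IsCoord Q δ α E) :
    eSig Q = ((Real.sqrt (Fintype.card A) : ℝ) : ℂ)⁻¹ * ∑ γ : A, eQZ (Q γ) := by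
  set z := ((Real.sqrt (Fintype.card A) : ℝ) : ℂ)⁻¹ * ∑ γ : A, eQZ (Q γ) with hz
  have h8 : z ^ 8 = 1 := by
    have h4 : z ^ 4 = -1 := by
      rw [show z ^ 4 = z ^ 2 * z ^ 2 by ring, h.gauss_sq]
      linear_combination (eta p * eta p) * h.delta_sq - eta_mul_self p
    rw [show z ^ 8 = z ^ 4 * z ^ 4 by ring, h4]; norm_num
  have hex : ∃ s : ZMod 8, e ((s.val : ℂ) / 8) = z := by
    obtain ⟨i, hi, hzi⟩ := (Complex.isPrimitiveRoot_exp 8 (by norm_num)).eq_pow_of_pow_eq_one h8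
    refine ⟨(i : ZMod 8), ?_⟩
    rw [ZMod.val_natCast_of_lt hi, ← hzi, e, ← Complex.exp_nat_mul]
    congr 1
    push_cast
    ring
  exact Classical.epsilon_spec hex

lemma IsCoord.eSig_sq (h : IsCoord Q δ α E) : eSig Q ^ 2 = δ * Complex.I * eta p := by
  rw [h.eSig_eq_gauss, h.gauss_sq]

lemma IsCoord.eSig_div (h : IsCoord Q δ α E) :
    eSig Q / ((Real.sqrt (Fintype.card A) : ℝ) : ℂ) =
      (1 + δ * Complex.I) / 2 * weilConst (psi p α) := by
  have hp0 : (p : ℂ) ≠ 0 := by exact_mod_cast (Fact.out (p := p.Prime)).ne_zero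
  have hc : ((Real.sqrt (Fintype.card A) : ℝ) : ℂ) ^ 2 = 2 * p := by
    rw [sqrt_sq_complex, h.card]; push_cast; rfl
  rw [h.eSig_eq_gauss, h.sum_eQZ, mul_comm, mul_div_assoc, inv_eq_one_div, div_div, ← pow_two, hc]
  field_simp

end Coordinates

/-! ### The theta multiplier as a cocycle -/

/-- The range of the principal square root. -/
def PrincipalHalf (w : ℂ) : Prop := 0 < w.re ∨ (w.re = 0 ∧ 0 ≤ w.im)

lemma principalHalf_sqrt (z : ℂ) : PrincipalHalf (z ^ (1 / 2 : ℂ)) := by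
  rw [one_div]
  rcases (show 0 ≤ (z ^ (2⁻¹ : ℂ)).re by
    rw [Complex.cpow_inv_two_re]; positivity).lt_or_eq with h | h
  · exact Or.inl h
  · refine Or.inr ⟨h.symm, ?_⟩
    by_contra him
    rcases lt_or_ge z.im 0 with hz | hz
    · have hsq : (z ^ (2⁻¹ : ℂ)) ^ 2 = z := by
        rw [← Complex.cpow_nat_mul]; simp
      have := congrArg Complex.im hsq
      rw [pow_two, Complex.mul_im, ← h] at this
      simp at this
      linarith
    · rw [Complex.cpow_inv_two_im_eq_sqrt hz] at him
      exact him (Real.sqrt_nonneg _)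

lemma sqrt_sq (z : ℂ) : (z ^ (1 / 2 : ℂ)) ^ 2 = z := by
  rw [← Complex.cpow_nat_mul]; simp

lemma PrincipalHalf.eq_of_sq_eq {w w' : ℂ} (h : PrincipalHalf w) (h' : PrincipalHalf w')
    (hsq : w ^ 2 = w' ^ 2) : w = w' := by
  rcases sq_eq_sq_iff_eq_or_eq_neg.mp hsq with h1 | h1
  · exact h1
  · subst h1
    simp only [PrincipalHalf, Complex.neg_re, Complex.neg_im] at h
    rcases h with h | ⟨h, hi⟩ <;> rcases h' with h' | ⟨h', hi'⟩
    · linarith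
    · linarith
    · linarith
    · have : w' = 0 := Complex.ext h' (by simp; linarith)
      simp [this]

lemma PrincipalHalf.sqrt_eq {w z : ℂ} (h : PrincipalHalf w) (hsq : w ^ 2 = z) :
    z ^ (1 / 2 : ℂ) = w :=
  (principalHalf_sqrt z).eq_of_sq_eq h (by rw [sqrt_sq, hsq])

lemma sqrt_quadrant {z : ℂ} (hz : 0 < z.im) :
    0 < (z ^ (1 / 2 : ℂ)).re ∧ 0 < (z ^ (1 / 2 : ℂ)).im := by
  have h := congrArg Complex.im (sqrt_sq z)
  rw [pow_two, Complex.mul_im] at h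
  rcases principalHalf_sqrt z with h1 | ⟨h1, -⟩
  · exact ⟨h1, by nlinarith⟩
  · rw [h1] at h; simp at h; linarith

lemma sqrt_quadrant_neg {z : ℂ} (hz : z.im < 0) :
    0 < (z ^ (1 / 2 : ℂ)).re ∧ (z ^ (1 / 2 : ℂ)).im < 0 := by
  have h := congrArg Complex.im (sqrt_sq z)
  rw [pow_two, Complex.mul_im] at h
  rcases principalHalf_sqrt z with h1 | ⟨h1, -⟩
  · exact ⟨h1, by nlinarith⟩
  · rw [h1] at h; simp at h; linarith

lemma sqrt_nonneg_im {z : ℂ} (hz : 0 ≤ z.im) :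
    0 ≤ (z ^ (1 / 2 : ℂ)).re ∧ 0 ≤ (z ^ (1 / 2 : ℂ)).im := by
  have h := congrArg Complex.im (sqrt_sq z)
  rw [pow_two, Complex.mul_im] at h
  rcases principalHalf_sqrt z with h1 | ⟨h1, h2⟩
  · exact ⟨h1.le, by nlinarith⟩
  · exact ⟨h1.ge, h2⟩

lemma sqrt_mul_of_neg {A B : ℂ} (hA : A.im < 0) (hB : 0 < B.im) :
    (A * B) ^ (1 / 2 : ℂ) = A ^ (1 / 2 : ℂ) * B ^ (1 / 2 : ℂ) := by
  obtain ⟨a1, a2⟩ := sqrt_quadrant_neg hA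
  obtain ⟨b1, b2⟩ := sqrt_quadrant hB
  refine PrincipalHalf.sqrt_eq (Or.inl ?_) (by rw [mul_pow, sqrt_sq, sqrt_sq])
  rw [Complex.mul_re]; nlinarith [mul_pos a1 b1]

lemma sqrt_mul_of_nonneg {A B : ℂ} (hA0 : A ≠ 0) (hA : 0 ≤ A.im) (hB : 0 < B.im) :
    A ^ (1 / 2 : ℂ) * B ^ (1 / 2 : ℂ) =
      if 0 ≤ (A * B).im then (A * B) ^ (1 / 2 : ℂ) else -(A * B) ^ (1 / 2 : ℂ) := by
  obtain ⟨a1, a2⟩ := sqrt_nonneg_im hA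
  obtain ⟨b1, b2⟩ := sqrt_quadrant hB
  have ha : (A ^ (1 / 2 : ℂ)) ≠ 0 := by
    intro h; apply hA0; rw [← sqrt_sq A, h]; simp
  have hsq : (A ^ (1 / 2 : ℂ) * B ^ (1 / 2 : ℂ)) ^ 2 = A * B := by
    rw [mul_pow, sqrt_sq, sqrt_sq]
  set w := A ^ (1 / 2 : ℂ) * B ^ (1 / 2 : ℂ) with hw
  have him : 0 < w.im := by
    rw [hw, Complex.mul_im]
    rcases a1.lt_or_eq with h | h
    · nlinarith [mul_pos h b2, mul_nonneg a2 b1.le]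
    · rcases a2.lt_or_eq with h' | h'
      · nlinarith [mul_pos h' b1, mul_nonneg a1 b2.le]
      · exact absurd (Complex.ext h.symm h'.symm) ha
  have h2 : 2 * (w.re * w.im) = (A * B).im := by
    rw [← hsq, pow_two w, Complex.mul_im w w]; ring
  split_ifs with h
  · refine (PrincipalHalf.sqrt_eq ?_ hsq).symm
    rcases (show 0 ≤ w.re by nlinarith).lt_or_eq with h3 | h3
    · exact Or.inl h3
    · exact Or.inr ⟨h3.symm, him.le⟩
  · rw [eq_comm, neg_eq_iff_eq_neg]
    refine PrincipalHalf.sqrt_eq (Or.inl ?_) (by rw [neg_sq, hsq])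
    rw [Complex.neg_re]; nlinarith

lemma sqrt_neg_of_pos {z : ℂ} (hz : 0 < z.im) :
    (-z) ^ (1 / 2 : ℂ) = -Complex.I * z ^ (1 / 2 : ℂ) := by
  obtain ⟨b1, b2⟩ := sqrt_quadrant hz
  refine PrincipalHalf.sqrt_eq (Or.inl ?_) ?_
  · simpa using b2
  · rw [mul_pow, sqrt_sq]; simp

/-- `ν_ϑ(M) √(cτ + d)` with the principal square root. -/
def thetaFactor (M : SL(2, ℤ)) (τ : ℍ) : ℂ := thetaMult M * cd M τ ^ (1 / 2 : ℂ)

lemma cd_im (M : SL(2, ℤ)) (τ : ℍ) : (cd M τ).im = M 1 0 * τ.im := by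
  simp [cd]

lemma jacobiSym_reflect {a m n : ℕ} (hm : Odd m) (hn : Odd n) (h : 4 * a ∣ m + n) :
    jacobiSym a m = jacobiSym a n := by
  rcases Nat.eq_zero_or_pos a with rfl | ha
  · rw [mul_zero, zero_dvd_iff] at h
    obtain ⟨k, hk⟩ := hm
    omega
  obtain ⟨k, b, hb, rfl⟩ := Nat.exists_eq_two_pow_mul_odd ha.ne'
  have e4 : (m : ZMod 4) = -(n : ZMod 4) := by
    rw [eq_neg_iff_add_eq_zero, ← Nat.cast_add, ZMod.natCast_eq_zero_iff]
    exact (dvd_mul_right 4 _).trans h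
  have eb : (b : ℤ) ∣ (m : ℤ) - (-(n : ℤ)) := by
    rw [sub_neg_eq_add]
    have : b ∣ m + n := (Dvd.intro_left (4 * 2 ^ k) (by ring)).trans h
    exact_mod_cast this
  have hχ : ∀ x : ZMod 4, ZMod.χ₄ (-x) = -ZMod.χ₄ x := by decide
  have hb1 : jacobiSym b m = jacobiSym b n := by
    rw [jacobiSym.quadratic_reciprocity' hb hm, jacobiSym.quadratic_reciprocity' hb hn, qrSign,
      qrSign, e4, hχ,
      jacobiSym.mod_left' (Int.modEq_iff_dvd.mpr eb).symm,
      jacobiSym.neg _ hb, jacobiSym.neg _ hb]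
    have h1 : ZMod.χ₄ (b : ZMod 4) * ZMod.χ₄ (b : ZMod 4) = 1 := by
      rcases ZMod.χ₄_nat_eq_if_mod_four b with h'
      rw [h']
      have := Nat.odd_iff.mp hb
      rw [if_neg (by omega)]
      split_ifs <;> norm_num
    linear_combination (jacobiSym (ZMod.χ₄ (n : ZMod 4)) b * jacobiSym n b) * h1
  have hk1 : jacobiSym ((2 : ℤ) ^ k) m = jacobiSym ((2 : ℤ) ^ k) n := by
    rcases Nat.eq_zero_or_pos k with rfl | hk
    · simp [jacobiSym.one_left]
    · have e8 : (m : ZMod 8) = -(n : ZMod 8) := by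
        rw [eq_neg_iff_add_eq_zero, ← Nat.cast_add, ZMod.natCast_eq_zero_iff]
        obtain ⟨j, rfl⟩ : ∃ j, k = j + 1 := ⟨k - 1, by omega⟩
        exact (Dvd.intro (2 ^ j * b) (by ring)).trans h
      have hχ8 : ∀ x : ZMod 8, ZMod.χ₈ (-x) = ZMod.χ₈ x := by decide
      rw [jacobiSym.pow_left, jacobiSym.pow_left, jacobiSym.at_two hm, jacobiSym.at_two hn, e8, hχ8]
  push_cast
  rw [jacobiSym.mul_left, jacobiSym.mul_left, hb1, hk1]

/-- For positive `c` divisible by `4`, the symbol `(c/d)` has period `c` in `d`. -/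
lemma thetaSymbol_add {c d : ℤ} (hc : 0 < c) (h4 : c % 4 = 0) (hd : Odd d) :
    thetaSymbol c (d + c) = thetaSymbol c d := by
  obtain ⟨a, rfl⟩ : ∃ a : ℕ, c = 4 * a := ⟨(c / 4).toNat, by omega⟩
  have key : ∀ m : ℕ, Odd m → jacobiSym (4 * a : ℤ) m = jacobiSym a m := by
    intro m hm
    rw [jacobiSym.mul_left, jacobiSym.at_four hm, one_mul]
  have o1 : Odd d.natAbs := Int.natAbs_odd.mpr hd
  have o2 : Odd (d + 4 * a).natAbs := Int.natAbs_odd.mpr (hd.add_even ⟨2 * a, by ring⟩)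
  rw [thetaSymbol, thetaSymbol, if_neg (by omega), if_neg (by omega), key _ o1, key _ o2]
  rcases le_total 0 d with h0 | h0
  · have : (d + 4 * a).natAbs = d.natAbs + 4 * a := by omega
    rw [this, jacobiSym.mod_right' a (this ▸ o2), Nat.add_mod_right, ← jacobiSym.mod_right' a o1]
  · rcases le_total 0 (d + 4 * a) with h1 | h1
    · exact jacobiSym_reflect o2 o1 ⟨1, by omega⟩
    · have : d.natAbs = (d + 4 * a).natAbs + 4 * a := by omega
      rw [jacobiSym.mod_right' a o1, this, Nat.add_mod_right, ← jacobiSym.mod_right' a o2]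

lemma epsd_add {c d : ℤ} (h4 : c % 4 = 0) : epsd (d + c) = epsd d := by
  rw [epsd, epsd, show (d + c) % 4 = d % 4 by omega]

lemma SL2Z_mul_entries (M N : SL(2, ℤ)) :
    (M * N) 0 0 = M 0 0 * N 0 0 + M 0 1 * N 1 0 ∧ (M * N) 0 1 = M 0 0 * N 0 1 + M 0 1 * N 1 1 ∧
    (M * N) 1 0 = M 1 0 * N 0 0 + M 1 1 * N 1 0 ∧
    (M * N) 1 1 = M 1 0 * N 0 1 + M 1 1 * N 1 1 := SL2_mul_entries M N

/-- The lower row of `M` is divisible by four and odd. -/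
def LowerFour (M : SL(2, ℤ)) : Prop := M 1 0 % 4 = 0

lemma LowerFour.odd {M : SL(2, ℤ)} (h : LowerFour M) : Odd (M 1 1) := by
  have hd := SL2_det M
  have h2 : Even (M 0 1 * M 1 0) := Even.mul_left (by rw [Int.even_iff]; rw [LowerFour] at h; omega) _
  have h3 : Odd (M 0 0 * M 1 1) := by
    rw [show M 0 0 * M 1 1 = 1 + M 0 1 * M 1 0 by linarith]
    exact odd_one.add_even h2
  exact (Int.odd_mul.mp h3).2

/-- `(1, 0; 4, 1)`. -/
def lowerFour : SL(2, ℤ) := ⟨!![1, 0; 4, 1], by simp [Matrix.det_fin_two]⟩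

lemma mul_T_entries (M : SL(2, ℤ)) :
    (M * ModularGroup.T) 0 0 = M 0 0 ∧ (M * ModularGroup.T) 0 1 = M 0 0 + M 0 1 ∧
    (M * ModularGroup.T) 1 0 = M 1 0 ∧ (M * ModularGroup.T) 1 1 = M 1 1 + M 1 0 := by
  obtain ⟨h1, h2, h3, h4⟩ := SL2Z_mul_entries M ModularGroup.T
  rw [h1, h2, h3, h4]
  simp [ModularGroup.T, add_comm]

lemma mul_lowerFour_entries (M : SL(2, ℤ)) :
    (M * lowerFour) 0 0 = M 0 0 + 4 * M 0 1 ∧ (M * lowerFour) 0 1 = M 0 1 ∧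
    (M * lowerFour) 1 0 = M 1 0 + 4 * M 1 1 ∧ (M * lowerFour) 1 1 = M 1 1 := by
  obtain ⟨h1, h2, h3, h4⟩ := SL2Z_mul_entries M lowerFour
  rw [h1, h2, h3, h4]
  simp [lowerFour, mul_comm]

lemma det_of_lower_zero {M : SL(2, ℤ)} (h : M 1 0 = 0) :
    (M 0 0 = 1 ∧ M 1 1 = 1) ∨ (M 0 0 = -1 ∧ M 1 1 = -1) := by
  have hd := SL2_det M
  rw [h, mul_zero, sub_zero] at hd
  exact Int.mul_eq_one_iff_eq_one_or_neg_one.mp hd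

lemma thetaFactor_mul_T {M : SL(2, ℤ)} (h : LowerFour M) (hc : 0 ≤ M 1 0) (τ : ℍ) :
    thetaFactor (M * ModularGroup.T) τ = thetaFactor M (ModularGroup.T • τ) := by
  obtain ⟨-, -, h3, h4⟩ := mul_T_entries M
  have h5 : cd (M * ModularGroup.T) τ = cd M (ModularGroup.T • τ) := by
    rw [cd_mul]; simp [cd, ModularGroup.T]
  rw [thetaFactor, thetaFactor, h5, thetaMult, thetaMult, h3, h4, epsd_add h]
  rcases hc.lt_or_eq with hc | hc
  · rw [thetaSymbol_add hc h h.odd]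
  · rw [← hc, add_zero]

lemma thetaFactor_mul_lowerFour (M : SL(2, ℤ)) (τ : ℍ) :
    thetaFactor (M * lowerFour) τ =
      thetaFactor M (lowerFour • τ) * cd lowerFour τ ^ (1 / 2 : ℂ) := by
  obtain ⟨-, -, h3, h4⟩ := mul_lowerFour_entries M
  have hB : 0 < (cd lowerFour τ).im := by
    rw [cd_im]; simp [lowerFour, τ.im_pos]
  have hAB : cd (M * lowerFour) τ = cd M (lowerFour • τ) * cd lowerFour τ := cd_mul _ _ _
  have hj : jacobiSym (M 1 0 + 4 * M 1 1) (M 1 1).natAbs = jacobiSym (M 1 0) (M 1 1).natAbs := by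
    apply jacobiSym.mod_left'
    refine Int.ModEq.symm (Int.modEq_iff_dvd.mpr ?_)
    rw [add_sub_cancel_left, Int.natAbs_dvd]
    exact dvd_mul_left _ _
  have hAim := cd_im M (lowerFour • τ)
  have hABim := cd_im (M * lowerFour) τ
  have i1 := (lowerFour • τ).im_pos
  have i2 := τ.im_pos
  rw [thetaFactor, thetaFactor, mul_assoc, thetaMult, thetaMult, h3, h4, thetaSymbol, thetaSymbol, hj]
  rcases lt_or_ge (M 1 0) 0 with hc | hc
  · rw [hAB, sqrt_mul_of_neg (by rw [hAim]; exact mul_neg_of_neg_of_pos (by exact_mod_cast hc) i1) hB]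
    by_cases hd : M 1 1 < 0
    · rw [if_pos ⟨by linarith, hd⟩, if_pos ⟨hc, hd⟩]
    · rw [if_neg (by tauto), if_neg (by tauto)]
  · rw [sqrt_mul_of_nonneg (cd_ne_zero _ _)
      (by rw [hAim]; exact mul_nonneg (by exact_mod_cast hc) i1.le) hB, ← hAB, hABim, h3,
      if_neg (c := M 1 0 < 0 ∧ M 1 1 < 0) (by rintro ⟨h, -⟩; linarith)]
    by_cases hn : 0 ≤ M 1 0 + 4 * M 1 1
    · rw [if_neg (by rintro ⟨h, -⟩; linarith),
        if_pos (mul_nonneg (by exact_mod_cast hn) i2.le)]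
    · push Not at hn
      rw [if_pos ⟨hn, by linarith⟩,
        if_neg (not_le.mpr (mul_neg_of_neg_of_pos (by exact_mod_cast hn) i2))]
      push_cast
      ring

lemma thetaFactor_neg_aux {M : SL(2, ℤ)} (h : LowerFour M) (hc : 0 < M 1 0) (τ : ℍ) :
    thetaFactor (-M) τ = thetaFactor M τ := by
  have hd := h.odd
  have e3 : (-M) 1 0 = -(M 1 0) := rfl
  have e4 : (-M) 1 1 = -(M 1 1) := rfl
  have hcd : cd (-M) τ = -cd M τ := by
    rw [cd, cd, e3, e4]; push_cast; ring
  have him : 0 < (cd M τ).im := by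
    rw [cd_im]; exact mul_pos (by exact_mod_cast hc) τ.im_pos
  have ho : Odd (M 1 1).natAbs := Int.natAbs_odd.mpr hd
  rw [thetaFactor, thetaFactor, hcd, sqrt_neg_of_pos him, ← mul_assoc]
  congr 1
  rw [thetaMult, thetaMult, e3, e4, thetaSymbol, thetaSymbol, Int.natAbs_neg, jacobiSym.neg _ ho,
    if_neg (c := M 1 0 < 0 ∧ M 1 1 < 0) (by rintro ⟨h, -⟩; linarith), epsd, epsd,
    ZMod.χ₄_nat_eq_if_mod_four]
  have h2 := Int.odd_iff.mp hd
  have h2' := Nat.odd_iff.mp ho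
  have hI := Complex.I_mul_I
  rw [if_neg (show ¬ (M 1 1).natAbs % 2 = 0 by omega)]
  rcases lt_or_ge (M 1 1) 0 with hs | hs
  · rw [if_neg (by omega)]
    rcases (show M 1 1 % 4 = 1 ∨ M 1 1 % 4 = 3 by omega) with h5 | h5
    · rw [if_neg (by omega), if_neg (by omega), if_pos h5]
      push_cast
      rw [Complex.inv_I]
      linear_combination (-(jacobiSym (M 1 0) (M 1 1).natAbs : ℂ)) * hI
    · rw [if_pos (by omega), if_pos (by omega), if_neg (by omega)]
      simp
  · rw [if_pos ⟨by linarith, by omega⟩]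
    rcases (show M 1 1 % 4 = 1 ∨ M 1 1 % 4 = 3 by omega) with h5 | h5
    · rw [if_pos (by omega), if_neg (by omega), if_pos h5]
      push_cast
      rw [Complex.inv_I]
      linear_combination (-(jacobiSym (M 1 0) (M 1 1).natAbs : ℂ)) * hI
    · rw [if_neg (by omega), if_pos (by omega), if_neg (by omega)]
      push_cast
      simp

lemma sqrt_neg_one : (-1 : ℂ) ^ (1 / 2 : ℂ) = Complex.I :=
  PrincipalHalf.sqrt_eq (Or.inr ⟨by simp, by simp⟩) (by simp)

lemma thetaFactor_lower_zero {M : SL(2, ℤ)} (h : M 1 0 = 0) (τ : ℍ) : thetaFactor M τ = 1 := by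
  rw [thetaFactor, thetaMult, cd, h]
  rcases det_of_lower_zero h with ⟨-, h1⟩ | ⟨-, h1⟩
  · rw [h1]; simp [thetaSymbol, epsd]
  · rw [h1]
    have : ((0 : ℤ) : ℂ) * (τ : ℂ) + ((-1 : ℤ) : ℂ) = -1 := by push_cast; ring
    rw [this, sqrt_neg_one]
    simp [thetaSymbol, epsd]

lemma thetaFactor_neg {M : SL(2, ℤ)} (h : LowerFour M) (τ : ℍ) :
    thetaFactor (-M) τ = thetaFactor M τ := by
  have e3 : (-M) 1 0 = -(M 1 0) := rfl
  rcases lt_trichotomy (M 1 0) 0 with hc | hc | hc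
  · have h' : LowerFour (-M) := by rw [LowerFour] at h ⊢; rw [e3]; omega
    have := thetaFactor_neg_aux h' (by rw [e3]; omega) τ
    rw [neg_neg] at this
    exact this.symm
  · rw [thetaFactor_lower_zero hc, thetaFactor_lower_zero (by rw [e3, hc, neg_zero])]
  · exact thetaFactor_neg_aux h hc τ

/-- Quadratic reciprocity for the theta multiplier: multiplying `c` by `4p` changes `ν_ϑ` by the
quadratic character mod `p` and, if `p ≡ 3 mod 4`, by an inversion. -/
lemma thetaMult_reciprocity {p : ℕ} [Fact p.Prime] (hp : p ≠ 2) {M M' : SL(2, ℤ)}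
    (hc : M 1 0 = 4 * p * M' 1 0) (hd : M 1 1 = M' 1 1) (hodd : Odd (M 1 1))
    (hpd : ((M 1 1 : ℤ) : ZMod p) ≠ 0) (hcop : IsCoprime (M 1 0) (M 1 1)) :
    (p % 4 = 1 → thetaMult M' * quadChar (ZMod p) ((M 1 1 : ℤ) : ZMod p) = thetaMult M) ∧
    (p % 4 = 3 → thetaMult M' * quadChar (ZMod p) ((M 1 1 : ℤ) : ZMod p) = (thetaMult M)⁻¹) := by
  set d := M 1 1 with hd'
  set c := M' 1 0 with hc'
  have hp0 : 0 < p := (Fact.out (p := p.Prime)).pos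
  have hpo := odd_of_ne_two hp
  have ho : Odd d.natAbs := Int.natAbs_odd.mpr hodd
  have h2 := Int.odd_iff.mp hodd
  -- the quadratic character as a Jacobi symbol
  have hq : quadChar (ZMod p) ((d : ℤ) : ZMod p) = (jacobiSym d p : ℂ) := by
    rw [← jacobiSym.legendreSym.to_jacobiSym]; rfl
  have hsign : (4 * p * c < 0 ∧ d < 0) ↔ (c < 0 ∧ d < 0) := by
    have : 4 * (p : ℤ) * c < 0 ↔ c < 0 := by
      have : (0 : ℤ) < 4 * p := by positivity
      constructor
      · intro h; by_contra h'; push Not at h'; nlinarith [mul_nonneg this.le h']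
      · intro h; exact mul_neg_of_pos_of_neg this h
    rw [this]
  have hsym : thetaSymbol (4 * p * c) d = thetaSymbol c d * jacobiSym p d.natAbs := by
    rw [thetaSymbol, thetaSymbol, jacobiSym.mul_left, jacobiSym.mul_left, jacobiSym.at_four ho]
    simp only [hsign]
    split_ifs <;> ring
  have hone : (thetaSymbol (4 * p * c) d : ℂ) * (thetaSymbol (4 * p * c) d : ℂ) = 1 := by
    have hg : Int.gcd (4 * p * c) d.natAbs = 1 := by
      rw [hc] at hcop
      have := Int.isCoprime_iff_gcd_eq_one.mp hcop
      rw [Int.gcd, Int.natAbs_natCast]; exact this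
    have h1 := jacobiSym.sq_one hg
    rw [pow_two] at h1
    have h3 : thetaSymbol (4 * p * c) d * thetaSymbol (4 * p * c) d = 1 := by
      rw [thetaSymbol]
      split_ifs
      · rw [neg_mul_neg, h1]
      · exact h1
    exact_mod_cast h3
  have hjp : (jacobiSym d p) * jacobiSym p d.natAbs =
      if p % 4 = 1 then 1 else if d % 4 = 1 then 1 else -1 := by
    have hnz : jacobiSym d p * jacobiSym d p = 1 := by
      rw [← jacobiSym.legendreSym.to_jacobiSym, ← pow_two, legendreSym.sq_one p hpd]
    have hdd : jacobiSym d p = (if d < 0 then jacobiSym (-1) p else 1) * jacobiSym d.natAbs p := by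
      split_ifs with h
      · rw [← jacobiSym.mul_left]; congr 1; omega
      · rw [one_mul]; congr 1; omega
    have hm1 := jacobiSym.at_neg_one hpo
    rw [ZMod.χ₄_nat_eq_if_mod_four, if_neg (by have := Nat.odd_iff.mp hpo; omega)] at hm1
    have hR := jacobiSym.quadratic_reciprocity_if (Nat.odd_iff.mp hpo) (Nat.odd_iff.mp ho)
    rw [← hR]
    rw [hm1] at hdd
    set J := jacobiSym d.natAbs p with hJ
    have hJJ : J * J = 1 := by
      rw [hdd] at hnz
      split_ifs at hnz <;> linarith
    rw [hdd]
    have := Nat.odd_iff.mp hpo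
    have := Nat.odd_iff.mp ho
    rcases (show p % 4 = 1 ∨ p % 4 = 3 by omega) with h4 | h4
    · simp [h4, hJJ]
    · simp only [h4]
      rcases lt_or_ge d 0 with hs | hs
      · rcases (show d % 4 = 1 ∨ d % 4 = 3 by omega) with h5 | h5
        · have : d.natAbs % 4 = 3 := by omega
          simp [hs, h5, this, hJJ]
        · have : d.natAbs % 4 = 1 := by omega
          simp [hs, h5, this, hJJ]
      · rcases (show d % 4 = 1 ∨ d % 4 = 3 by omega) with h5 | h5
        · have : d.natAbs % 4 = 1 := by omega
          simp [not_lt.mpr hs, h5, this, hJJ]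
        · have : d.natAbs % 4 = 3 := by omega
          simp [not_lt.mpr hs, h5, this, hJJ]
  have hJJ : (jacobiSym p d.natAbs : ℂ) * jacobiSym p d.natAbs * (thetaSymbol c d * thetaSymbol c d) = 1 := by
    rw [hsym] at hone; push_cast at hone; linear_combination hone
  have hpp : (jacobiSym p d.natAbs : ℂ) * jacobiSym p d.natAbs = 1 := by
    rcases jacobiSym.trichotomy p d.natAbs with h | h | h
    · rw [h] at hJJ; simp at hJJ
    · rw [h]; simp
    · rw [h]; simp
  have hjp' : (jacobiSym d p : ℂ) =
      (if p % 4 = 1 then 1 else if d % 4 = 1 then 1 else -1) * jacobiSym p d.natAbs := by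
    have : ((jacobiSym d p * jacobiSym p d.natAbs : ℤ) : ℂ) =
      (if p % 4 = 1 then 1 else if d % 4 = 1 then 1 else -1) := by
      rw [hjp]; split_ifs <;> simp
    push_cast at this
    rw [← this, mul_assoc, hpp, mul_one]
  rw [thetaMult, thetaMult, ← hd, hc, ← hc', ← hd', hq, hjp']
  constructor
  · intro h4
    rw [if_pos h4, hsym]
    push_cast
    ring
  · intro h4
    rw [if_neg (by omega), mul_inv, inv_inv, ← eq_inv_of_mul_eq_one_left hone, hsym, epsd]
    push_cast
    split_ifs
    · simp
    · simp; ring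

/-! ### The dual Weil representation in coordinates -/

section Tensor

variable {A : Type*} [AddCommGroup A] [Fintype A] [DecidableEq A] {p : ℕ} [Fact p.Prime]
  {Q : QuadraticMap ℤ A (AddCircle (1 : ℚ))} {δ α : ℤ} {E : A ≃+ ZMod 2 × ZMod p}

/-- The Weil representation of `SL₂(ℤ)` on `ℂ[ℤ/pℤ]`, through `SL₂(ℤ/pℤ)`. -/
def weilP (p : ℕ) [Fact p.Prime] (α : ℤ) (M : SL(2, ℤ)) : Matrix (ZMod p) (ZMod p) ℂ :=
  weilMat (psi p α) (Matrix.SpecialLinearGroup.map (Int.castRingHom (ZMod p)) M)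

lemma map_entry (M : SL(2, ℤ)) (i j : Fin 2) :
    (Matrix.SpecialLinearGroup.map (Int.castRingHom (ZMod p)) M) i j = ((M i j : ℤ) : ZMod p) := rfl

/-- The tensor product of a matrix on `ℂ[ℤ/2ℤ]` with the `p`-part of the Weil representation at `M`,
as a matrix on `ℂ[A]`. -/
def tens (α : ℤ) (E : A ≃+ ZMod 2 × ZMod p) (L : Matrix (ZMod 2) (ZMod 2) ℂ) (M : SL(2, ℤ)) :
    Matrix A A ℂ :=
  Matrix.of fun β γ => L (E β).1 (E γ).1 * weilP p α M (E β).2 (E γ).2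

lemma IsCoord.weilP_mul (h : IsCoord Q δ α E) (M N : SL(2, ℤ)) :
    weilP p α (M * N) = weilP p α M * weilP p α N := by
  rw [weilP, map_mul, weilMat_mul (ringChar_ne_two h.odd) (psi_primitive h.alpha)]; rfl

lemma IsCoord.tens_mul (h : IsCoord Q δ α E) (L L' : Matrix (ZMod 2) (ZMod 2) ℂ) (M N : SL(2, ℤ)) :
    tens α E L M * tens α E L' N = tens α E (L * L') (M * N) := by
  ext β γ
  rw [Matrix.mul_apply]
  simp only [tens, Matrix.of_apply]
  refine (Equiv.sum_comp E.toEquiv (fun z : ZMod 2 × ZMod p =>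
    L (E β).1 z.1 * weilP p α M (E β).2 z.2 * (L' z.1 (E γ).1 * weilP p α N z.2 (E γ).2))).trans ?_
  rw [Fintype.sum_prod_type, h.weilP_mul, Matrix.mul_apply, Matrix.mul_apply, Finset.sum_mul_sum]
  refine Finset.sum_congr rfl fun x _ => Finset.sum_congr rfl fun y _ => by ring

lemma tens_one (α : ℤ) (E : A ≃+ ZMod 2 × ZMod p) : tens α E 1 1 = 1 := by
  ext β γ
  rw [tens, weilP, map_one, weilMat_one, Matrix.of_apply, Matrix.one_apply, Matrix.one_apply,
    Matrix.one_apply]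
  by_cases hβ : β = γ
  · simp [hβ]
  · rw [if_neg hβ]
    by_cases h1 : (E β).1 = (E γ).1
    · by_cases h2 : (E β).2 = (E γ).2
      · exact absurd (E.injective (Prod.ext h1 h2)) hβ
      · simp [h2]
    · simp [h1]

/-- The `2`-part of `ρ*(S)`. -/
def twoS (δ : ℤ) : Matrix (ZMod 2) (ZMod 2) ℂ :=
  Matrix.of fun x y => (1 + δ * Complex.I) / 2 * sgnTwo x y

/-- The `2`-part of `ρ*(T)`. -/
def twoT (δ : ℤ) : Matrix (ZMod 2) (ZMod 2) ℂ := Matrix.diagonal fun x => (quart δ x)⁻¹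

lemma IsCoord.weilS_eq (h : IsCoord Q δ α E) : weilS Q = tens α E (twoS δ) ModularGroup.S := by
  ext β γ
  have h1 : (Matrix.SpecialLinearGroup.map (Int.castRingHom (ZMod p)) ModularGroup.S) 1 0 ≠ 0 := by
    rw [map_entry]; simp [ModularGroup.S]
  rw [weilS, tens, Matrix.of_apply, Matrix.of_apply, weilP, weilMat_of_ne_zero _ h1, map_entry,
    map_entry, map_entry, h.eQZ_polar, h.eSig_div]
  simp only [ModularGroup.S, twoS, Matrix.of_apply]
  simp
  ring

lemma IsCoord.weilT_eq (h : IsCoord Q δ α E) : weilT Q = tens α E (twoT δ) ModularGroup.T := by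
  ext β γ
  have h1 : (Matrix.SpecialLinearGroup.map (Int.castRingHom (ZMod p)) ModularGroup.T) 1 0 = 0 := by
    rw [map_entry]; simp [ModularGroup.T]
  rw [weilT, tens, Matrix.of_apply, weilP, weilMat_of_eq_zero _ h1, map_entry, map_entry, twoT,
    Matrix.diagonal_apply, Matrix.diagonal_apply]
  by_cases hβ : β = γ
  · subst hβ
    simp [ModularGroup.T, h.neg_snd_sq]
  · rw [if_neg hβ]
    by_cases h2 : (E β).1 = (E γ).1
    · rw [if_pos h2, if_neg, mul_zero]
      intro h3
      refine hβ (E.injective (Prod.ext h2 ?_))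
      simpa [ModularGroup.T] using h3.symm
    · rw [if_neg h2, zero_mul]

lemma IsCoord.twoS_mul_self (h : IsCoord Q δ α E) :
    twoS δ * twoS δ = Matrix.diagonal fun _ => (δ : ℂ) * Complex.I := by
  have hd := h.delta_sq
  ext x y
  rw [Matrix.mul_apply, Matrix.diagonal_apply]
  refine (Fin.sum_univ_two (fun z : ZMod 2 => twoS δ x z * twoS δ z y)).trans ?_
  change twoS δ x 0 * twoS δ 0 y + twoS δ x 1 * twoS δ 1 y = _
  simp only [twoS, Matrix.of_apply]
  rcases zmodTwo_cases x with rfl | rfl <;> rcases zmodTwo_cases y with rfl | rfl <;>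
    simp [sgnTwo] <;> linear_combination (1 / 2 : ℂ) * hd

lemma IsCoord.delta_I_ne_zero (h : IsCoord Q δ α E) : (δ : ℂ) * Complex.I ≠ 0 := by
  intro h'
  have := h.delta_sq
  rw [h'] at this
  norm_num at this

lemma IsCoord.quart_ne_zero (h : IsCoord Q δ α E) (x : ZMod 2) : quart δ x ≠ 0 := by
  intro h'
  have := h.quart_pow_four x
  rw [h'] at this
  norm_num at this

lemma IsCoord.dual_mul (h : IsCoord Q δ α E) {g g' : Mp2Z} {L L' : Matrix (ZMod 2) (ZMod 2) ℂ}
    (hg : DualWeil Q g (tens α E L g.mat)) (hg' : DualWeil Q g' (tens α E L' g'.mat)) :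
    DualWeil Q (g * g') (tens α E (L * L') (g * g').mat) := by
  rw [Mp2Z.mul_mat, ← h.tens_mul]
  exact hg.mul hg'

lemma IsCoord.dual_inv (h : IsCoord Q δ α E) {g : Mp2Z} {L L' : Matrix (ZMod 2) (ZMod 2) ℂ}
    (hg : DualWeil Q g (tens α E L g.mat)) (h1 : L * L' = 1) (h2 : L' * L = 1) :
    DualWeil Q g⁻¹ (tens α E L' g⁻¹.mat) := by
  refine hg.inv ?_ ?_
  · rw [h.tens_mul, h1, Mp2Z.inv_mat, mul_inv_cancel, tens_one]
  · rw [h.tens_mul, h2, Mp2Z.inv_mat, inv_mul_cancel, tens_one]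

lemma IsCoord.dual_S (h : IsCoord Q δ α E) :
    DualWeil Q Mp2Z.S (tens α E (twoS δ) Mp2Z.S.mat) := by
  have := DualWeil.S (Q := Q)
  rwa [h.weilS_eq] at this

lemma IsCoord.dual_T (h : IsCoord Q δ α E) :
    DualWeil Q Mp2Z.T (tens α E (twoT δ) Mp2Z.T.mat) := by
  have := DualWeil.T (Q := Q)
  rwa [h.weilT_eq] at this

lemma IsCoord.twoS_inv (h : IsCoord Q δ α E) :
    twoS δ * ((Matrix.diagonal fun _ => ((δ : ℂ) * Complex.I)⁻¹) * twoS δ) = 1 ∧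
    ((Matrix.diagonal fun _ => ((δ : ℂ) * Complex.I)⁻¹) * twoS δ) * twoS δ = 1 := by
  have h0 := h.delta_I_ne_zero
  have hs : (Matrix.diagonal fun _ : ZMod 2 => ((δ : ℂ) * Complex.I)⁻¹) =
      ((δ : ℂ) * Complex.I)⁻¹ • (1 : Matrix (ZMod 2) (ZMod 2) ℂ) := by
    rw [Matrix.smul_one_eq_diagonal]
  have hs' : (Matrix.diagonal fun _ : ZMod 2 => ((δ : ℂ) * Complex.I)) =
      ((δ : ℂ) * Complex.I) • (1 : Matrix (ZMod 2) (ZMod 2) ℂ) := by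
    rw [Matrix.smul_one_eq_diagonal]
  constructor
  · rw [hs, smul_mul_assoc, one_mul, mul_smul_comm, h.twoS_mul_self, hs', smul_smul,
      inv_mul_cancel₀ h0, one_smul]
  · rw [hs, smul_mul_assoc, one_mul, smul_mul_assoc, h.twoS_mul_self, hs', smul_smul,
      inv_mul_cancel₀ h0, one_smul]

/-- Every element of `SL₂(ℤ)` lifts to an element of `Mp₂(ℤ)` on which `ρ*` is defined. -/
lemma IsCoord.exists_dualWeil (h : IsCoord Q δ α E) (M : SL(2, ℤ)) :
    ∃ (g : Mp2Z) (L : Matrix A A ℂ), g.mat = M ∧ DualWeil Q g L := by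
  suffices key : ∃ (g : Mp2Z) (L L' : Matrix (ZMod 2) (ZMod 2) ℂ), g.mat = M ∧
      DualWeil Q g (tens α E L g.mat) ∧ L * L' = 1 ∧ L' * L = 1 by
    obtain ⟨g, L, L', h1, h2, -⟩ := key
    exact ⟨g, _, h1, h2⟩
  have hM : M ∈ Subgroup.closure {ModularGroup.S, ModularGroup.T} := by
    rw [SpecialLinearGroup.SL2Z_generators]; trivial
  induction hM using Subgroup.closure_induction with
  | mem x hx =>
    rcases hx with rfl | rfl
    · exact ⟨Mp2Z.S, _, _, rfl, h.dual_S, h.twoS_inv.1, h.twoS_inv.2⟩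
    · refine ⟨Mp2Z.T, _, Matrix.diagonal fun x => quart δ x, rfl, h.dual_T, ?_, ?_⟩
      · rw [twoT, Matrix.diagonal_mul_diagonal]
        simp [h.quart_ne_zero]
      · rw [twoT, Matrix.diagonal_mul_diagonal]
        simp [h.quart_ne_zero]
  | one => exact ⟨1, 1, 1, rfl, by rw [Mp2Z.one_mat, tens_one]; exact DualWeil.one, by simp, by simp⟩
  | mul x y _ _ hx hy =>
    obtain ⟨g, L, L', h1, h2, h3, h4⟩ := hx
    obtain ⟨g', K, K', h1', h2', h3', h4'⟩ := hy
    refine ⟨g * g', L * K, K' * L', by rw [Mp2Z.mul_mat, h1, h1'], h.dual_mul h2 h2', ?_, ?_⟩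
    · rw [mul_assoc, ← mul_assoc K, h3', one_mul, h3]
    · rw [mul_assoc, ← mul_assoc L', h4, one_mul, h4']
  | inv x _ hx =>
    obtain ⟨g, L, L', h1, h2, h3, h4⟩ := hx
    exact ⟨g⁻¹, L', L, by rw [Mp2Z.inv_mat, h1], h.dual_inv h2 h3 h4, h4, h3⟩

/-! ### The action of `Γ₀(4)` on the `2`-part -/

/-- `ρ*(g)` acts on the `2`-part by the diagonal matrix with entries `l`, `l e(δn/4)`. -/
def DiagLift (Q : QuadraticMap ℤ A (AddCircle (1 : ℚ))) (δ α : ℤ) (E : A ≃+ ZMod 2 × ZMod p)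
    (g : Mp2Z) (l : ℂ) (n : ℤ) : Prop :=
  l ≠ 0 ∧ DualWeil Q g (tens α E (Matrix.diagonal fun x => l * quart δ x ^ n) g.mat)

lemma DiagLift.mul (h : IsCoord Q δ α E) {g g' : Mp2Z} {l l' : ℂ} {n n' : ℤ}
    (hg : DiagLift Q δ α E g l n) (hg' : DiagLift Q δ α E g' l' n') :
    DiagLift Q δ α E (g * g') (l * l') (n + n') := by
  refine ⟨mul_ne_zero hg.1 hg'.1, ?_⟩
  have := h.dual_mul hg.2 hg'.2
  rw [Matrix.diagonal_mul_diagonal] at this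
  have he : (fun x => l * quart δ x ^ n * (l' * quart δ x ^ n')) =
      fun x => l * l' * quart δ x ^ (n + n') := by
    funext x
    rw [zpow_add₀ (h.quart_ne_zero x)]; ring
  rwa [he] at this

lemma DiagLift.inv (h : IsCoord Q δ α E) {g : Mp2Z} {l : ℂ} {n : ℤ} (hg : DiagLift Q δ α E g l n) :
    DiagLift Q δ α E g⁻¹ l⁻¹ (-n) := by
  have hq := h.quart_ne_zero
  have hl := hg.1
  refine ⟨inv_ne_zero hg.1, h.dual_inv hg.2 ?_ ?_⟩
  all_goals
    rw [Matrix.diagonal_mul_diagonal, ← Matrix.diagonal_one]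
    congr 1
    funext x
    have := zpow_ne_zero n (hq x)
    rw [zpow_neg]
    field_simp

lemma IsCoord.diagLift_one (_h : IsCoord Q δ α E) : DiagLift Q δ α E 1 1 0 := by
  refine ⟨one_ne_zero, ?_⟩
  have : (Matrix.diagonal fun x => 1 * quart δ x ^ (0 : ℤ)) = 1 := by
    rw [← Matrix.diagonal_one]; simp
  rw [this, Mp2Z.one_mat, tens_one]
  exact DualWeil.one

lemma IsCoord.diagLift_T (h : IsCoord Q δ α E) : DiagLift Q δ α E Mp2Z.T 1 (-1) := by
  refine ⟨one_ne_zero, ?_⟩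
  have := h.dual_T
  rw [twoT] at this
  simpa using this

/-- A lift of `-1`. -/
def liftNeg : Mp2Z := Mp2Z.S * Mp2Z.S

lemma S_mul_S : ModularGroup.S * ModularGroup.S = -1 := by
  decide

lemma liftNeg_mat : liftNeg.mat = -1 := S_mul_S

lemma IsCoord.diagLift_neg (h : IsCoord Q δ α E) :
    DiagLift Q δ α E liftNeg (δ * Complex.I) 0 := by
  refine ⟨h.delta_I_ne_zero, ?_⟩
  have := h.dual_mul h.dual_S h.dual_S
  rw [h.twoS_mul_self] at this
  simp only [zpow_zero, mul_one]
  exact this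

lemma root_S (τ : ℍ) : 0 < (Mp2Z.S.root τ).re ∧ 0 < (Mp2Z.S.root τ).im :=
  sqrt_quadrant (z := (τ : ℂ)) τ.im_pos

lemma liftNeg_root (τ : ℍ) : liftNeg.root τ = Complex.I := by
  have h1 := liftNeg.root_sq τ
  rw [liftNeg_mat] at h1
  have h2 : cd (-1) τ = -1 := by simp [cd]
  rw [h2, ← Complex.I_sq] at h1
  rcases sq_eq_sq_iff_eq_or_eq_neg.mp h1 with h3 | h3
  · exact h3
  · exfalso
    obtain ⟨a1, a2⟩ := root_S τ
    obtain ⟨b1, b2⟩ := root_S (Mp2Z.S.mat • τ)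
    have h4 : liftNeg.root τ = Mp2Z.S.root (Mp2Z.S.mat • τ) * Mp2Z.S.root τ := rfl
    rw [h4] at h3
    have := congrArg Complex.im h3
    rw [Complex.mul_im, Complex.neg_im, Complex.I_im] at this
    nlinarith [mul_pos b1 a2, mul_pos b2 a1]

/-- A lift of `(1, 0; 4, 1) = S⁻¹T⁻⁴S`. -/
def liftLowerFour : Mp2Z :=
  Mp2Z.S⁻¹ * (Mp2Z.T⁻¹ * Mp2Z.T⁻¹ * Mp2Z.T⁻¹ * Mp2Z.T⁻¹) * Mp2Z.S

lemma liftLowerFour_mat : liftLowerFour.mat = lowerFour := by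
  simp only [liftLowerFour, Mp2Z.mul_mat, Mp2Z.inv_mat]
  change ModularGroup.S⁻¹ * (ModularGroup.T⁻¹ * ModularGroup.T⁻¹ * ModularGroup.T⁻¹ *
    ModularGroup.T⁻¹) * ModularGroup.S = lowerFour
  decide

lemma IsCoord.diagLift_lowerFour (h : IsCoord Q δ α E) :
    DiagLift Q δ α E liftLowerFour 1 0 := by
  refine ⟨one_ne_zero, ?_⟩
  have h1 := h.diagLift_T.inv h
  have h4 := ((h1.mul h h1).mul h h1).mul h h1
  have e1 : (Matrix.diagonal fun x : ZMod 2 =>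
      (1 : ℂ)⁻¹ * 1⁻¹ * 1⁻¹ * 1⁻¹ * quart δ x ^ (- -1 + - -1 + - -1 + - -1 : ℤ)) = 1 := by
    rw [← Matrix.diagonal_one]
    congr 1
    funext x
    have := h.quart_pow_four x
    norm_num
    exact_mod_cast this
  have h5 := h4.2
  rw [e1] at h5
  have h6 := h.dual_mul (h.dual_mul (h.dual_inv h.dual_S h.twoS_inv.1 h.twoS_inv.2) h5) h.dual_S
  rw [mul_one, h.twoS_inv.2] at h6
  simpa [liftLowerFour] using h6

lemma liftLowerFour_root (τ : ℍ) :
    liftLowerFour.root τ = cd lowerFour τ ^ (1 / 2 : ℂ) := by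
  have h1 := liftLowerFour.root_sq τ
  rw [liftLowerFour_mat] at h1
  refine (PrincipalHalf.sqrt_eq (Or.inl ?_) h1).symm
  have hT : ∀ τ : ℍ, (Mp2Z.T⁻¹).root τ = 1 := fun τ => by simp [Mp2Z.T]
  obtain ⟨σ, hσ⟩ : ∃ σ : ℍ, liftLowerFour.root τ = (Mp2Z.S.root σ)⁻¹ * Mp2Z.S.root τ := by
    refine ⟨Mp2Z.S.mat⁻¹ • (Mp2Z.T⁻¹ * Mp2Z.T⁻¹ * Mp2Z.T⁻¹ * Mp2Z.T⁻¹).mat • Mp2Z.S.mat • τ, ?_⟩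
    simp only [liftLowerFour, Mp2Z.mul_root, Mp2Z.inv_root Mp2Z.S, hT, mul_one]
  rw [hσ]
  obtain ⟨a1, a2⟩ := root_S τ
  obtain ⟨b1, b2⟩ := root_S σ
  rw [Complex.mul_re, Complex.inv_re, Complex.inv_im]
  have hn : 0 < Complex.normSq (Mp2Z.S.root σ) := by
    rw [Complex.normSq_pos]; exact Mp2Z.root_ne_zero _ _
  have : (Mp2Z.S.root σ).re / Complex.normSq (Mp2Z.S.root σ) * (Mp2Z.S.root τ).re -
      -(Mp2Z.S.root σ).im / Complex.normSq (Mp2Z.S.root σ) * (Mp2Z.S.root τ).im =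
      ((Mp2Z.S.root σ).re * (Mp2Z.S.root τ).re + (Mp2Z.S.root σ).im * (Mp2Z.S.root τ).im) /
        Complex.normSq (Mp2Z.S.root σ) := by ring
  rw [this]
  positivity

/-- `M = (a, b; c, d)` has a lift `(M, φ)` that acts on the `2`-part with eigenvalues `l` and
`l e(-δbd/4)`, where `l^(-δ) φ` is `√(cτ + d)` times the theta multiplier of `M`. -/
def ThetaLift (Q : QuadraticMap ℤ A (AddCircle (1 : ℚ))) (δ α : ℤ) (E : A ≃+ ZMod 2 × ZMod p)
    (M : SL(2, ℤ)) : Prop :=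
  ∃ (g : Mp2Z) (l : ℂ) (n : ℤ), g.mat = M ∧ DiagLift Q δ α E g l n ∧ 4 ∣ n + M 0 1 * M 1 1 ∧
    ∀ τ, l ^ (-δ) * g.root τ = thetaFactor M τ

lemma IsCoord.thetaLift_mul_iff (h : IsCoord Q δ α E) {M N : SL(2, ℤ)} {g : Mp2Z} {l : ℂ} {n : ℤ}
    (hg : g.mat = N) (hl : DiagLift Q δ α E g l n)
    (hbd : 4 ∣ n + ((M * N) 0 1 * (M * N) 1 1 - M 0 1 * M 1 1))
    (hτ : ∀ τ, thetaFactor (M * N) τ = thetaFactor M (N • τ) * (l ^ (-δ) * g.root τ)) :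
    ThetaLift Q δ α E M ↔ ThetaLift Q δ α E (M * N) := by
  subst hg
  constructor
  · rintro ⟨g', l', n', rfl, hl', hbd', hτ'⟩
    refine ⟨g' * g, l' * l, n' + n, rfl, hl'.mul h hl, ?_, fun τ => ?_⟩
    · obtain ⟨u, hu⟩ := hbd
      obtain ⟨v, hv⟩ := hbd'
      exact ⟨u + v, by linarith⟩
    · rw [hτ, ← hτ', Mp2Z.mul_root, mul_zpow]; ring
  · rintro ⟨g', l', n', hg', hl', hbd', hτ'⟩
    refine ⟨g' * g⁻¹, l' * l⁻¹, n' + -n, by rw [Mp2Z.mul_mat, hg', Mp2Z.inv_mat, mul_inv_cancel_right],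
      hl'.mul h (hl.inv h), ?_, fun τ => ?_⟩
    · obtain ⟨u, hu⟩ := hbd
      obtain ⟨v, hv⟩ := hbd'
      exact ⟨v - u, by linarith⟩
    · have h1 := hτ (g.mat⁻¹ • τ)
      rw [← hτ', smul_inv_smul] at h1
      have h2 := g.root_ne_zero (g.mat⁻¹ • τ)
      have h3 := zpow_ne_zero (-δ) hl.1
      rw [Mp2Z.mul_root, Mp2Z.inv_root, Mp2Z.inv_mat, mul_zpow, inv_zpow]
      field_simp
      linear_combination h1

lemma IsCoord.thetaLift_neg_iff (h : IsCoord Q δ α E) {M : SL(2, ℤ)} (hM : LowerFour M) :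
    ThetaLift Q δ α E M ↔ ThetaLift Q δ α E (-M) := by
  rw [← mul_neg_one M]
  refine h.thetaLift_mul_iff liftNeg_mat h.diagLift_neg ?_ fun τ => ?_
  · rw [mul_neg_one]
    simp
  · rw [mul_neg_one, thetaFactor_neg hM, liftNeg_root]
    have h1 : (-1 : SL(2, ℤ)) • τ = τ := by simp
    rw [h1]
    rcases h.delta with rfl | rfl <;> simp

lemma IsCoord.thetaLift_T_iff (h : IsCoord Q δ α E) {M : SL(2, ℤ)} (hM : LowerFour M)
    (hc : 0 ≤ M 1 0) : ThetaLift Q δ α E M ↔ ThetaLift Q δ α E (M * ModularGroup.T) := by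
  refine h.thetaLift_mul_iff (g := Mp2Z.T) rfl h.diagLift_T ?_ fun τ => ?_
  · obtain ⟨-, h2, -, h4⟩ := mul_T_entries M
    rw [h2, h4]
    have hd := SL2_det M
    obtain ⟨k, hk⟩ := Int.dvd_of_emod_eq_zero hM
    refine ⟨(M 0 0 + 2 * M 0 1) * k, ?_⟩
    rw [hk] at hd ⊢
    linear_combination hd
  · rw [thetaFactor_mul_T hM hc]; simp [Mp2Z.T]

lemma IsCoord.thetaLift_lowerFour_iff (h : IsCoord Q δ α E) (M : SL(2, ℤ)) :
    ThetaLift Q δ α E M ↔ ThetaLift Q δ α E (M * lowerFour) := by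
  refine h.thetaLift_mul_iff liftLowerFour_mat h.diagLift_lowerFour ?_ fun τ => ?_
  · obtain ⟨-, h2, -, h4⟩ := mul_lowerFour_entries M
    rw [h2, h4]; simp
  · rw [thetaFactor_mul_lowerFour, liftLowerFour_root]; simp

lemma mul_T_zpow_entries (M : SL(2, ℤ)) (n : ℤ) :
    (M * ModularGroup.T ^ n) 1 0 = M 1 0 ∧ (M * ModularGroup.T ^ n) 1 1 = M 1 1 + n * M 1 0 := by
  obtain ⟨-, -, h3, h4⟩ := SL2Z_mul_entries M (ModularGroup.T ^ n)
  rw [h3, h4, ModularGroup.coe_T_zpow]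
  simp
  ring

lemma IsCoord.thetaLift_T_zpow_iff (h : IsCoord Q δ α E) {M : SL(2, ℤ)} (hM : LowerFour M)
    (hc : 0 ≤ M 1 0) (n : ℤ) :
    ThetaLift Q δ α E M ↔ ThetaLift Q δ α E (M * ModularGroup.T ^ n) := by
  have key : ∀ n : ℤ, ThetaLift Q δ α E (M * ModularGroup.T ^ n) ↔
      ThetaLift Q δ α E (M * ModularGroup.T ^ (n + 1)) := by
    intro n
    obtain ⟨h3, -⟩ := mul_T_zpow_entries M n
    rw [zpow_add_one, ← mul_assoc]
    refine h.thetaLift_T_iff ?_ ?_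
    · rw [LowerFour, h3]; exact hM
    · rw [h3]; exact hc
  induction n using Int.induction_on with
  | zero => simp
  | succ n ih => exact ih.trans (key _)
  | pred n ih =>
    have h1 := key (-(n : ℤ) - 1)
    rw [sub_add_cancel] at h1
    exact ih.trans h1.symm

/-- Euclid's algorithm for the lower row: `Γ₀(4)` is generated by `T`, `(1, 0; 4, 1)` and `-1`, and
the lift with the theta multiplier propagates along these generators. -/
lemma IsCoord.thetaLift (h : IsCoord Q δ α E) {M : SL(2, ℤ)} (hM : LowerFour M) :
    ThetaLift Q δ α E M := by
  induction hk : (M 1 0).natAbs using Nat.strong_induction_on generalizing M with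
  | _ k ih =>
  have hpos : ∀ N : SL(2, ℤ), LowerFour N → 0 < N 1 0 → (N 1 0).natAbs = k →
      ThetaLift Q δ α E N := by
    intro N hN hc hNk
    -- reduce `d` modulo `c` to `|d| < c/2`
    obtain ⟨n, hn⟩ : ∃ n : ℤ, 2 * |N 1 1 + n * N 1 0| ≤ N 1 0 := by
      refine ⟨-((2 * N 1 1 + N 1 0) / (2 * N 1 0)), ?_⟩
      have h1 := Int.emod_add_mul_ediv (2 * N 1 1 + N 1 0) (2 * N 1 0)
      have h2 := Int.emod_nonneg (2 * N 1 1 + N 1 0) (show 2 * N 1 0 ≠ 0 by omega)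
      have h3 := Int.emod_lt_of_pos (2 * N 1 1 + N 1 0) (show 0 < 2 * N 1 0 by omega)
      rw [show 2 * |N 1 1 + -((2 * N 1 1 + N 1 0) / (2 * N 1 0)) * N 1 0| =
        |2 * (N 1 1 + -((2 * N 1 1 + N 1 0) / (2 * N 1 0)) * N 1 0)| by rw [abs_mul]; simp, abs_le]
      constructor <;> nlinarith
    rw [h.thetaLift_T_zpow_iff hN hc.le n]
    obtain ⟨e3, e4⟩ := mul_T_zpow_entries N n
    rw [← e4] at hn
    generalize hP : N * ModularGroup.T ^ n = P at *
    have hPl : LowerFour P := by rw [LowerFour, e3]; exact hN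
    have hodd := Int.odd_iff.mp hPl.odd
    rw [← e3] at hc hNk hn
    rcases lt_or_ge (P 1 1) 0 with hd | hd
    · rw [h.thetaLift_lowerFour_iff]
      obtain ⟨-, -, f3, f4⟩ := mul_lowerFour_entries P
      rw [abs_of_neg hd] at hn
      refine ih _ ?_ ?_ rfl
      · rw [f3, ← hNk]; rw [LowerFour] at hPl; omega
      · rw [LowerFour, f3]; rw [LowerFour] at hPl; omega
    · have hP' : P = (P * lowerFour⁻¹) * lowerFour := by group
      obtain ⟨-, -, f3, f4⟩ := mul_lowerFour_entries (P * lowerFour⁻¹)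
      rw [← hP'] at f3 f4
      rw [hP', ← h.thetaLift_lowerFour_iff]
      rw [abs_of_nonneg hd] at hn
      refine ih _ ?_ ?_ rfl
      · rw [← hNk]; rw [LowerFour] at hPl; omega
      · rw [LowerFour]; rw [LowerFour] at hPl; omega
  rcases lt_trichotomy (M 1 0) 0 with hc | hc | hc
  · rw [h.thetaLift_neg_iff hM]
    have e3 : (-M) 1 0 = -(M 1 0) := rfl
    refine hpos _ ?_ (by rw [e3]; omega) (by rw [e3]; omega)
    rw [LowerFour] at hM ⊢; rw [e3]; omega
  · have hT : ∀ n : ℤ, ThetaLift Q δ α E (ModularGroup.T ^ n) := by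
      intro n
      have h1 : ThetaLift Q δ α E 1 :=
        ⟨1, 1, 0, rfl, h.diagLift_one, by simp, fun τ => by
          rw [thetaFactor_lower_zero (by simp)]; simp⟩
      rw [h.thetaLift_T_zpow_iff (by simp [LowerFour]) (by simp) n, one_mul] at h1
      exact h1
    rcases det_of_lower_zero hc with ⟨h1, h2⟩ | ⟨h1, h2⟩
    · convert hT (M 0 1) using 1
      ext i j
      rw [ModularGroup.coe_T_zpow]
      fin_cases i <;> fin_cases j <;> simp [h1, h2, hc]
    · rw [h.thetaLift_neg_iff hM]
      convert hT (-(M 0 1)) using 1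
      ext i j
      rw [ModularGroup.coe_T_zpow]
      fin_cases i <;> fin_cases j <;> simp [h1, h2, hc]
  · exact hpos M hM hc hk

end Tensor

/-! ### Affine substitutions, holomorphy and square roots on the upper half-plane -/

/-- The substitution `τ ↦ rτ + x` with rational `r > 0` and `x`. -/
def aff (r x : ℚ) (hr : 0 < r) (τ : ℍ) : ℍ :=
  (x : ℝ) +ᵥ ((⟨(r : ℝ), by exact_mod_cast hr⟩ : {y : ℝ // 0 < y}) • τ)

lemma coe_aff (r x : ℚ) (hr : 0 < r) (τ : ℍ) : (aff r x hr τ : ℂ) = r * τ + x := by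
  simp [aff, add_comm]

lemma coe_smul_SL (M : SL(2, ℤ)) (τ : ℍ) :
    ((M • τ : ℍ) : ℂ) = ((M 0 0 : ℂ) * τ + M 0 1) / cd M τ := by
  rw [UpperHalfPlane.coe_specialLinearGroup_apply]
  simp [cd]

lemma coe_fourP (p : ℕ) [NeZero p] (τ : ℍ) : ((fourP p • τ : ℍ) : ℂ) = 4 * p * τ := by
  simp [fourP]

lemma coe_S_smul (τ : ℍ) : ((ModularGroup.S • τ : ℍ) : ℂ) = -1 / τ := by
  rw [coe_smul_SL]; simp [cd, ModularGroup.S]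

lemma coe_T_smul (τ : ℍ) : ((ModularGroup.T • τ : ℍ) : ℂ) = τ + 1 := by
  rw [coe_smul_SL]; simp [cd, ModularGroup.T]

lemma mdiff_comp {F : ℍ → ℂ} (hF : MDiff F) {φ : ℍ → ℍ} {u : ℂ → ℂ}
    (hu : ∀ τ : ℍ, ((φ τ : ℍ) : ℂ) = u τ) (hd : ∀ τ : ℍ, DifferentiableAt ℂ u τ) :
    MDiff (fun τ => F (φ τ)) := by
  intro τ
  rw [UpperHalfPlane.mdifferentiableAt_iff]
  have h1 : DifferentiableAt ℂ ((F ∘ UpperHalfPlane.ofComplex) ∘ u) τ := by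
    refine DifferentiableAt.comp _ ?_ (hd τ)
    rw [← hu]
    exact UpperHalfPlane.mdifferentiableAt_iff.mp (hF (φ τ))
  refine h1.congr_of_eventuallyEq ?_
  filter_upwards [UpperHalfPlane.isOpen_upperHalfPlaneSet.mem_nhds τ.im_pos] with z hz
  simp only [Function.comp_apply]
  rw [UpperHalfPlane.ofComplex_apply_of_im_pos hz, ← UpperHalfPlane.ofComplex_apply (φ _), hu]

lemma mdiff_of_differentiableAt {F : ℍ → ℂ} {u : ℂ → ℂ} (hu : ∀ τ : ℍ, F τ = u τ)
    (hd : ∀ τ : ℍ, DifferentiableAt ℂ u τ) : MDiff F := by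
  intro τ
  rw [UpperHalfPlane.mdifferentiableAt_iff]
  refine (hd τ).congr_of_eventuallyEq ?_
  filter_upwards [UpperHalfPlane.isOpen_upperHalfPlaneSet.mem_nhds τ.im_pos] with z hz
  simp only [Function.comp_apply]
  rw [UpperHalfPlane.ofComplex_apply_of_im_pos hz, hu]

lemma mdiff_comp_aff {F : ℍ → ℂ} (hF : MDiff F) (r x : ℚ) (hr : 0 < r) :
    MDiff (fun τ => F (aff r x hr τ)) :=
  mdiff_comp hF (u := fun z => r * z + x) (coe_aff r x hr) fun τ => by fun_prop

lemma mdiff_comp_fourP (p : ℕ) [NeZero p] {F : ℍ → ℂ} (hF : MDiff F) :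
    MDiff (fun τ => F (fourP p • τ)) :=
  mdiff_comp hF (u := fun z => 4 * p * z) (coe_fourP p) fun τ => by fun_prop

lemma mdiff_comp_S {F : ℍ → ℂ} (hF : MDiff F) : MDiff (fun τ => F (ModularGroup.S • τ)) :=
  mdiff_comp hF (u := fun z => -1 / z) coe_S_smul fun τ =>
    (differentiableAt_const _).div differentiableAt_id τ.ne_zero

lemma mdiff_root_S_zpow (n : ℤ) : MDiff (fun τ => Mp2Z.S.root τ ^ n) := by
  refine mdiff_of_differentiableAt (u := fun z => (z ^ (1 / 2 : ℂ)) ^ n) (fun τ => rfl) fun τ => ?_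
  refine DifferentiableAt.zpow (differentiableAt_id.cpow_const (Or.inr τ.im_ne_zero)) (Or.inl ?_)
  exact Mp2Z.root_ne_zero Mp2Z.S τ

/-- Two continuous functions on the upper half-plane with proportional squares are proportional. -/
lemma exists_const_of_sq {u v : ℍ → ℂ} (hu : Continuous u) (hv : Continuous v) (hv0 : ∀ τ, v τ ≠ 0)
    {K : ℂ} (hK : K ≠ 0) (h : ∀ τ, u τ ^ 2 = K * v τ ^ 2) :
    ∃ K' : ℂ, K' ≠ 0 ∧ ∀ τ, u τ = K' * v τ := by
  set s := K ^ (1 / 2 : ℂ) with hs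
  have hs2 : s ^ 2 = K := sqrt_sq K
  have hs0 : s ≠ 0 := by rintro h0; rw [h0] at hs2; apply hK; rw [← hs2]; simp
  rcases (isPreconnected_univ (α := ℍ)).eq_or_eq_neg_of_sq_eq (f := u) (g := fun τ => s * v τ)
    hu.continuousOn (by fun_prop) (fun τ _ => by simp [h, mul_pow, hs2])
    (fun {τ} _ => mul_ne_zero hs0 (hv0 τ)) with h1 | h1
  · exact ⟨s, hs0, fun τ => h1 (Set.mem_univ τ)⟩
  · exact ⟨-s, neg_ne_zero.mpr hs0, fun τ => by rw [h1 (Set.mem_univ τ)]; simp⟩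

lemma continuous_sqrt_cd (M : SL(2, ℤ)) : Continuous fun τ : ℍ => cd M τ ^ (1 / 2 : ℂ) := by
  by_cases hc : M 1 0 = 0
  · have : (fun τ : ℍ => cd M τ ^ (1 / 2 : ℂ)) = fun _ => (M 1 1 : ℂ) ^ (1 / 2 : ℂ) := by
      funext τ; simp [cd, hc]
    rw [this]; exact continuous_const
  · refine continuous_iff_continuousAt.mpr fun τ => ?_
    have h1 : Continuous fun τ : ℍ => cd M τ := by
      unfold cd
      exact (continuous_const.mul UpperHalfPlane.continuous_coe).add continuous_const
    refine ContinuousAt.cpow h1.continuousAt continuousAt_const (Or.inr ?_)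
    rw [cd_im]
    exact mul_ne_zero (by exact_mod_cast hc) τ.im_ne_zero

lemma cpow_half (z : ℂ) (κ : ℤ) : z ^ ((κ : ℂ) / 2) = (z ^ (1 / 2 : ℂ)) ^ κ := by
  rw [← Complex.cpow_int_mul]; congr 1; ring

lemma cpow_neg_half (z : ℂ) (κ : ℤ) : z ^ (-((κ : ℂ) / 2)) = (z ^ (1 / 2 : ℂ)) ^ (-κ) := by
  rw [← Complex.cpow_int_mul]; congr 1; push_cast; ring

/-! ### Expansions with bounded denominators -/

/-- `f` has an expansion `∑_{n ≫ -∞} c(n) q^n` with `n ∈ (1/h)ℤ` for some `h`. -/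
def HasFracExpansion (f : ℍ → ℂ) : Prop :=
  ∃ (h : ℕ) (c : ℚ → ℂ), 0 < h ∧ (∀ n : ℚ, c n ≠ 0 → ∃ m : ℤ, n = (m : ℚ) / (h : ℚ)) ∧
    HasRatExpansion f c

lemma HasFracExpansion.zero : HasFracExpansion fun _ => 0 :=
  ⟨1, 0, one_pos, fun _ hn => absurd rfl hn, HasRatExpansion.zero⟩

lemma HasFracExpansion.add {f g : ℍ → ℂ} (hf : HasFracExpansion f) (hg : HasFracExpansion g) :
    HasFracExpansion fun τ => f τ + g τ := by
  obtain ⟨h, c, hh, hc, hs⟩ := hf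
  obtain ⟨h', c', hh', hc', hs'⟩ := hg
  refine ⟨h * h', c + c', mul_pos hh hh', fun n hn => ?_, hs.add hs'⟩
  have e1 : (h : ℚ) ≠ 0 := by exact_mod_cast hh.ne'
  have e2 : (h' : ℚ) ≠ 0 := by exact_mod_cast hh'.ne'
  by_cases h0 : c n = 0
  · by_cases h0' : c' n = 0
    · simp [h0, h0'] at hn
    · obtain ⟨m, rfl⟩ := hc' n h0'
      exact ⟨m * h, by push_cast; field_simp⟩
  · obtain ⟨m, rfl⟩ := hc n h0
    exact ⟨m * h', by push_cast; field_simp⟩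

lemma HasFracExpansion.const_mul {f : ℍ → ℂ} (a : ℂ) (hf : HasFracExpansion f) :
    HasFracExpansion fun τ => a * f τ := by
  obtain ⟨h, c, hh, hc, hs⟩ := hf
  exact ⟨h, a • c, hh, fun n hn => hc n fun h => hn (by simp [h]), hs.smul a⟩

lemma HasFracExpansion.sum {ι : Type*} {s : Finset ι} {f : ι → ℍ → ℂ}
    (hf : ∀ i ∈ s, HasFracExpansion (f i)) : HasFracExpansion fun τ => ∑ i ∈ s, f i τ := by
  classical
  induction s using Finset.induction_on with
  | empty => simpa using HasFracExpansion.zero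
  | insert a s ha ih =>
    simp only [Finset.sum_insert ha]
    exact (hf a (Finset.mem_insert_self a s)).add
      (ih fun i hi => hf i (Finset.mem_insert_of_mem hi))

lemma HasRatExpansion.comp_aff {f : ℍ → ℂ} {c : ℚ → ℂ} (hf : HasRatExpansion f c) (r x : ℚ)
    (hr : 0 < r) : HasRatExpansion (fun τ => f (aff r x hr τ))
      (fun n => c (n / r) * e (((n / r * x : ℚ)) : ℂ)) := by
  obtain ⟨⟨B, hB⟩, hs⟩ := hf
  refine ⟨⟨B * r, fun n hn => ?_⟩, fun τ => ?_⟩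
  · beta_reduce
    rw [hB _ ((div_lt_iff₀ hr).mpr hn), zero_mul]
  · have h1 := hs (aff r x hr τ)
    rw [← (Equiv.divRight₀ r hr.ne').hasSum_iff] at h1
    refine h1.congr_fun ?_
    intro n
    have hr' : (r : ℂ) ≠ 0 := by exact_mod_cast hr.ne'
    simp only [Function.comp_apply, Equiv.divRight₀_apply]
    rw [mul_assoc, ← e_add, coe_aff]
    congr 2
    push_cast
    field_simp
    ring

lemma HasFracExpansion.comp_aff {f : ℍ → ℂ} (hf : HasFracExpansion f) (r x : ℚ) (hr : 0 < r) :
    HasFracExpansion fun τ => f (aff r x hr τ) := by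
  obtain ⟨h, c, hh, hc, hs⟩ := hf
  refine ⟨h * r.den, _, mul_pos hh r.den_pos, fun n hn => ?_, hs.comp_aff r x hr⟩
  obtain ⟨m, hm⟩ := hc _ (left_ne_zero_of_mul hn)
  refine ⟨m * r.num, ?_⟩
  have e1 : (h : ℚ) ≠ 0 := by exact_mod_cast hh.ne'
  have e2 : (r.den : ℚ) ≠ 0 := by exact_mod_cast r.den_pos.ne'
  have e3 := Rat.num_div_den r
  rw [div_eq_iff hr.ne'] at hm
  rw [hm]
  nth_rewrite 1 [← e3]
  push_cast
  field_simp

/-- Averaging over the translates by integers selects the exponents in a class modulo `ℤ`. -/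
lemma HasFracExpansion.of_translation {f : ℍ → ℂ} (hf : HasFracExpansion f) {y : ℚ}
    (hT : ∀ τ, f (ModularGroup.T • τ) = e (y : ℂ) * f τ) :
    ∃ c : ℚ → ℂ, (∀ n : ℚ, c n ≠ 0 → ∃ m : ℤ, n = y + m) ∧ HasRatExpansion f c := by
  obtain ⟨h, c, hh, hc, hs⟩ := hf
  set N := h * y.den with hN
  have hN0 : N ≠ 0 := (mul_pos hh y.den_pos).ne'
  have hNC : (N : ℂ) ≠ 0 := by exact_mod_cast hN0
  have hTj : ∀ (j : ℕ) τ, f (aff 1 j one_pos τ) = e (y : ℂ) ^ j * f τ := by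
    intro j
    induction j with
    | zero =>
      intro τ
      have : aff 1 ((0 : ℕ) : ℚ) one_pos τ = τ := by
        ext; rw [coe_aff]; simp
      rw [this]; simp
    | succ j ih =>
      intro τ
      have : aff 1 ((j + 1 : ℕ) : ℚ) one_pos τ = ModularGroup.T • aff 1 j one_pos τ := by
        ext; rw [coe_aff, coe_T_smul, coe_aff]; push_cast; ring
      rw [this, hT, ih, pow_succ]; ring
  -- the average over `N` translates
  have havg : ∀ n : ℚ, c n ≠ 0 → (¬ ∃ m : ℤ, n = y + m) →
      ∑ j ∈ Finset.range N, e ((n - y : ℚ) : ℂ) ^ j = 0 := by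
    intro n hn hm
    have h1 : e ((n - y : ℚ) : ℂ) ≠ 1 := by
      rw [Ne, e_eq_one_iff]
      rintro ⟨m, h2⟩
      exact hm ⟨m, by linarith⟩
    have h3 : e ((n - y : ℚ) : ℂ) ^ N = 1 := by
      rw [← e_nat_mul]
      obtain ⟨m, hm'⟩ := hc n hn
      have e1 : (h : ℚ) ≠ 0 := by exact_mod_cast hh.ne'
      have h4 : (N : ℚ) * (n - y) = ((m * y.den - h * y.num : ℤ) : ℚ) := by
        have e3 := Rat.mul_den_eq_num y
        rw [hm', hN]
        push_cast
        rw [← e3]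
        field_simp
      have h5 : (N : ℂ) * ((n - y : ℚ) : ℂ) = ((m * y.den - h * y.num : ℤ) : ℂ) := by
        exact_mod_cast congrArg (fun q : ℚ => (q : ℂ)) h4
      rw [h5, e_int]
    have := geom_sum_mul (e ((n - y : ℚ) : ℂ)) N
    rw [h3, sub_self] at this
    exact (mul_eq_zero.mp this).resolve_right (sub_ne_zero.mpr h1)
  refine ⟨fun n => (N : ℂ)⁻¹ * ∑ j ∈ Finset.range N, c n * e ((n - y : ℚ) : ℂ) ^ j, ?_, ?_, ?_⟩
  · intro n hn
    by_contra hm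
    apply hn
    by_cases h0 : c n = 0
    · simp [h0]
    · beta_reduce
      rw [← Finset.mul_sum, havg n h0 hm, mul_zero, mul_zero]
  · obtain ⟨B, hB⟩ := hs.1
    exact ⟨B, fun n hn => by simp [hB n hn]⟩
  · intro τ
    have h1 : ∀ j : ℕ, HasSum (fun n : ℚ => c n * e ((n - y : ℚ) : ℂ) ^ j * e (n * (τ : ℂ))) (f τ) := by
      intro j
      have h2 := (hs.2 (aff 1 j one_pos τ)).mul_left ((e (y : ℂ) ^ j)⁻¹)
      rw [hTj, inv_mul_cancel_left₀ (pow_ne_zero _ (e_ne_zero _))] at h2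
      refine h2.congr_fun fun n => ?_
      rw [coe_aff, mul_left_comm, mul_assoc]
      congr 1
      rw [← e_nat_mul, ← e_nat_mul, ← e_neg, ← e_add, ← e_add]
      congr 1
      push_cast
      ring
    have h2 := (hasSum_sum (s := Finset.range N) fun j _ => h1 j).mul_left ((N : ℂ)⁻¹)
    rw [Finset.sum_const, Finset.card_range, nsmul_eq_mul, inv_mul_cancel_left₀ hNC] at h2
    refine h2.congr_fun fun n => ?_
    rw [mul_assoc, Finset.sum_mul]

/-! ### Integral matrices of positive determinant -/

/-- An integral matrix of positive determinant is the product of an element of `SL₂(ℤ)` and an upper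
triangular one; here in terms of the action on the upper half-plane. -/
lemma exists_SL_mul_aff (a b c d : ℤ) (hdet : 0 < a * d - b * c) :
    ∃ (M : SL(2, ℤ)) (r x : ℚ) (hr : 0 < r) (K : ℂ), K ≠ 0 ∧
      (∀ τ : ℍ, cd M (aff r x hr τ) = K * (c * τ + d)) ∧
      ∀ τ w : ℍ, (w : ℂ) * (c * τ + d) = a * τ + b → w = M • aff r x hr τ := by
  have hac : 0 < Int.gcd a c := by
    rw [Int.gcd_pos_iff]
    by_contra h
    push Not at h
    rw [h.1, h.2] at hdet
    simp at hdet
  obtain ⟨A, hA⟩ : ∃ A : ℤ, A = (Int.gcd a c : ℤ) := ⟨_, rfl⟩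
  have hA0 : 0 < A := by rw [hA]; exact_mod_cast hac
  obtain ⟨a', ha'⟩ : A ∣ a := hA ▸ Int.gcd_dvd_left _ _
  obtain ⟨c', hc'⟩ : A ∣ c := hA ▸ Int.gcd_dvd_right _ _
  have hbez := Int.gcd_eq_gcd_ab a c
  rw [← hA] at hbez
  set u := Int.gcdA a c
  set v := Int.gcdB a c
  have huv : u * a' + v * c' = 1 := by
    have : A * (u * a' + v * c') = A * 1 := by
      rw [ha', hc'] at hbez; linear_combination -hbez
    exact mul_left_cancel₀ hA0.ne' this
  set D : ℤ := a' * d - c' * b with hD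
  have hAD : A * D = a * d - b * c := by rw [hD, ha', hc']; ring
  have hD0 : 0 < D := by
    rw [← hAD] at hdet
    exact pos_of_mul_pos_right hdet hA0.le
  set B : ℤ := u * b + v * d with hB
  let M : SL(2, ℤ) := ⟨!![a', -v; c', u], by rw [Matrix.det_fin_two_of]; linarith⟩
  have hDQ : (D : ℚ) ≠ 0 := by exact_mod_cast hD0.ne'
  have hDC : (D : ℂ) ≠ 0 := by exact_mod_cast hD0.ne'
  have hr : (0 : ℚ) < A / D := by
    have : (0 : ℚ) < D := by exact_mod_cast hD0
    have : (0 : ℚ) < A := by exact_mod_cast hA0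
    positivity
  have hd : c' * B + u * D = d := by rw [hB, hD]; linear_combination d * huv
  have hb : a' * B - v * D = b := by rw [hB, hD]; linear_combination b * huv
  have hdC : (c' : ℂ) * B + u * D = d := by exact_mod_cast congrArg (fun z : ℤ => (z : ℂ)) hd
  have hbC : (a' : ℂ) * B - v * D = b := by exact_mod_cast congrArg (fun z : ℤ => (z : ℂ)) hb
  have haC : (a : ℂ) = A * a' := by exact_mod_cast congrArg (fun z : ℤ => (z : ℂ)) ha'
  have hcC : (c : ℂ) = A * c' := by exact_mod_cast congrArg (fun z : ℤ => (z : ℂ)) hc'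
  have hcd : ∀ τ : ℍ, cd M (aff (A / D) (B / D) hr τ) = (D : ℂ)⁻¹ * (c * τ + d) := by
    intro τ
    rw [cd, coe_aff]
    simp only [M, Matrix.of_apply, Matrix.cons_val', Matrix.cons_val_zero, Matrix.cons_val_one,
      Matrix.cons_val_fin_one]
    rw [hcC, ← hdC]
    push_cast
    field_simp
    ring
  refine ⟨M, A / D, B / D, hr, (D : ℂ)⁻¹, inv_ne_zero hDC, hcd, fun τ w hw => ?_⟩
  have h0 := cd_ne_zero M (aff (A / D) (B / D) hr τ)
  have h0' := h0
  rw [hcd] at h0'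
  ext
  rw [coe_smul_SL, eq_div_iff h0, hcd, mul_left_comm, hw, coe_aff]
  simp only [M, Matrix.of_apply, Matrix.cons_val', Matrix.cons_val_zero, Matrix.cons_val_one,
    Matrix.cons_val_fin_one]
  rw [haC, ← hbC]
  push_cast
  field_simp
  ring

/-- A form that is meromorphic at the cusps has expansions along all rational substitutions. -/
lemma MeromorphicAtCusps.hasFracExpansion {κ : ℤ} {G : ℍ → ℂ} (hG : MeromorphicAtCusps κ G)
    {a b c d : ℤ} (hdet : 0 < a * d - b * c) {φ : ℍ → ℍ}
    (hφ : ∀ τ, (φ τ : ℂ) * (c * τ + d) = a * τ + b) {u : ℍ → ℂ} (hu : Continuous u) {K : ℂ}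
    (hK : K ≠ 0) (hu2 : ∀ τ, u τ ^ 2 = K * (c * τ + d)) :
    HasFracExpansion fun τ => u τ ^ (-κ) * G (φ τ) := by
  obtain ⟨M, r, x, hr, K', hK', hcd, hM⟩ := exists_SL_mul_aff a b c d hdet
  have h1 : HasFracExpansion fun τ => cd M τ ^ (-((κ : ℂ) / 2)) * G (M • τ) := hG M
  have h2 := h1.comp_aff r x hr
  have hcont : Continuous (aff r x hr) := by
    rw [UpperHalfPlane.isEmbedding_coe.continuous_iff]
    have : ((↑) ∘ aff r x hr : ℍ → ℂ) = fun τ : ℍ => (r : ℂ) * τ + x := by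
      funext τ; exact coe_aff r x hr τ
    rw [this]
    exact (continuous_const.mul UpperHalfPlane.continuous_coe).add continuous_const
  obtain ⟨L, hL, huL⟩ := exists_const_of_sq (K := K / K') hu
    ((continuous_sqrt_cd M).comp hcont)
    (fun τ h => by
      have := sqrt_sq (cd M (aff r x hr τ))
      simp only [Function.comp_apply] at h
      rw [h] at this
      exact cd_ne_zero _ _ (by rw [← this]; simp)) (div_ne_zero hK hK')
    (fun τ => by
      rw [hu2, Function.comp_apply, sqrt_sq, hcd]; field_simp)
  have h3 := h2.const_mul (L ^ (-κ))
  convert h3 using 2 with τ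
  rw [hM τ (φ τ) (hφ τ), huL τ, cpow_neg_half, mul_zpow, Function.comp_apply, mul_assoc]

/-! ### The slash operator of `S` and the Atkin-Lehner operator -/

/-- The weight `κ/2` slash operator of `S` on scalar-valued functions. -/
def slashS (κ : ℤ) (f : ℍ → ℂ) (τ : ℍ) : ℂ := Mp2Z.S.root τ ^ (-κ) * f (ModularGroup.S • τ)

lemma S_smul_S_smul (τ : ℍ) : ModularGroup.S • ModularGroup.S • τ = τ := by
  rw [← mul_smul, S_mul_S]; simp

lemma slashS_slashS (κ : ℤ) (f : ℍ → ℂ) (τ : ℍ) :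
    slashS κ (slashS κ f) τ = Complex.I ^ (-κ) * f τ := by
  have h : Mp2Z.S.root (ModularGroup.S • τ) * Mp2Z.S.root τ = Complex.I := liftNeg_root τ
  rw [slashS, slashS, S_smul_S_smul, ← h, mul_zpow]; ring

lemma slashS_add (κ : ℤ) (f g : ℍ → ℂ) (τ : ℍ) :
    slashS κ (fun z => f z + g z) τ = slashS κ f τ + slashS κ g τ := by
  simp only [slashS]; ring

lemma slashS_sub (κ : ℤ) (f g : ℍ → ℂ) (τ : ℍ) :
    slashS κ (fun z => f z - g z) τ = slashS κ f τ - slashS κ g τ := by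
  simp only [slashS]; ring

lemma slashS_const_mul (κ : ℤ) (a : ℂ) (f : ℍ → ℂ) (τ : ℍ) :
    slashS κ (fun z => a * f z) τ = a * slashS κ f τ := by
  simp only [slashS]; ring

lemma slashS_sum (κ : ℤ) {ι : Type*} (s : Finset ι) (f : ι → ℍ → ℂ) (τ : ℍ) :
    slashS κ (fun z => ∑ i ∈ s, f i z) τ = ∑ i ∈ s, slashS κ (f i) τ := by
  simp only [slashS, Finset.mul_sum]

lemma sqrt_I_mul (r : ℝ) (hr : 0 < r) {z : ℂ} (hz : 0 < z.im) :
    ((r : ℂ) * z) ^ (1 / 2 : ℂ) =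
      Complex.I ^ (1 / 2 : ℂ) * ((r : ℂ) ^ (1 / 2 : ℂ) * (-Complex.I * z) ^ (1 / 2 : ℂ)) := by
  refine PrincipalHalf.sqrt_eq (Or.inl ?_) ?_
  · obtain ⟨a1, a2⟩ := sqrt_quadrant (z := Complex.I) (by simp)
    have ha : (Complex.I ^ (1 / 2 : ℂ)).re = (Complex.I ^ (1 / 2 : ℂ)).im := by
      have := congrArg Complex.re (sqrt_sq Complex.I)
      rw [pow_two, Complex.mul_re, Complex.I_re] at this
      nlinarith
    have hr' : (r : ℂ) ^ (1 / 2 : ℂ) = ((Real.sqrt r : ℝ) : ℂ) :=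
      PrincipalHalf.sqrt_eq (Or.inl (by simpa using hr))
        (by rw [← Complex.ofReal_pow, Real.sq_sqrt hr.le])
    have hs := Real.sqrt_pos.mpr hr
    set v := (-Complex.I * z) ^ (1 / 2 : ℂ) with hv
    have hv2 := congrArg Complex.re (sqrt_sq (-Complex.I * z))
    rw [← hv, pow_two, Complex.mul_re] at hv2
    have hre : (-Complex.I * z).re = z.im := by simp
    rw [hre] at hv2
    have hvre : 0 ≤ v.re := by
      rcases principalHalf_sqrt (-Complex.I * z) with h | h
      · exact h.le
      · exact h.1.ge
    have hvlt : v.im < v.re := by nlinarith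
    rw [hr', Complex.mul_re, Complex.re_ofReal_mul, Complex.im_ofReal_mul, ha]
    have : (Complex.I ^ (1 / 2 : ℂ)).im * (Real.sqrt r * v.re) -
        (Complex.I ^ (1 / 2 : ℂ)).im * (Real.sqrt r * v.im) =
        (Complex.I ^ (1 / 2 : ℂ)).im * Real.sqrt r * (v.re - v.im) := by ring
    rw [this]
    exact mul_pos (mul_pos a2 hs) (sub_pos.mpr hvlt)
  · rw [mul_pow, mul_pow, sqrt_sq, sqrt_sq, sqrt_sq]
    linear_combination (-(r : ℂ) * z) * Complex.I_mul_I

/-- Rescaled by `4p`, the operator `W_{16p²}` becomes `i^k` times the slash operator of `S`. -/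
lemma atkinLehner_comp_fourP (p : ℕ) [NeZero p] (κ : ℤ) (f : ℍ → ℂ) (τ : ℍ) :
    atkinLehner p κ (fun z => f (fourP p • z)) τ =
      Complex.I ^ ((κ : ℂ) / 2) * slashS κ f (fourP p • τ) := by
  have hp0 : (p : ℂ) ≠ 0 := by exact_mod_cast NeZero.ne p
  have hτ := τ.ne_zero
  have hpos : (0 : ℝ) < 4 * p := by
    have : 0 < p := Nat.pos_of_ne_zero (NeZero.ne p)
    positivity
  have h1 : fourP p • ModularGroup.S • ((fourP p * fourP p) • τ) =
      ModularGroup.S • (fourP p • τ) := by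
    ext
    rw [coe_fourP, coe_S_smul, coe_S_smul, mul_smul, coe_fourP, coe_fourP]
    field_simp
  have h2 : Mp2Z.S.root (fourP p • τ) = Complex.I ^ (1 / 2 : ℂ) *
      ((4 * (p : ℂ)) ^ (1 / 2 : ℂ) * (-Complex.I * τ) ^ (1 / 2 : ℂ)) := by
    have := sqrt_I_mul (4 * p) hpos τ.im_pos
    push_cast at this
    rw [← this, ← coe_fourP]
    rfl
  have hI : Complex.I ^ (1 / 2 : ℂ) ≠ 0 := by
    rw [Ne, Complex.cpow_eq_zero_iff]; simp
  rw [atkinLehner, slashS, h1, h2, cpow_neg_half, cpow_neg_half, cpow_half, mul_zpow, mul_zpow,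
    zpow_neg (Complex.I ^ (1 / 2 : ℂ))]
  have := zpow_ne_zero κ hI
  field_simp

/-! ### The action of `S` in coordinates -/

section Coord

variable {A : Type*} [AddCommGroup A] [Fintype A] [DecidableEq A] {p : ℕ} [Fact p.Prime]
  {Q : QuadraticMap ℤ A (AddCircle (1 : ℚ))} {δ α : ℤ} {E : A ≃+ ZMod 2 × ZMod p}

lemma sum_eq_sum_coord (E : A ≃+ ZMod 2 × ZMod p) (f : A → ℂ) :
    ∑ γ : A, f γ = ∑ y : ZMod p, (f (E.symm (0, y)) + f (E.symm (1, y))) := by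
  rw [← sum_coord E fun x y => f (E.symm (x, y))]
  simp

/-- The constant `e(sig/8) |A|^(-1/2)`. -/
def normConst (Q : QuadraticMap ℤ A (AddCircle (1 : ℚ))) : ℂ :=
  eSig Q / ((Real.sqrt (Fintype.card A) : ℝ) : ℂ)

lemma IsCoord.weilS_mulVec (h : IsCoord Q δ α E) (v : A → ℂ) (x : ZMod 2) (y : ZMod p) :
    (weilS Q).mulVec v (E.symm (x, y)) = normConst Q * ∑ y' : ZMod p, psi p α (-2 * y * y') *
      (v (E.symm (0, y')) + sgnTwo x 1 * v (E.symm (1, y'))) := by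
  rw [Matrix.mulVec, dotProduct, sum_eq_sum_coord E, Finset.mul_sum]
  refine Finset.sum_congr rfl fun y' _ => ?_
  simp only [weilS, Matrix.of_apply, h.eQZ_polar, AddEquiv.apply_symm_apply, normConst]
  have : sgnTwo x 0 = 1 := by simp [sgnTwo]
  rw [this]
  ring

lemma sgnTwo_zero_left (y : ZMod 2) : sgnTwo 0 y = 1 := by simp [sgnTwo]

lemma sgnTwo_one_one : sgnTwo 1 1 = -1 := by simp [sgnTwo]

lemma IsCoord.normConst_eq (h : IsCoord Q δ α E) :
    normConst Q = eSig Q / (((Real.sqrt 2 : ℝ) : ℂ) * ((Real.sqrt p : ℝ) : ℂ)) := by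
  rw [normConst, h.card]
  push_cast
  rw [Real.sqrt_mul (by norm_num)]
  push_cast
  rfl

lemma eSig_ne_zero : eSig Q ≠ 0 := e_ne_zero _

lemma normConst_ne_zero [Nonempty A] : normConst Q ≠ 0 :=
  div_ne_zero eSig_ne_zero (sqrt_ne_zero_complex Fintype.card_ne_zero)

lemma IsCoord.sum_psi (h : IsCoord Q δ α E) (y' : ZMod p) :
    ∑ y : ZMod p, psi p α (-2 * y * y') = if y' = 0 then (p : ℂ) else 0 := by
  have h1 := AddChar.sum_mulShift (-2 * y') (psi_primitive (p := p) h.alpha)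
  rw [ZMod.card] at h1
  have h2 : -2 * y' = 0 ↔ y' = 0 := by
    rw [mul_eq_zero, or_iff_right (neg_ne_zero.mpr h.two_ne_zero)]
  simp only [h2, Nat.cast_ite, Nat.cast_zero] at h1
  rw [← h1]
  exact Finset.sum_congr rfl fun y _ => congrArg _ (by ring)

/-- The sum of `ρ*(S)v` over the nonzero elements of a parity class. -/
lemma IsCoord.sum_weilS_mulVec (h : IsCoord Q δ α E) (v : A → ℂ) (x : ZMod 2) :
    ∑ y : ZMod p, (weilS Q).mulVec v (E.symm (x, y)) - (weilS Q).mulVec v (E.symm (x, 0)) =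
      normConst Q * (p * (v (E.symm (0, 0)) + sgnTwo x 1 * v (E.symm (1, 0))) -
        ∑ y' : ZMod p, (v (E.symm (0, y')) + sgnTwo x 1 * v (E.symm (1, y')))) := by
  simp only [h.weilS_mulVec]
  rw [← Finset.mul_sum, Finset.sum_comm, ← mul_sub]
  congr 1
  simp only [← Finset.sum_mul, h.sum_psi]
  simp [AddChar.map_zero_eq_one]

lemma MulChar.sum_one_mul (f : ZMod p → ℂ) :
    ∑ y : ZMod p, (1 : DirichletCharacter ℂ p) y * f y = ∑ y : ZMod p, f y - f 0 := by
  have h0 : (1 : DirichletCharacter ℂ p) 0 = 0 := MulChar.map_nonunit _ (by simp)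
  rw [← Finset.sum_erase_add _ (fun y => (1 : DirichletCharacter ℂ p) y * f y)
      (Finset.mem_univ (0 : ZMod p)), ← Finset.sum_erase_add _ f (Finset.mem_univ (0 : ZMod p)),
    h0, zero_mul, add_zero, add_sub_cancel_right]
  refine Finset.sum_congr rfl fun y hy => ?_
  rw [MulChar.one_apply (isUnit_iff_ne_zero.mpr (Finset.ne_of_mem_erase hy)), one_mul]

lemma IsCoord.sum_char_psi (h : IsCoord Q δ α E) {ω : DirichletCharacter ℂ p} (hω : ω ≠ 1)
    (y' : ZMod p) : ∑ y : ZMod p, ω y * psi p α (-2 * y * y') =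
      ω⁻¹ ((2 * α : ℤ) : ZMod p) * gaussSum ω ZMod.stdAddChar * ω⁻¹ y' := by
  have h1 : ∀ y : ZMod p, psi p α (-2 * y * y') =
      (ZMod.stdAddChar (N := p)).mulShift (((2 * α : ℤ) : ZMod p) * y') y := by
    intro y
    rw [psi_apply, AddChar.mulShift_apply]
    congr 1
    push_cast
    ring
  simp only [h1]
  change gaussSum ω ((ZMod.stdAddChar (N := p)).mulShift (((2 * α : ℤ) : ZMod p) * y')) = _
  by_cases hy : y' = 0
  · have h0 : ω⁻¹ (0 : ZMod p) = 0 := MulChar.map_nonunit _ (by simp)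
    rw [hy, mul_zero, AddChar.mulShift_zero, gaussSum_one_right hω, h0, mul_zero]
  · have h2 : ((2 * α : ℤ) : ZMod p) * y' ≠ 0 := by
      refine mul_ne_zero ?_ hy
      push_cast
      exact mul_ne_zero h.two_ne_zero h.alpha
    have h3 := gaussSum_mulShift_eq ω (ZMod.stdAddChar (N := p)) (Units.mk0 _ h2)
    rw [Units.val_mk0] at h3
    rw [h3, map_mul]
    ring

/-- The twisted sum of `ρ*(S)v` by a nontrivial character only involves the even components. -/
lemma IsCoord.sum_char_weilS_mulVec (h : IsCoord Q δ α E) {ω : DirichletCharacter ℂ p} (hω : ω ≠ 1)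
    (v : A → ℂ) :
    ∑ y : ZMod p, ω y * ((weilS Q).mulVec v (E.symm (0, y)) + (weilS Q).mulVec v (E.symm (1, y))) =
      2 * normConst Q * (ω⁻¹ ((2 * α : ℤ) : ZMod p) * gaussSum ω ZMod.stdAddChar) *
        ∑ y : ZMod p, ω⁻¹ y * v (E.symm (0, y)) := by
  have h1 : ∀ y : ZMod p, ω y * ((weilS Q).mulVec v (E.symm (0, y)) +
      (weilS Q).mulVec v (E.symm (1, y))) = 2 * normConst Q *
      ∑ y' : ZMod p, (ω y * psi p α (-2 * y * y')) * v (E.symm (0, y')) := by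
    intro y
    rw [h.weilS_mulVec, h.weilS_mulVec, sgnTwo_zero_left, sgnTwo_one_one, ← mul_add,
      ← Finset.sum_add_distrib, Finset.mul_sum, Finset.mul_sum, Finset.mul_sum]
    exact Finset.sum_congr rfl fun y' _ => by ring
  simp only [h1]
  rw [← Finset.mul_sum, Finset.sum_comm]
  simp only [← Finset.sum_mul, h.sum_char_psi hω]
  rw [Finset.mul_sum, Finset.mul_sum]
  exact Finset.sum_congr rfl fun y _ => by ring

/-- A matrix `tens L M` with `M` upper triangular mod `p` and `L` diagonal acts by a monomial
matrix. -/
lemma tens_diagonal_mulVec (f : ZMod 2 → ℂ) {M : SL(2, ℤ)} (hM : ((M 1 0 : ℤ) : ZMod p) = 0)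
    (v : A → ℂ) (x : ZMod 2) (y : ZMod p) :
    (tens α E (Matrix.diagonal f) M).mulVec v (E.symm (x, y)) =
      f x * (quadChar (ZMod p) ((M 0 0 : ℤ) : ZMod p) *
        psi p α (((M 0 0 : ℤ) : ZMod p) * ((M 0 1 : ℤ) : ZMod p) * y ^ 2)) *
        v (E.symm (x, ((M 0 0 : ℤ) : ZMod p) * y)) := by
  rw [Matrix.mulVec, dotProduct, Finset.sum_eq_single (E.symm (x, ((M 0 0 : ℤ) : ZMod p) * y))]
  · rw [tens, Matrix.of_apply, AddEquiv.apply_symm_apply, AddEquiv.apply_symm_apply,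
      Matrix.diagonal_apply_eq, weilP, weilMat_of_eq_zero _ hM]
    simp
  · intro γ _ hγ
    rw [tens, Matrix.of_apply, AddEquiv.apply_symm_apply, weilP, weilMat_of_eq_zero _ hM,
      Matrix.diagonal_apply, map_entry, map_entry]
    by_cases h1 : x = (E γ).1
    · rw [if_neg (c := (E γ).2 = _), mul_zero, zero_mul]
      intro h2
      apply hγ
      rw [AddEquiv.eq_symm_apply]
      exact Prod.ext h1.symm h2
    · rw [if_neg h1, zero_mul, zero_mul]
  · simp

lemma neg_symm (E : A ≃+ ZMod 2 × ZMod p) (x : ZMod 2) (y : ZMod p) :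
    -E.symm (x, y) = E.symm (x, -y) := by
  rw [← map_neg, Prod.neg_mk, ZMod.neg_eq_self_mod_two]

lemma IsCoord.weilS_sq_mulVec (h : IsCoord Q δ α E) (v : A → ℂ) (γ : A) :
    (weilS Q).mulVec ((weilS Q).mulVec v) γ = eSig Q ^ 2 * v (-γ) := by
  obtain ⟨⟨x, y⟩, rfl⟩ := E.symm.surjective γ
  rw [Matrix.mulVec_mulVec, h.weilS_eq, h.tens_mul, h.twoS_mul_self, S_mul_S,
    tens_diagonal_mulVec _ (by simp), h.eSig_sq, neg_symm]
  simp [eta]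

end Coord

/-! ### Twists in terms of vector-valued functions -/

section Twists

variable {A : Type*} [AddCommGroup A] [Fintype A] [DecidableEq A] {p : ℕ} [Fact p.Prime]
  {Q : QuadraticMap ℤ A (AddCircle (1 : ℚ))} {δ α : ℤ} {E : A ≃+ ZMod 2 × ZMod p}

/-- The sum of `v` over the nonzero elements `(x, y)`, `y ≠ 0`, of the parity class `x`. -/
def punctSum (E : A ≃+ ZMod 2 × ZMod p) (v : A → ℂ) (x : ZMod 2) : ℂ :=
  ∑ y : ZMod p, v (E.symm (x, y)) - v (E.symm (x, 0))

lemma IsCoord.punctSum_weilS (h : IsCoord Q δ α E) (v : A → ℂ) (x : ZMod 2) :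
    punctSum E ((weilS Q).mulVec v) x = normConst Q *
      (((p : ℂ) - 1) * (v (E.symm (0, 0)) + sgnTwo x 1 * v (E.symm (1, 0))) -
        (punctSum E v 0 + sgnTwo x 1 * punctSum E v 1)) := by
  rw [punctSum, h.sum_weilS_mulVec, Finset.sum_add_distrib, ← Finset.mul_sum, punctSum, punctSum]
  ring

lemma punctSum_eq_of_forall {v w : A → ℂ} {x : ZMod 2}
    (hvw : ∀ y : ZMod p, y ≠ 0 → v (E.symm (x, y)) = w (E.symm (x, y))) :
    punctSum E v x = punctSum E w x := by
  rw [punctSum, punctSum, ← Finset.sum_erase_eq_sub (Finset.mem_univ _),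
    ← Finset.sum_erase_eq_sub (Finset.mem_univ _)]
  exact Finset.sum_congr rfl fun y hy => hvw y (Finset.ne_of_mem_erase hy)

/-- The components of `G` are `G_γ(τ) = χ(γ) f_γ(4pτ)`. -/
def HasComponents (Q : QuadraticMap ℤ A (AddCircle (1 : ℚ))) (E : A ≃+ ZMod 2 × ZMod p)
    (χ : DirichletCharacter ℂ p) (G : ℍ → ℂ) (f : ℍ → A → ℂ) : Prop :=
  ∀ (γ : A) (τ : ℍ), component p Q G γ τ = χ (E γ).2 * f (fourP p • τ) γ

variable {ι : A ≃+ ZMod (2 * p)} {hp : p ≠ 2} {χ : DirichletCharacter ℂ p} {G : ℍ → ℂ}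
  {f : ℍ → A → ℂ}

lemma HasComponents.twist_eq (hf : HasComponents Q (coordEquiv hp ι) χ G f)
    (ψ : DirichletCharacter ℂ p) (τ : ℍ) :
    twist Q ι ψ G τ = ∑ y : ZMod p, (ψ * χ) y * (f (fourP p • τ) ((coordEquiv hp ι).symm (0, y)) +
      f (fourP p • τ) ((coordEquiv hp ι).symm (1, y))) := by
  rw [twist, sum_eq_sum_coord (coordEquiv hp ι)]
  refine Finset.sum_congr rfl fun y _ => ?_
  rw [charAt_eq hp, charAt_eq hp, hf, hf, AddEquiv.apply_symm_apply, AddEquiv.apply_symm_apply,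
    MulChar.mul_apply]
  ring

lemma HasComponents.twistEven_eq (hf : HasComponents Q (coordEquiv hp ι) χ G f)
    (h : IsCoord Q δ α (coordEquiv hp ι)) (ψ : DirichletCharacter ℂ p) (τ : ℍ) :
    twistEven Q ι ψ G τ =
      ∑ y : ZMod p, (ψ * χ) y * f (fourP p • τ) ((coordEquiv hp ι).symm (0, y)) := by
  rw [twistEven, Finset.sum_filter, sum_eq_sum_coord (coordEquiv hp ι)]
  refine Finset.sum_congr rfl fun y _ => ?_
  rw [if_pos ((h.isEven_iff _).mpr (by simp)), if_neg (fun h' => by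
    simpa using (h.isEven_iff _).mp h'), charAt_eq hp, hf, AddEquiv.apply_symm_apply,
    MulChar.mul_apply]
  ring

lemma HasComponents.twistOdd_eq (hf : HasComponents Q (coordEquiv hp ι) χ G f)
    (h : IsCoord Q δ α (coordEquiv hp ι)) (ψ : DirichletCharacter ℂ p) (τ : ℍ) :
    twistOdd Q ι ψ G τ =
      ∑ y : ZMod p, (ψ * χ) y * f (fourP p • τ) ((coordEquiv hp ι).symm (1, y)) := by
  rw [twistOdd, Finset.sum_filter, sum_eq_sum_coord (coordEquiv hp ι)]
  refine Finset.sum_congr rfl fun y _ => ?_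
  rw [if_pos (c := IsOdd p Q ((coordEquiv hp ι).symm (1, y))) ((h.isOdd_iff _).mpr (by simp)),
    if_neg (fun h' => by simpa using (h.isOdd_iff _).mp h'), charAt_eq hp, hf,
    AddEquiv.apply_symm_apply, MulChar.mul_apply]
  ring

lemma IsCoord.invConst_mul (h : IsCoord Q δ α E) (κ : ℤ) :
    invConst p Q κ * Complex.I ^ ((κ : ℂ) / 2) = (2 * ((p : ℂ) - 1) * normConst Q)⁻¹ := by
  have hp0 := sqrt_ne_zero_complex (Fact.out (p := p.Prime)).ne_zero
  have h2 : ((Real.sqrt 2 : ℝ) : ℂ) ≠ 0 := by exact_mod_cast sqrt_ne_zero_complex (n := 2) (by simp)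
  have hp1 : (p : ℂ) - 1 ≠ 0 := by
    rw [sub_ne_zero]; exact_mod_cast (Fact.out (p := p.Prime)).one_lt.ne'
  have hs := eSig_ne_zero (Q := Q)
  have e1 : e (-((signature Q).val : ℂ) / 8) = (eSig Q)⁻¹ := by
    rw [eSig, ← e_neg]; congr 1; ring
  have e2 : Complex.I ^ (-((κ : ℂ) / 2)) * Complex.I ^ ((κ : ℂ) / 2) = 1 := by
    rw [← Complex.cpow_add _ _ Complex.I_ne_zero]; simp
  rw [invConst, e1, h.normConst_eq, mul_assoc, e2, mul_one]
  have e3 : ((Real.sqrt 2 : ℝ) : ℂ) * ((Real.sqrt 2 : ℝ) : ℂ) = 2 := by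
    have := sqrt_sq_complex 2
    rw [pow_two] at this
    exact_mod_cast this
  rw [← e3]
  field_simp

lemma HasComponents.zeroPart_eq (hf : HasComponents Q (coordEquiv hp ι) χ G f)
    (h : IsCoord Q δ α (coordEquiv hp ι)) (κ : ℤ) (τ : ℍ) :
    zeroPart Q ι χ κ G ((fourP p)⁻¹ • τ) = (2 * ((p : ℂ) - 1) * normConst Q)⁻¹ *
      (slashS κ (fun z => punctSum (coordEquiv hp ι) (f z) 0) τ +
        slashS κ (fun z => punctSum (coordEquiv hp ι) (f z) 1) τ) +
      1 / ((p : ℂ) - 1) * punctSum (coordEquiv hp ι) (f τ) 0 := by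
  rw [zeroPart]
  simp only [hf.twistEven_eq h, hf.twistOdd_eq h, inv_mul_cancel, MulChar.sum_one_mul]
  rw [atkinLehner_comp_fourP p κ (fun z => ∑ y : ZMod p, f z ((coordEquiv hp ι).symm (0, y)) -
    f z ((coordEquiv hp ι).symm (0, 0)) + (∑ y : ZMod p, f z ((coordEquiv hp ι).symm (1, y)) -
    f z ((coordEquiv hp ι).symm (1, 0)))), smul_inv_smul, ← mul_assoc, h.invConst_mul,
    slashS_add]
  rfl

lemma HasComponents.pPart_eq (hf : HasComponents Q (coordEquiv hp ι) χ G f)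
    (h : IsCoord Q δ α (coordEquiv hp ι)) (κ : ℤ) (τ : ℍ) :
    pPart Q ι χ κ G ((fourP p)⁻¹ • τ) = (2 * ((p : ℂ) - 1) * normConst Q)⁻¹ *
      (slashS κ (fun z => punctSum (coordEquiv hp ι) (f z) 0) τ -
        slashS κ (fun z => punctSum (coordEquiv hp ι) (f z) 1) τ) +
      1 / ((p : ℂ) - 1) * punctSum (coordEquiv hp ι) (f τ) 1 := by
  rw [pPart]
  simp only [hf.twistEven_eq h, hf.twistOdd_eq h, inv_mul_cancel, MulChar.sum_one_mul]
  rw [atkinLehner_comp_fourP p κ (fun z => ∑ y : ZMod p, f z ((coordEquiv hp ι).symm (0, y)) -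
    f z ((coordEquiv hp ι).symm (0, 0)) - (∑ y : ZMod p, f z ((coordEquiv hp ι).symm (1, y)) -
    f z ((coordEquiv hp ι).symm (1, 0)))), smul_inv_smul, ← mul_assoc, h.invConst_mul,
    slashS_sub]
  rfl

/-- The Atkin-Lehner condition in terms of the slash operator of `S`. -/
lemma HasComponents.atkinLehner_iff (hf : HasComponents Q (coordEquiv hp ι) χ G f)
    (h : IsCoord Q δ α (coordEquiv hp ι)) (κ : ℤ) (ψ : DirichletCharacter ℂ p) (τ : ℍ) :
    (atkinLehner p κ (twist Q ι ψ G) τ =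
      alConst Q α χ ψ κ * twistEven Q ι (ψ⁻¹ * (χ⁻¹) ^ 2) G τ) ↔
    slashS κ (fun z => ∑ y : ZMod p, (ψ * χ) y * (f z ((coordEquiv hp ι).symm (0, y)) +
      f z ((coordEquiv hp ι).symm (1, y)))) (fourP p • τ) =
    2 * normConst Q * ((ψ * χ)⁻¹ ((2 * α : ℤ) : ZMod p) * gaussSum (ψ * χ) ZMod.stdAddChar) *
      ∑ y : ZMod p, (ψ * χ)⁻¹ y * f (fourP p • τ) ((coordEquiv hp ι).symm (0, y)) := by
  have hp0 := sqrt_ne_zero_complex (Fact.out (p := p.Prime)).ne_zero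
  have h2 : ((Real.sqrt 2 : ℝ) : ℂ) ≠ 0 := by exact_mod_cast sqrt_ne_zero_complex (n := 2) (by simp)
  have e3 : (2 : ℂ) = ((Real.sqrt 2 : ℝ) : ℂ) * ((Real.sqrt 2 : ℝ) : ℂ) := by
    have := sqrt_sq_complex 2
    rw [pow_two] at this
    exact_mod_cast this.symm
  have h1 : atkinLehner p κ (twist Q ι ψ G) τ = Complex.I ^ ((κ : ℂ) / 2) * slashS κ (fun z =>
      ∑ y : ZMod p, (ψ * χ) y * (f z ((coordEquiv hp ι).symm (0, y)) +
        f z ((coordEquiv hp ι).symm (1, y)))) (fourP p • τ) := by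
    rw [funext (hf.twist_eq ψ)]
    exact atkinLehner_comp_fourP p κ (fun z => ∑ y : ZMod p, (ψ * χ) y *
      (f z ((coordEquiv hp ι).symm (0, y)) + f z ((coordEquiv hp ι).symm (1, y)))) τ
  have hI : Complex.I ^ ((κ : ℂ) / 2) ≠ 0 := by
    rw [Ne, Complex.cpow_eq_zero_iff]; simp
  have hω : ψ⁻¹ * (χ⁻¹) ^ 2 * χ = (ψ * χ)⁻¹ := by
    rw [mul_inv, pow_two, mul_assoc, mul_assoc, inv_mul_cancel, mul_one]
  have hc : alConst Q α χ ψ κ = Complex.I ^ ((κ : ℂ) / 2) * (2 * normConst Q *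
      ((ψ * χ)⁻¹ ((2 * α : ℤ) : ZMod p) * gaussSum (ψ * χ) ZMod.stdAddChar)) := by
    rw [alConst, h.normConst_eq, starRingEnd_apply, MulChar.star_apply', e3]
    field_simp
  rw [h1, hf.twistEven_eq h, hω, hc, mul_assoc]
  exact mul_right_inj' hI

lemma inverseMap_of_eq_zero {κ : ℤ} {γ : A} (hγ : ι γ = 0) (τ : ℍ) :
    inverseMap Q ι χ κ G τ γ = zeroPart Q ι χ κ G ((fourP p)⁻¹ • τ) := by
  rw [inverseMap, if_pos hγ]

lemma inverseMap_of_eq_p {κ : ℤ} {γ : A} (hp : p ≠ 2) (hγ : ι γ = (p : ZMod (2 * p))) (τ : ℍ) :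
    inverseMap Q ι χ κ G τ γ = pPart Q ι χ κ G ((fourP p)⁻¹ • τ) := by
  rw [inverseMap, if_neg, if_pos hγ]
  rw [coord_eq_zero hp, (coord_eq_p hp ι γ).mp hγ]
  simp

lemma coord_cases (hp : p ≠ 2) (ι : A ≃+ ZMod (2 * p)) (γ : A) :
    ι γ = 0 ∨ ι γ = (p : ZMod (2 * p)) ∨ (coordEquiv hp ι γ).2 ≠ 0 := by
  by_cases h2 : (coordEquiv hp ι γ).2 = 0
  · rw [coord_eq_zero hp, coord_eq_p hp]
    rcases zmodTwo_cases (coordEquiv hp ι γ).1 with h1 | h1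
    · exact Or.inl (Prod.ext h1 h2)
    · exact Or.inr (Or.inl (Prod.ext h1 h2))
  · exact Or.inr (Or.inr h2)

lemma HasComponents.inverseMap_eq (hf : HasComponents Q (coordEquiv hp ι) χ G f) {κ : ℤ} {γ : A}
    (hγ : (coordEquiv hp ι γ).2 ≠ 0) (τ : ℍ) : inverseMap Q ι χ κ G τ γ = f τ γ := by
  rw [inverseMap, if_neg, if_neg, hf, charAt_eq hp, starRingEnd_apply, MulChar.star_apply',
    ← mul_assoc, ← MulChar.mul_apply, inv_mul_cancel,
    MulChar.one_apply (isUnit_iff_ne_zero.mpr hγ), one_mul, smul_inv_smul]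
  · rw [coord_eq_p hp]
    intro h'
    apply hγ
    rw [h']
  · rw [coord_eq_zero hp]
    intro h'
    apply hγ
    rw [h']
    rfl

/-- The condition `χ(-1) = (-1)^(k + sig/2)`. -/
lemma char_neg_one_eq {κ : ℤ} (hχ : χ (-1) = Complex.exp
      (Real.pi * Complex.I * ((κ : ℂ) / 2 + ((signature Q).val : ℂ) / 2))) :
    χ (-1) = Complex.I ^ κ * eSig Q ^ 2 := by
  rw [hχ, mul_add, Complex.exp_add]
  congr 1
  · conv_rhs => rw [← Complex.exp_pi_div_two_mul_I, ← Complex.exp_int_mul]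
    congr 1; ring
  · rw [eSig, ← e_nat_mul, e]
    congr 1; push_cast; ring

end Twists

/-! ### From vector-valued to scalar-valued forms -/

section Expansion

lemma HasQExpansion.sum {ι : Type*} (s : Finset ι) {f : ι → ℍ → ℂ} {c : ι → ℤ → ℂ}
    (h : ∀ i ∈ s, HasQExpansion (f i) (c i)) :
    HasQExpansion (fun τ => ∑ i ∈ s, f i τ) (fun n => ∑ i ∈ s, c i n) := by
  classical
  induction s using Finset.induction_on with
  | empty =>
    simp only [Finset.sum_empty]
    exact HasQExpansion.zero
  | insert a s ha ih =>
    simp only [Finset.sum_insert ha]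
    exact (h a (Finset.mem_insert_self a s)).add
      (ih fun i hi => h i (Finset.mem_insert_of_mem hi))

variable {A : Type*} [AddCommGroup A] {p : ℕ} [Fact p.Prime]
  {Q : QuadraticMap ℤ A (AddCircle (1 : ℚ))} {δ α : ℤ} {E : A ≃+ ZMod 2 × ZMod p}

/-- Exponents congruent to `-Q(γ)` are multiples of `1/4p`. -/
lemma IsCoord.exists_eq_div (h : IsCoord Q δ α E) {γ : A} {n : ℚ}
    (hn : (n : AddCircle (1 : ℚ)) = -Q γ) : ∃ m : ℤ, n = (m : ℚ) / (4 * (p : ℚ)) := by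
  have hp0 : (p : ℚ) ≠ 0 := by exact_mod_cast (Fact.out (p := p.Prime)).ne_zero
  obtain ⟨m, hm⟩ := h.exists_num γ
  rw [hm, ← sub_eq_zero, sub_neg_eq_add, ← AddCircle.coe_add, AddCircle.coe_eq_zero_iff] at hn
  obtain ⟨k, hk⟩ := hn
  refine ⟨4 * p * k - m, ?_⟩
  rw [zsmul_eq_mul, mul_one] at hk
  rw [eq_div_iff (by positivity)]
  push_cast
  rw [hk]
  field_simp
  ring

lemma IsCoord.hasQExpansion_comp_fourP (h : IsCoord Q δ α E) {γ : A} {f : ℍ → ℂ} {c : ℚ → ℂ}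
    (hc : ∀ n : ℚ, c n ≠ 0 → (n : AddCircle (1 : ℚ)) = -Q γ) (hf : HasRatExpansion f c) :
    HasQExpansion (fun τ => f (fourP p • τ)) (fun m : ℤ => c ((m : ℚ) / (4 * (p : ℚ)))) := by
  have hp0 : (0 : ℚ) < 4 * p := by
    have := (Fact.out (p := p.Prime)).pos
    positivity
  have hpc : (p : ℂ) ≠ 0 := by exact_mod_cast (Fact.out (p := p.Prime)).ne_zero
  obtain ⟨⟨B, hB⟩, hs⟩ := hf
  refine ⟨⟨⌊B * (4 * p)⌋, fun n hn => hB _ ?_⟩, fun τ => ?_⟩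
  · rw [div_lt_iff₀ hp0]
    exact lt_of_lt_of_le (by exact_mod_cast hn) (Int.floor_le _)
  · have hinj : Function.Injective (fun m : ℤ => (m : ℚ) / (4 * (p : ℚ))) := by
      intro m m' hm
      have := (div_left_inj' hp0.ne').mp hm
      exact_mod_cast this
    have h1 := hs (fourP p • τ)
    rw [← hinj.hasSum_iff] at h1
    · refine h1.congr_fun ?_ |> id
      intro m
      simp only [Function.comp_apply, coe_fourP]
      congr 2
      push_cast
      field_simp
    · intro n hn
      have : c n = 0 := by
        by_contra h0
        obtain ⟨m, hm⟩ := h.exists_eq_div (hc n h0)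
        exact hn ⟨m, hm.symm⟩
      rw [this, zero_mul]

lemma IsCoord.hasFracExpansion (h : IsCoord Q δ α E) {γ : A} {f : ℍ → ℂ} {c : ℚ → ℂ}
    (hc : ∀ n : ℚ, c n ≠ 0 → (n : AddCircle (1 : ℚ)) = -Q γ) (hf : HasRatExpansion f c) :
    HasFracExpansion f := by
  refine ⟨4 * p, c, Nat.mul_pos four_pos (Fact.out (p := p.Prime)).pos, fun n hn => ?_, hf⟩
  obtain ⟨m, hm⟩ := h.exists_eq_div (hc n hn)
  exact ⟨m, by rw [hm]; push_cast; rfl⟩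

end Expansion

section Forward

variable {A : Type*} [AddCommGroup A] [Fintype A] [DecidableEq A] {p : ℕ} [Fact p.Prime]
  {Q : QuadraticMap ℤ A (AddCircle (1 : ℚ))} {δ α : ℤ} {E : A ≃+ ZMod 2 × ZMod p}

lemma slashS_of_mem_vectorForms {κ : ℤ} {F : ℍ → A → ℂ} (hF : F ∈ vectorForms Q κ) (γ : A) (τ : ℍ) :
    slashS κ (fun z => F z γ) τ = (weilS Q).mulVec (F τ) γ := by
  have h1 := hF.2.1 _ _ DualWeil.S τ
  change F (ModularGroup.S • τ) = _ at h1
  rw [slashS, h1, Pi.smul_apply, smul_eq_mul, ← mul_assoc,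
    ← zpow_add₀ (Mp2Z.root_ne_zero _ _), neg_add_cancel, zpow_zero, one_mul]

lemma char_neg_one_mul_self {χ : DirichletCharacter ℂ p} : χ (-1) * χ (-1) = 1 := by
  rw [← map_mul, neg_one_mul, neg_neg, map_one]

/-- The parity of the components of a vector-valued form, from the action of `-1`. -/
lemma IsCoord.neg_of_mem_vectorForms (h : IsCoord Q δ α E) {κ : ℤ} {χ : DirichletCharacter ℂ p}
    (hχ : χ (-1) = Complex.I ^ κ * eSig Q ^ 2) {F : ℍ → A → ℂ} (hF : F ∈ vectorForms Q κ)
    (τ : ℍ) (γ : A) : F τ (-γ) = χ (-1) * F τ γ := by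
  have h1 : F (liftNeg.mat • τ) γ = liftNeg.root τ ^ κ * (weilS Q * weilS Q).mulVec (F τ) γ :=
    congrFun (hF.2.1 _ _ (DualWeil.S.mul DualWeil.S) τ) γ
  rw [liftNeg_mat, liftNeg_root, ModularGroup.SL_neg_smul, one_smul,
    ← Matrix.mulVec_mulVec, h.weilS_sq_mulVec, ← mul_assoc, ← hχ] at h1
  rw [h1, ← mul_assoc, char_neg_one_mul_self, one_mul]

variable {ι : A ≃+ ZMod (2 * p)} {hp : p ≠ 2} {χ : DirichletCharacter ℂ p}

lemma twistedComponentSum_apply (hp : p ≠ 2) (ι : A ≃+ ZMod (2 * p)) (χ : DirichletCharacter ℂ p)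
    (F : ℍ → A → ℂ) (τ : ℍ) : twistedComponentSum ι χ F τ =
      ∑ γ : A, χ (coordEquiv hp ι γ).2 * F (fourP p • τ) γ := by
  simp only [← charAt_eq hp]
  rfl

/-- The Fourier expansion of `φ_χ(F)` is supported on the classes `γ ≠ 0, p`, and its components
are `χ(γ) F_γ(4pτ)`. -/
lemma IsCoord.hasComponents_of_mem_vectorForms (h : IsCoord Q δ α (coordEquiv hp ι)) {κ : ℤ}
    (hχ : χ (-1) = Complex.I ^ κ * eSig Q ^ 2) {F : ℍ → A → ℂ} (hF : F ∈ vectorForms Q κ) :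
    HasComponents Q (coordEquiv hp ι) χ (twistedComponentSum ι χ F) F ∧
    ∃ c : ℤ → ℂ, HasQExpansion (twistedComponentSum ι χ F) c ∧
      ∀ n : ℤ, c n ≠ 0 → ∃ γ : A, ι γ ≠ 0 ∧ ι γ ≠ (p : ZMod (2 * p)) ∧ InSupport p Q γ n := by
  classical
  choose c hc hs using hF.2.2
  have hq : ∀ γ, HasQExpansion (fun τ => F (fourP p • τ) γ)
      (fun m : ℤ => c γ ((m : ℚ) / (4 * (p : ℚ)))) :=
    fun γ => h.hasQExpansion_comp_fourP (hc γ) (hs γ)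
  have hsum : HasQExpansion (twistedComponentSum ι χ F) (fun m : ℤ => ∑ γ : A,
      χ (coordEquiv hp ι γ).2 * c γ ((m : ℚ) / (4 * (p : ℚ)))) := by
    have h1 : twistedComponentSum ι χ F = fun τ =>
        ∑ γ : A, χ (coordEquiv hp ι γ).2 * F (fourP p • τ) γ :=
      funext (twistedComponentSum_apply hp ι χ F)
    rw [h1]
    exact HasQExpansion.sum _ fun γ _ => (hq γ).smul (χ (coordEquiv hp ι γ).2)
  refine ⟨fun γ τ => ?_, _, hsum, fun n hn => ?_⟩
  · rw [component, hsum.qCoeff_eq]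
    -- only the classes `±γ` contribute to the component of index `γ`
    have h1 : ∀ n : ℤ, (if InSupport p Q γ n then (∑ γ' : A, χ (coordEquiv hp ι γ').2 *
        c γ' ((n : ℚ) / (4 * (p : ℚ)))) * e (n * (τ : ℂ)) else 0) =
        ∑ γ' ∈ ({γ, -γ} : Finset A), χ (coordEquiv hp ι γ').2 *
          (c γ' ((n : ℚ) / (4 * (p : ℚ))) * e (n * (τ : ℂ))) := by
      intro n
      by_cases hn : InSupport p Q γ n
      · rw [if_pos hn, Finset.sum_mul]
        symm
        refine (Finset.sum_subset (Finset.subset_univ _) fun γ' _ hγ' => ?_).trans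
          (Finset.sum_congr rfl fun _ _ => (mul_assoc _ _ _).symm)
        have : c γ' ((n : ℚ) / (4 * (p : ℚ))) = 0 := by
          by_contra h0
          have h2 : Q γ' = Q γ := neg_injective ((hc γ' _ h0).symm.trans hn)
          rcases h.eq_or_eq_neg h2 with h3 | h3 <;> simp [h3] at hγ'
        rw [this]; ring
      · rw [if_neg hn]
        symm
        refine Finset.sum_eq_zero fun γ' hγ' => ?_
        have hQ : Q γ' = Q γ := by
          rw [Finset.mem_insert, Finset.mem_singleton] at hγ'
          rcases hγ' with rfl | rfl
          · rfl
          · rw [QuadraticMap.map_neg]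
        have : c γ' ((n : ℚ) / (4 * (p : ℚ))) = 0 := by
          by_contra h0
          exact hn ((hc γ' _ h0).trans (by rw [hQ]))
        rw [this]; ring
    simp only [h1]
    have h2 := hasSum_sum (s := ({γ, -γ} : Finset A)) fun γ' _ =>
      ((hq γ').2 τ).mul_left (χ (coordEquiv hp ι γ').2)
    rw [h2.tsum_eq]
    have h3 : χ (coordEquiv hp ι (-γ)).2 * F (fourP p • τ) (-γ) =
        χ (coordEquiv hp ι γ).2 * F (fourP p • τ) γ := by
      rw [h.neg_of_mem_vectorForms hχ hF, map_neg, Prod.snd_neg, ← neg_one_mul, map_mul]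
      linear_combination χ (coordEquiv hp ι γ).2 * F (fourP p • τ) γ * char_neg_one_mul_self (χ := χ)
    by_cases hγ : γ = -γ
    · have h4 : (coordEquiv hp ι γ).2 = 0 := by
        have := congrArg (fun z => (coordEquiv hp ι z).2) hγ
        simp only [map_neg, Prod.snd_neg] at this
        have h5 : 2 * (coordEquiv hp ι γ).2 = 0 := by linear_combination this
        exact (mul_eq_zero.mp h5).resolve_left h.two_ne_zero
      have h5 : χ (0 : ZMod p) = 0 := MulChar.map_nonunit _ (by simp)
      rw [← hγ, Finset.pair_eq_singleton, Finset.sum_singleton, h4, h5]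
      ring
    · rw [Finset.sum_pair hγ, h3]
      ring
  · obtain ⟨γ, -, hγ⟩ := Finset.exists_ne_zero_of_sum_ne_zero hn
    have h1 := hc γ _ (right_ne_zero_of_mul hγ)
    have h2 : (coordEquiv hp ι γ).2 ≠ 0 := by
      intro h0
      apply left_ne_zero_of_mul hγ
      rw [h0]
      exact MulChar.map_nonunit _ (by simp)
    refine ⟨γ, fun h0 => h2 ?_, fun h0 => h2 ?_, h1⟩
    · rw [(coord_eq_zero hp ι γ).mp h0]; rfl
    · rw [(coord_eq_p hp ι γ).mp h0]

lemma thetaMult_neg_one : thetaMult (-1) = -Complex.I := by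
  have h1 : thetaSymbol 0 (-1) = 1 := by simp [thetaSymbol]
  have h2 : epsd (-1) = Complex.I := by simp [epsd]
  have h3 : ((-1 : SL(2, ℤ)) 1 0) = 0 := by simp
  have h4 : ((-1 : SL(2, ℤ)) 1 1) = -1 := by simp
  rw [thetaMult, h3, h4, h1, h2]
  simp

lemma eta_eq (hp : p ≠ 2) : (p % 4 = 1 ∧ eta p = 1) ∨ (p % 4 = 3 ∧ eta p = -1) := by
  have h1 := quadraticChar_neg_one (F := ZMod p) (ringChar_ne_two hp)
  rw [ZMod.card] at h1
  have h2 : p % 2 = 1 := Nat.odd_iff.mp (odd_of_ne_two hp)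
  have h3 : eta p = ((quadraticChar (ZMod p) (-1) : ℤ) : ℂ) := rfl
  rw [h3, h1]
  rcases (by omega : p % 4 = 1 ∨ p % 4 = 3) with h4 | h4
  · left
    rw [ZMod.χ₄_nat_one_mod_four h4]; simp [h4]
  · right
    rw [ZMod.χ₄_nat_three_mod_four h4]; simp [h4]

/-- The sign of the theta multiplier system is `-δ(-1/p)`. -/
lemma IsCoord.sign_eq (h : IsCoord Q δ α E) {κ : ℤ} (hκ : Odd κ)
    (hχ : χ (-1) = Complex.I ^ κ * eSig Q ^ 2) {s : ℤ} (hs : s = 1 ∨ s = -1)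
    (h1 : thetaMult (-1) ^ s * χ (-1) * Complex.I ^ κ = 1) :
    (p % 4 = 1 ∧ s = -δ) ∨ (p % 4 = 3 ∧ s = δ) := by
  have h2 : Complex.I ^ κ * Complex.I ^ κ = -1 := by
    rw [← mul_zpow, Complex.I_mul_I, hκ.neg_one_zpow]
  have h3 : (-Complex.I) ^ s * (δ * Complex.I * eta p) = -1 := by
    rw [thetaMult_neg_one, hχ, h.eSig_sq] at h1
    linear_combination -h1 + (-Complex.I) ^ s * (δ * Complex.I * eta p) * h2
  have hI := Complex.I_mul_I
  have hII : Complex.I⁻¹ = -Complex.I := Complex.inv_I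
  rcases eta_eq h.odd with ⟨h4, h5⟩ | ⟨h4, h5⟩ <;> rw [h5] at h3 <;> [left; right] <;>
    refine ⟨h4, ?_⟩ <;> rcases hs with rfl | rfl <;> rcases h.delta with rfl | rfl <;>
    simp [hI] at h3 ⊢ <;> norm_num at h3

/-- The transformation of `φ_χ(F)` under `Γ₀(16p²)`. -/
lemma IsCoord.twistedComponentSum_smul (h : IsCoord Q δ α (coordEquiv hp ι)) {κ : ℤ} (hκ : Odd κ)
    (hχ : χ (-1) = Complex.I ^ κ * eSig Q ^ 2) {F : ℍ → A → ℂ} (hF : F ∈ vectorForms Q κ)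
    {s : ℤ} (hs : s = 1 ∨ s = -1) (hs1 : thetaMult (-1) ^ s * χ (-1) * Complex.I ^ κ = 1)
    {M : SL(2, ℤ)} (hM : M ∈ CongruenceSubgroup.Gamma0 (16 * p ^ 2)) (τ : ℍ) :
    twistedComponentSum ι χ F (M • τ) = χ ((M 1 1 : ℤ) : ZMod p) * thetaMult M ^ s *
      cd M τ ^ ((κ : ℂ) / 2) * twistedComponentSum ι χ F τ := by
  have hpp : p ≠ 0 := (Fact.out (p := p.Prime)).ne_zero
  have hp0 : (p : ℂ) ≠ 0 := by exact_mod_cast hpp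
  rw [CongruenceSubgroup.Gamma0_mem, ZMod.intCast_zmod_eq_zero_iff_dvd] at hM
  obtain ⟨m, hm⟩ := hM
  have hdet := SL2_det M
  set a := M 0 0 with ha
  set b := M 0 1 with hb
  set d := M 1 1 with hd
  have hm' : M 1 0 = 4 * p * (4 * p * m) := by rw [hm]; push_cast; ring
  -- conjugation by `diag(4p, 1)` takes `M` to `M'`
  set M' : SL(2, ℤ) := ⟨!![a, 4 * p * b; 4 * p * m, d], by
    rw [Matrix.det_fin_two_of, ← hdet, hm']; ring⟩ with hM'
  have e00 : M' 0 0 = a := rfl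
  have e01 : M' 0 1 = 4 * p * b := rfl
  have e10 : M' 1 0 = 4 * p * m := rfl
  have e11 : M' 1 1 = d := rfl
  have hcd : cd M' (fourP p • τ) = cd M τ := by
    rw [cd, cd, coe_fourP, e10, e11, hm']; push_cast; ring
  have hsm : fourP p • M • τ = M' • (fourP p • τ) := by
    ext
    rw [coe_fourP, coe_smul_SL, coe_smul_SL, hcd, coe_fourP, e00, e01]
    push_cast; ring
  have hlow : LowerFour M' := by
    rw [LowerFour, e10, mul_assoc]; omega
  obtain ⟨g, l, n, hg, hl, hn, hroot⟩ := h.thetaLift hlow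
  have hn4 : (4 : ℤ) ∣ n := by
    rw [e01, e11] at hn
    have : (4 : ℤ) ∣ 4 * p * b * d := ⟨p * b * d, by ring⟩
    exact (dvd_add_left this).mp hn
  have hquart : ∀ x : ZMod 2, quart δ x ^ n = 1 := by
    intro x
    obtain ⟨j, rfl⟩ := hn4
    rw [zpow_mul]
    have := h.quart_pow_four x
    rw [show quart δ x ^ (4 : ℤ) = quart δ x ^ 4 from by norm_cast, this, one_zpow]
  have hcp : ((M' 1 0 : ℤ) : ZMod p) = 0 := by rw [e10]; simp
  have hbp : ((M' 0 1 : ℤ) : ZMod p) = 0 := by rw [e01]; simp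
  have had : (a : ZMod p) * (d : ZMod p) = 1 := by
    have := congrArg (Int.cast : ℤ → ZMod p) hdet
    rw [hm'] at this
    push_cast at this
    simpa using this
  have ha0 : (a : ZMod p) ≠ 0 := left_ne_zero_of_mul_eq_one had
  have hd0 : (d : ZMod p) ≠ 0 := right_ne_zero_of_mul_eq_one had
  have hqa : quadChar (ZMod p) (a : ZMod p) = quadChar (ZMod p) (d : ZMod p) := by
    rw [eq_inv_of_mul_eq_one_left had, quadChar_inv]
  have hF1 := hF.2.1 g _ hl.2 (fourP p • τ)
  rw [hg] at hF1
  -- the action on components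
  have hact : ∀ (x : ZMod 2) (y : ZMod p), F (M' • (fourP p • τ)) ((coordEquiv hp ι).symm (x, y)) =
      g.root (fourP p • τ) ^ κ * (l * quadChar (ZMod p) (d : ZMod p) *
        F (fourP p • τ) ((coordEquiv hp ι).symm (x, (a : ZMod p) * y))) := by
    intro x y
    rw [hF1, Pi.smul_apply, smul_eq_mul, tens_diagonal_mulVec _ hcp, hquart, hbp, e00, hqa]
    simp
  have hsum : twistedComponentSum ι χ F (M • τ) = g.root (fourP p • τ) ^ κ * l *
      quadChar (ZMod p) (d : ZMod p) * χ (d : ZMod p) * twistedComponentSum ι χ F τ := by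
    rw [twistedComponentSum_apply hp, twistedComponentSum_apply hp, hsm,
      sum_eq_sum_coord (coordEquiv hp ι), sum_eq_sum_coord (coordEquiv hp ι), Finset.mul_sum]
    refine Finset.sum_equiv (Equiv.mulLeft₀ (a : ZMod p) ha0) (by simp) fun y _ => ?_
    rw [hact, hact]
    simp only [Equiv.mulLeft₀_apply, AddEquiv.apply_symm_apply, map_mul]
    have : χ (d : ZMod p) * χ (a : ZMod p) = 1 := by rw [← map_mul, mul_comm, had, map_one]
    linear_combination (-(g.root (fourP p • τ) ^ κ * l * quadChar (ZMod p) (d : ZMod p) * χ y *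
      (F (fourP p • τ) ((coordEquiv hp ι).symm (0, (a : ZMod p) * y)) +
        F (fourP p • τ) ((coordEquiv hp ι).symm (1, (a : ZMod p) * y))))) * this
  -- the automorphy factor: `l^δ ν_ϑ(M')` is a sign
  have hr := hroot (fourP p • τ)
  rw [thetaFactor, hcd] at hr
  have hsq := g.root_sq (fourP p • τ)
  rw [hg, hcd] at hsq
  set w := cd M τ ^ (1 / 2 : ℂ) with hw
  have hw2 : w ^ 2 = cd M τ := sqrt_sq _
  have hw0 : w ≠ 0 := by
    intro h0
    apply cd_ne_zero M τ
    rw [← hw2, h0]; simp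
  set r := g.root (fourP p • τ) with hrdef
  set t := thetaMult M' with ht
  have hl0 := hl.1
  have ht0 : t ≠ 0 := by
    intro h0
    rw [h0, zero_mul] at hr
    have := mul_ne_zero (zpow_ne_zero (-δ) hl0) (Mp2Z.root_ne_zero g (fourP p • τ))
    exact this hr
  have hrw : r = w ∨ r = -w := sq_eq_sq_iff_eq_or_eq_neg.mp (hsq.trans hw2.symm)
  have hfac : r ^ κ * l = t ^ (-δ) * w ^ κ := by
    rcases hrw with h0 | h0
    · rw [h0] at hr ⊢
      have h1 := mul_right_cancel₀ hw0 hr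
      rw [← h1]
      rcases h.delta with rfl | rfl <;> simp [mul_comm]
    · rw [h0] at hr ⊢
      have h1 : l ^ (-δ) = -t := by
        apply mul_right_cancel₀ hw0
        linear_combination -hr
      rw [hκ.neg_zpow]
      rcases h.delta with rfl | rfl
      · have : l = -t⁻¹ := by
          rw [← inv_inv l, ← zpow_neg_one l, h1, inv_neg]
        rw [this]; simp [mul_comm]
      · have : l = -t := by simpa using h1
        rw [this]; simp [mul_comm]
  have hodd : Odd d := e11 ▸ hlow.odd
  obtain ⟨h1, h3⟩ := thetaMult_reciprocity (M := M) (M' := M') hp (by rw [e10, hm']) e11.symm hodd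
    hd0 ⟨-b, a, by linear_combination hdet⟩
  have hq1 : quadChar (ZMod p) (d : ZMod p) * quadChar (ZMod p) (d : ZMod p) = 1 :=
    quadChar_mul_self hd0
  have hq0 : (quadChar (ZMod p) (d : ZMod p))⁻¹ = quadChar (ZMod p) (d : ZMod p) :=
    inv_eq_of_mul_eq_one_left hq1
  have hmult : t ^ (-δ) * quadChar (ZMod p) (d : ZMod p) = thetaMult M ^ s := by
    have hqd : quadChar (ZMod p) (d : ZMod p) = quadChar (ZMod p) (d : ZMod p) ^ (-δ) := by
      rcases h.delta with rfl | rfl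
      · rw [zpow_neg_one, hq0]
      · simp
    rw [hqd, ← mul_zpow]
    rcases h.sign_eq hκ hχ hs hs1 with ⟨h4, h5⟩ | ⟨h4, h5⟩
    · rw [h1 h4, h5]
    · rw [h3 h4, h5, inv_zpow, zpow_neg, inv_inv]
  rw [hsum, cpow_half, ← hw, ← hmult]
  linear_combination quadChar (ZMod p) (d : ZMod p) * χ (d : ZMod p) *
    twistedComponentSum ι χ F τ * hfac

lemma mdiff_sum {ι : Type*} (s : Finset ι) {f : ι → ℍ → ℂ} (h : ∀ i ∈ s, MDiff (f i)) :
    MDiff (fun τ => ∑ i ∈ s, f i τ) := by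
  classical
  induction s using Finset.induction_on with
  | empty => simpa using mdifferentiable_const
  | insert a s ha ih =>
    simp only [Finset.sum_insert ha]
    exact (h a (Finset.mem_insert_self a s)).add
      (ih fun i hi => h i (Finset.mem_insert_of_mem hi))

lemma mdiff_twistedComponentSum (hp : p ≠ 2) {κ : ℤ} {F : ℍ → A → ℂ} (hF : F ∈ vectorForms Q κ) :
    MDiff (twistedComponentSum ι χ F) := by
  rw [funext (twistedComponentSum_apply hp ι χ F)]
  exact mdiff_sum _ fun γ _ => (mdiff_comp_fourP p (F := fun τ => F τ γ) (hF.1 γ)).const_smul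
    (χ (coordEquiv hp ι γ).2)

/-- `φ_χ(F)` is meromorphic at the cusps, since `τ ↦ 4pMτ` is the composition of an affine map and
an element of `SL₂(ℤ)`. -/
lemma IsCoord.meromorphicAtCusps_twistedComponentSum (h : IsCoord Q δ α (coordEquiv hp ι)) {κ : ℤ}
    {F : ℍ → A → ℂ} (hF : F ∈ vectorForms Q κ) :
    MeromorphicAtCusps κ (twistedComponentSum ι χ F) := by
  intro M
  have hdet := SL2_det M
  have hp0 := (Fact.out (p := p.Prime)).pos
  obtain ⟨N, r, x, hr, K, hK, hcd, hN⟩ := exists_SL_mul_aff (4 * p * M 0 0) (4 * p * M 0 1)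
    (M 1 0) (M 1 1) (by
      have : 4 * (p : ℤ) * M 0 0 * M 1 1 - 4 * p * M 0 1 * M 1 0 = 4 * p := by
        linear_combination 4 * (p : ℤ) * hdet
      rw [this]; positivity)
  obtain ⟨g, L, hg, hL⟩ := h.exists_dualWeil N
  have hcont : Continuous (aff r x hr) := by
    refine UpperHalfPlane.isEmbedding_coe.continuous_iff.mpr ?_
    have : ((↑) : ℍ → ℂ) ∘ aff r x hr = fun τ : ℍ => (r : ℂ) * (τ : ℂ) + x :=
      funext (coe_aff r x hr)
    rw [this]
    exact (continuous_const.mul UpperHalfPlane.continuous_coe).add continuous_const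
  have hw0 : ∀ τ, cd M τ ^ (1 / 2 : ℂ) ≠ 0 := by
    intro τ h0
    apply cd_ne_zero M τ
    rw [← sqrt_sq (cd M τ), h0]; simp
  obtain ⟨K', hK', hroot⟩ := exists_const_of_sq (g.continuous_root.comp hcont)
    (continuous_sqrt_cd M) hw0 hK (fun τ => by
      rw [Function.comp_apply, g.root_sq, hg, hcd, sqrt_sq]; rfl)
  have hsm : ∀ τ : ℍ, fourP p • M • τ = N • aff r x hr τ := by
    intro τ
    refine hN τ _ ?_
    have h0 : (M 1 0 : ℂ) * τ + M 1 1 ≠ 0 := cd_ne_zero M τ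
    rw [coe_fourP, coe_smul_SL, cd]
    push_cast
    rw [mul_assoc, div_mul_cancel₀ _ h0]
    ring
  have hfun : (fun τ => cd M τ ^ (-((κ : ℂ) / 2)) * twistedComponentSum ι χ F (M • τ)) =
      fun τ => K' ^ κ * ∑ γ : A, χ (coordEquiv hp ι γ).2 *
        ∑ γ' : A, L γ γ' * F (aff r x hr τ) γ' := by
    funext τ
    have h1 : F (N • aff r x hr τ) = _ := hg ▸ hF.2.1 g L hL (aff r x hr τ)
    have h2 : g.root (aff r x hr τ) = K' * cd M τ ^ (1 / 2 : ℂ) := hroot τ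
    rw [twistedComponentSum_apply hp, hsm, h1, h2, cpow_neg_half, mul_zpow, Finset.mul_sum,
      Finset.mul_sum]
    refine Finset.sum_congr rfl fun γ _ => ?_
    rw [Pi.smul_apply, smul_eq_mul, zpow_neg]
    have := zpow_ne_zero κ (hw0 τ)
    rw [Matrix.mulVec, dotProduct]
    field_simp
  rw [hfun]
  refine HasFracExpansion.const_mul _ (HasFracExpansion.sum fun γ _ => HasFracExpansion.const_mul _
    (HasFracExpansion.sum fun γ' _ => HasFracExpansion.const_mul _ ?_))
  obtain ⟨c, hc, hs⟩ := hF.2.2 γ'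
  exact (h.hasFracExpansion hc hs).comp_aff r x hr

/-- The map `φ_χ` takes values in the forms satisfying the Atkin-Lehner condition. -/
lemma IsCoord.twistedComponentSum_mem (h : IsCoord Q δ α (coordEquiv hp ι)) {κ : ℤ} (hκ : Odd κ)
    (hχ : χ (-1) = Complex.I ^ κ * eSig Q ^ 2) {F : ℍ → A → ℂ} (hF : F ∈ vectorForms Q κ) :
    twistedComponentSum ι χ F ∈ alForms Q α ι χ κ := by
  obtain ⟨hcomp, hexp⟩ := h.hasComponents_of_mem_vectorForms hχ hF
  refine ⟨⟨⟨mdiff_twistedComponentSum hp hF, fun s hs hs1 M hM τ => ?_,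
    h.meromorphicAtCusps_twistedComponentSum hF⟩, hexp⟩, fun ψ hψ τ => ?_⟩
  · exact h.twistedComponentSum_smul hκ hχ hF hs hs1 hM τ
  · rw [hcomp.atkinLehner_iff h]
    have hω : ψ * χ ≠ 1 := fun h0 => hψ (eq_inv_of_mul_eq_one_left h0)
    rw [← h.sum_char_weilS_mulVec hω, slashS_sum]
    refine Finset.sum_congr rfl fun y _ => ?_
    rw [slashS_const_mul, slashS_add, slashS_of_mem_vectorForms hF, slashS_of_mem_vectorForms hF]

/-- Injectivity of `φ_χ`: the components of index `0` and `p`, which the twist by `χ` kills, are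
recovered from the sums of `F|S = ρ*(S)F` over the parity classes. -/
lemma IsCoord.inverseMap_twistedComponentSum (h : IsCoord Q δ α (coordEquiv hp ι)) {κ : ℤ}
    (hχ : χ (-1) = Complex.I ^ κ * eSig Q ^ 2) {F : ℍ → A → ℂ} (hF : F ∈ vectorForms Q κ) :
    inverseMap Q ι χ κ (twistedComponentSum ι χ F) = F := by
  obtain ⟨hcomp, -⟩ := h.hasComponents_of_mem_vectorForms hχ hF
  have hp1 : (p : ℂ) - 1 ≠ 0 := by
    rw [sub_ne_zero]; exact_mod_cast (Fact.out (p := p.Prime)).one_lt.ne'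
  have hK := normConst_ne_zero (Q := Q)
  have hP : ∀ x τ, slashS κ (fun z => punctSum (coordEquiv hp ι) (F z) x) τ =
      punctSum (coordEquiv hp ι) ((weilS Q).mulVec (F τ)) x := by
    intro x τ
    simp only [punctSum]
    rw [slashS_sub, slashS_sum]
    simp only [slashS_of_mem_vectorForms hF]
  funext τ γ
  rcases coord_cases hp ι γ with h0 | h0 | h0
  · have hγ : γ = (coordEquiv hp ι).symm (0, 0) := by
      rw [AddEquiv.eq_symm_apply, (coord_eq_zero hp ι γ).mp h0]; rfl
    rw [inverseMap_of_eq_zero h0, hcomp.zeroPart_eq h, hP, hP, h.punctSum_weilS, h.punctSum_weilS,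
      sgnTwo_zero_left, sgnTwo_one_one, hγ]
    field_simp
    ring
  · have hγ : γ = (coordEquiv hp ι).symm (1, 0) := by
      rw [AddEquiv.eq_symm_apply, (coord_eq_p hp ι γ).mp h0]
    rw [inverseMap_of_eq_p hp h0, hcomp.pPart_eq h, hP, hP, h.punctSum_weilS, h.punctSum_weilS,
      sgnTwo_zero_left, sgnTwo_one_one, hγ]
    field_simp
    ring
  · exact hcomp.inverseMap_eq h0 τ

end Forward

/-! ### Components of a scalar-valued form -/

section Components

variable {A : Type*} [AddCommGroup A] {p : ℕ} [Fact p.Prime]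
  {Q : QuadraticMap ℤ A (AddCircle (1 : ℚ))} {δ α : ℤ} {E : A ≃+ ZMod 2 × ZMod p}

lemma div_fourP_pos : (0 : ℚ) < 1 / (4 * (p : ℚ)) := by
  have := (Fact.out (p := p.Prime)).pos
  positivity

lemma coe_fourP_inv (τ : ℍ) : (((fourP p)⁻¹ • τ : ℍ) : ℂ) = τ / (4 * p) := by
  have h := coe_fourP p ((fourP p)⁻¹ • τ)
  have hp0 : (p : ℂ) ≠ 0 := by exact_mod_cast (Fact.out (p := p.Prime)).ne_zero
  rw [smul_inv_smul] at h
  rw [h]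
  field_simp

lemma geom_sum_root {N : ℕ} {z : ℂ} (hz : z ^ N = 1) :
    ∑ j ∈ Finset.range N, z ^ j = if z = 1 then (N : ℂ) else 0 := by
  split_ifs with h1
  · simp [h1]
  · have := mul_geom_sum z N
    rw [hz, sub_self] at this
    exact (mul_eq_zero.mp this).resolve_left (sub_ne_zero.mpr h1)

/-- The components of `G`, extracted by averaging over the translates by multiples of `1/4p`. -/
lemma IsCoord.component_eq (h : IsCoord Q δ α E) {G : ℍ → ℂ} {c : ℤ → ℂ} (hG : HasQExpansion G c)
    (γ : A) (τ : ℍ) : component p Q G γ ((fourP p)⁻¹ • τ) = 1 / (8 * (p : ℂ)) *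
      ∑ j ∈ Finset.range (4 * p), eQZ (Q γ) ^ j *
        G (aff (1 / (4 * (p : ℚ))) ((j : ℚ) / (4 * (p : ℚ))) div_fourP_pos τ) := by
  classical
  have hp0 : (p : ℂ) ≠ 0 := by exact_mod_cast (Fact.out (p := p.Prime)).ne_zero
  obtain ⟨m, hm⟩ := h.exists_num γ
  have h1 := hasSum_sum (s := Finset.range (4 * p)) fun j _ =>
    (hG.2 (aff (1 / (4 * (p : ℚ))) ((j : ℚ) / (4 * (p : ℚ))) div_fourP_pos τ)).mul_left
      (eQZ (Q γ) ^ j)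
  have h2 : ∀ n : ℤ, ∑ j ∈ Finset.range (4 * p), eQZ (Q γ) ^ j * (c n * e (n *
      (aff (1 / (4 * (p : ℚ))) ((j : ℚ) / (4 * (p : ℚ))) div_fourP_pos τ : ℂ))) =
      4 * p * if InSupport p Q γ n then c n * e (n * (((fourP p)⁻¹ • τ : ℍ) : ℂ)) else 0 := by
    intro n
    set z := eQZ (Q γ + ((n : ℚ) / (4 * (p : ℚ)) : ℚ)) with hz
    have hz1 : z = e (((m : ℂ) + n) / (4 * p)) := by
      rw [hz, hm, ← AddCircle.coe_add, eQZ_coe]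
      congr 1; push_cast; ring
    have hzN : z ^ (4 * p) = 1 := by
      rw [hz1, ← e_nat_mul, ← e_int (m + n)]
      congr 1; push_cast; field_simp
    have h3 : ∀ j : ℕ, eQZ (Q γ) ^ j * (c n * e (n *
        (aff (1 / (4 * (p : ℚ))) ((j : ℚ) / (4 * (p : ℚ))) div_fourP_pos τ : ℂ))) =
        c n * e (n * (((fourP p)⁻¹ • τ : ℍ) : ℂ)) * z ^ j := by
      intro j
      have h4 : e (n * (aff (1 / (4 * (p : ℚ))) ((j : ℚ) / (4 * (p : ℚ))) div_fourP_pos τ : ℂ)) =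
          e (n * (((fourP p)⁻¹ • τ : ℍ) : ℂ)) * e ((n : ℂ) / (4 * p)) ^ j := by
        rw [← e_nat_mul, ← e_add, coe_aff, coe_fourP_inv]
        congr 1; push_cast; ring
      have h5 : z = eQZ (Q γ) * e ((n : ℂ) / (4 * p)) := by
        rw [hz, eQZ_add, eQZ_coe]
        congr 2; push_cast; rfl
      rw [h4, h5, mul_pow]
      ring
    have h6 : InSupport p Q γ n ↔ z = 1 := by
      rw [InSupport, hz, eQZ_eq_one_iff, eq_neg_iff_add_eq_zero, add_comm]
    simp only [h3]
    rw [← Finset.mul_sum, geom_sum_root hzN]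
    simp only [h6]
    split_ifs <;> push_cast <;> ring
  simp only [h2] at h1
  rw [← h1.tsum_eq, tsum_mul_left, component, hG.qCoeff_eq, ← mul_assoc]
  congr 1
  field_simp
  norm_num

lemma component_neg (G : ℍ → ℂ) (γ : A) (τ : ℍ) :
    component p Q G (-γ) τ = component p Q G γ τ := by
  classical
  rw [component, component]
  refine congrArg (1 / 2 * ·) (tsum_congr fun n => if_congr ?_ rfl rfl)
  rw [InSupport, InSupport, QuadraticMap.map_neg]

lemma IsCoord.component_eq_zero (h : IsCoord Q δ α E) {G : ℍ → ℂ} {c : ℤ → ℂ}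
    (hG : HasQExpansion G c)
    (hc : ∀ n : ℤ, c n ≠ 0 → ∃ γ : A, (E γ).2 ≠ 0 ∧ InSupport p Q γ n) {γ : A}
    (hγ : (E γ).2 = 0) (τ : ℍ) : component p Q G γ τ = 0 := by
  classical
  rw [component, hG.qCoeff_eq]
  have : ∀ n : ℤ, (if InSupport p Q γ n then c n * e (n * (τ : ℂ)) else 0) = 0 := by
    intro n
    split_ifs with hn
    · have : c n = 0 := by
        by_contra h0
        obtain ⟨γ', h1, h2⟩ := hc n h0
        have hQ : Q γ' = Q γ := neg_injective (h2.symm.trans hn)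
        apply h1
        rcases h.eq_or_eq_neg hQ with h3 | h3
        · rw [h3, hγ]
        · rw [h3, map_neg, Prod.snd_neg, hγ, neg_zero]
      rw [this, zero_mul]
    · rfl
  simp [this]

lemma IsCoord.eq_neg_iff (h : IsCoord Q δ α E) (γ : A) : γ = -γ ↔ (E γ).2 = 0 := by
  constructor
  · intro hγ
    have := congrArg (fun z => (E z).2) hγ
    simp only [map_neg, Prod.snd_neg] at this
    have h5 : 2 * (E γ).2 = 0 := by linear_combination this
    exact (mul_eq_zero.mp h5).resolve_left h.two_ne_zero
  · intro hγ
    apply E.injective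
    rw [map_neg]
    exact Prod.ext (ZMod.neg_eq_self_mod_two _).symm (by simp [hγ])

lemma IsCoord.sum_component [Fintype A] (h : IsCoord Q δ α E) {G : ℍ → ℂ} {c : ℤ → ℂ}
    (hG : HasQExpansion G c)
    (hc : ∀ n : ℤ, c n ≠ 0 → ∃ γ : A, (E γ).2 ≠ 0 ∧ InSupport p Q γ n) (τ : ℍ) :
    ∑ γ : A, component p Q G γ τ = G τ := by
  classical
  have hs : ∀ γ : A, Summable fun n : ℤ => if InSupport p Q γ n then c n * e (n * (τ : ℂ)) else 0 :=
    fun γ => ((hG.2 τ).summable.indicator {n | InSupport p Q γ n}).congr fun n => by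
      simp [Set.indicator_apply]
  simp only [component, hG.qCoeff_eq]
  rw [← Finset.mul_sum, ← Summable.tsum_finsetSum fun γ _ => hs γ, ← tsum_mul_left,
    ← (hG.2 τ).tsum_eq]
  refine tsum_congr fun n => ?_
  by_cases h0 : c n = 0
  · simp [h0]
  obtain ⟨γ, h1, h2⟩ := hc n h0
  have h3 : ∀ γ' : A, InSupport p Q γ' n ↔ γ' ∈ ({γ, -γ} : Finset A) := by
    intro γ'
    rw [Finset.mem_insert, Finset.mem_singleton]
    constructor
    · exact fun h4 => h.eq_or_eq_neg (neg_injective (h4.symm.trans h2))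
    · rintro (rfl | rfl)
      · exact h2
      · rwa [InSupport, QuadraticMap.map_neg]
  simp only [h3]
  rw [Finset.sum_ite_mem, Finset.univ_inter,
    Finset.sum_pair fun h4 => h1 ((h.eq_neg_iff γ).mp h4)]
  ring

end Components

/-! ### The defect of `S`-equivariance -/

section Defect

variable {A : Type*} [AddCommGroup A] [Fintype A] [DecidableEq A] {p : ℕ} [Fact p.Prime]
  {Q : QuadraticMap ℤ A (AddCircle (1 : ℚ))} {δ α : ℤ} {E : A ≃+ ZMod 2 × ZMod p}
  {χ : DirichletCharacter ℂ p} {κ : ℤ}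

/-- The weight `κ/2` slash operator of `S` on vector-valued functions, without the Weil
representation. -/
def slashV (κ : ℤ) (f : ℍ → A → ℂ) (τ : ℍ) : A → ℂ :=
  Mp2Z.S.root τ ^ (-κ) • f (ModularGroup.S • τ)

lemma slashV_apply (f : ℍ → A → ℂ) (τ : ℍ) (γ : A) :
    slashV κ f τ γ = slashS κ (fun z => f z γ) τ := rfl

lemma slashV_slashV (f : ℍ → A → ℂ) (τ : ℍ) :
    slashV κ (slashV κ f) τ = Complex.I ^ (-κ) • f τ := by
  funext γ
  exact slashS_slashS κ (fun z => f z γ) τ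

lemma slashV_mulVec (N : Matrix A A ℂ) (f : ℍ → A → ℂ) (τ : ℍ) :
    slashV κ (fun z => N.mulVec (f z)) τ = N.mulVec (slashV κ f τ) := by
  rw [slashV, slashV, Matrix.mulVec_smul]

lemma slashV_eq_iff (f : ℍ → A → ℂ) (τ : ℍ) (w : A → ℂ) :
    slashV κ f τ = w ↔ f (ModularGroup.S • τ) = Mp2Z.S.root τ ^ κ • w := by
  have h0 := zpow_ne_zero κ (Mp2Z.root_ne_zero Mp2Z.S τ)
  rw [slashV, zpow_neg, inv_smul_eq_iff₀ h0]

/-- The failure `f|S - ρ*(S)f` of equivariance under `S`. -/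
def defectS (Q : QuadraticMap ℤ A (AddCircle (1 : ℚ))) (κ : ℤ) (f : ℍ → A → ℂ) (τ : ℍ) : A → ℂ :=
  slashV κ f τ - (weilS Q).mulVec (f τ)

lemma IsCoord.eSig_sq_mul_char (h : IsCoord Q δ α E) (hκ : Odd κ)
    (hχ : χ (-1) = Complex.I ^ κ * eSig Q ^ 2) : eSig Q ^ 2 * χ (-1) = Complex.I ^ (-κ) := by
  have h1 : Complex.I ^ κ * Complex.I ^ κ = -1 := by
    rw [← mul_zpow, Complex.I_mul_I, hκ.neg_one_zpow]
  have h2 : eSig Q ^ 2 * eSig Q ^ 2 = -1 := by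
    rw [h.eSig_sq]
    linear_combination (eta p * eta p) * h.delta_sq - eta_mul_self p
  rw [zpow_neg]
  refine eq_inv_of_mul_eq_one_left ?_
  rw [hχ]
  linear_combination Complex.I ^ κ * Complex.I ^ κ * h2 - h1

/-- The square of `f ↦ f|S` and that of `ρ*(S)` agree on functions of the parity of `χ`, so the
defect is anti-equivariant. -/
lemma IsCoord.slashV_defectS (h : IsCoord Q δ α E) (hκ : Odd κ)
    (hχ : χ (-1) = Complex.I ^ κ * eSig Q ^ 2) {f : ℍ → A → ℂ}
    (hf : ∀ τ γ, f τ (-γ) = χ (-1) * f τ γ) (τ : ℍ) :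
    slashV κ (defectS Q κ f) τ = -(weilS Q).mulVec (defectS Q κ f τ) := by
  have h1 : slashV κ (defectS Q κ f) τ =
      slashV κ (slashV κ f) τ - slashV κ (fun z => (weilS Q).mulVec (f z)) τ :=
    smul_sub (Mp2Z.S.root τ ^ (-κ)) (slashV κ f (ModularGroup.S • τ))
      ((weilS Q).mulVec (f (ModularGroup.S • τ)))
  have h2 : (weilS Q).mulVec ((weilS Q).mulVec (f τ)) = Complex.I ^ (-κ) • f τ := by
    funext γ
    rw [h.weilS_sq_mulVec, hf, ← mul_assoc, h.eSig_sq_mul_char hκ hχ]; rfl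
  rw [h1, slashV_slashV, slashV_mulVec, defectS, Matrix.mulVec_sub, h2]
  abel

/-- Orthogonality of characters: a function with vanishing sums against all nontrivial characters
is constant on the units. -/
lemma exists_const_of_sum_char_eq_zero {s : ZMod p → ℂ}
    (hs : ∀ ω : DirichletCharacter ℂ p, ω ≠ 1 → ∑ y : ZMod p, ω y * s y = 0) :
    ∃ c : ℂ, ∀ y : ZMod p, y ≠ 0 → s y = c := by
  have hp1 : ((Nat.totient p : ℕ) : ℂ) ≠ 0 := by
    exact_mod_cast (Nat.totient_pos.mpr (Fact.out (p := p.Prime)).pos).ne'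
  refine ⟨((Nat.totient p : ℕ) : ℂ)⁻¹ * ∑ y : ZMod p, (1 : DirichletCharacter ℂ p) y * s y,
    fun a ha => ?_⟩
  have h1 : ∑ ω : DirichletCharacter ℂ p, ω a⁻¹ * ∑ y : ZMod p, ω y * s y =
      ∑ y : ZMod p, (1 : DirichletCharacter ℂ p) y * s y := by
    rw [Finset.sum_eq_single 1]
    · rw [MulChar.one_apply (isUnit_iff_ne_zero.mpr (inv_ne_zero ha)), one_mul]
    · intro ω _ hω
      rw [hs ω hω, mul_zero]
    · simp
  rw [← h1]
  simp only [Finset.mul_sum]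
  rw [Finset.sum_comm]
  have h2 : ∀ y : ZMod p, ∑ ω : DirichletCharacter ℂ p,
      ((Nat.totient p : ℕ) : ℂ)⁻¹ * (ω a⁻¹ * (ω y * s y)) = if a = y then s y else 0 := by
    intro y
    have := DirichletCharacter.sum_char_inv_mul_char_eq ℂ (isUnit_iff_ne_zero.mpr ha) y
    rw [← Finset.mul_sum]
    simp only [← mul_assoc]
    rw [← Finset.sum_mul, this]
    split_ifs
    · field_simp
    · simp
  simp only [h2]
  simp

/-- If the twisted sums of an anti-equivariant function against all nontrivial characters vanish,
it is constant in each parity class away from `0` and `p`. -/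
lemma IsCoord.eq_of_sum_char (h : IsCoord Q δ α E) {u : ℍ → A → ℂ}
    (hS : ∀ τ, slashV κ u τ = -(weilS Q).mulVec (u τ))
    (hu : ∀ τ, ∀ ω : DirichletCharacter ℂ p, ω ≠ 1 →
      ∑ y : ZMod p, ω y * (u τ (E.symm (0, y)) + u τ (E.symm (1, y))) = 0)
    (τ : ℍ) (x : ZMod 2) {y y' : ZMod p} (hy : y ≠ 0) (hy' : y' ≠ 0) :
    u τ (E.symm (x, y)) = u τ (E.symm (x, y')) := by
  have hN : ∀ τ, ∃ b : ℂ, ∀ y : ZMod p, y ≠ 0 → (weilS Q).mulVec (u τ) (E.symm (0, y)) = b := by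
    intro τ
    obtain ⟨c, hc⟩ := exists_const_of_sum_char_eq_zero (hu τ)
    refine ⟨normConst Q * (u τ (E.symm (0, 0)) + u τ (E.symm (1, 0)) - c), fun y hy => ?_⟩
    rw [h.weilS_mulVec, sgnTwo_zero_left]
    congr 1
    have h1 := h.sum_psi y
    rw [if_neg hy] at h1
    have h2 : ∀ y' : ZMod p, psi p α (-2 * y * y') *
        (u τ (E.symm (0, y')) + 1 * u τ (E.symm (1, y'))) = c * psi p α (-2 * y' * y) +
          if y' = 0 then u τ (E.symm (0, 0)) + u τ (E.symm (1, 0)) - c else 0 := by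
      intro y'
      rw [one_mul, show -2 * y * y' = -2 * y' * y by ring]
      split_ifs with h0
      · rw [h0]; simp [AddChar.map_zero_eq_one]
      · rw [hc y' h0]; ring
    simp only [h2]
    rw [Finset.sum_add_distrib, ← Finset.mul_sum, h1]
    simp
  have h0 : ∀ (τ : ℍ) {y y' : ZMod p}, y ≠ 0 → y' ≠ 0 →
      u τ (E.symm (0, y)) = u τ (E.symm (0, y')) := by
    intro τ y y' hy hy'
    obtain ⟨z, rfl⟩ : ∃ z, τ = ModularGroup.S • z :=
      ⟨ModularGroup.S • τ, (S_smul_S_smul τ).symm⟩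
    obtain ⟨b, hb⟩ := hN z
    rw [(slashV_eq_iff u z _).mp (hS z)]
    simp only [Pi.smul_apply, Pi.neg_apply, hb y hy, hb y' hy']
  rcases zmodTwo_cases x with rfl | rfl
  · exact h0 τ hy hy'
  · obtain ⟨c, hc⟩ := exists_const_of_sum_char_eq_zero (hu τ)
    have := (hc y hy).trans (hc y' hy').symm
    rw [h0 τ hy hy'] at this
    exact add_left_cancel this

end Defect

/-! ### Equivariance of the completed form under `S` -/

section Completion

variable {A : Type*} [AddCommGroup A] [Fintype A] [DecidableEq A] {p : ℕ} [Fact p.Prime]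
  {Q : QuadraticMap ℤ A (AddCircle (1 : ℚ))} {δ α : ℤ} {E : A ≃+ ZMod 2 × ZMod p}
  {χ : DirichletCharacter ℂ p} {κ : ℤ}

/-- `F` is obtained from `f`, a function of the parity of `χ`, by replacing the components of
index `0` and `p` by those dictated by equivariance under `S`. -/
structure IsCompletion (Q : QuadraticMap ℤ A (AddCircle (1 : ℚ))) (E : A ≃+ ZMod 2 × ZMod p)
    (χ : DirichletCharacter ℂ p) (κ : ℤ) (f F : ℍ → A → ℂ) : Prop where
  neg : ∀ τ γ, f τ (-γ) = χ (-1) * f τ γ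
  off : ∀ τ x y, y ≠ 0 → F τ (E.symm (x, y)) = f τ (E.symm (x, y))
  center : ∀ τ x, F τ (E.symm (x, 0)) = (2 * ((p : ℂ) - 1) * normConst Q)⁻¹ *
    (slashS κ (fun z => punctSum E (f z) 0) τ +
      sgnTwo x 1 * slashS κ (fun z => punctSum E (f z) 1) τ) +
    1 / ((p : ℂ) - 1) * punctSum E (f τ) x

lemma natCast_sub_one_ne_zero (p : ℕ) [Fact p.Prime] : (p : ℂ) - 1 ≠ 0 := by
  rw [sub_ne_zero]; exact_mod_cast (Fact.out (p := p.Prime)).one_lt.ne'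

lemma char_neg_one_cases (χ : DirichletCharacter ℂ p) : χ (-1) = 1 ∨ χ (-1) = -1 :=
  mul_self_eq_one_iff.mp char_neg_one_mul_self

lemma IsCompletion.neg_eq {f F : ℍ → A → ℂ} (hF : IsCompletion Q E χ κ f F) (τ : ℍ) (γ : A) :
    F τ (-γ) = χ (-1) * F τ γ := by
  obtain ⟨⟨x, y⟩, rfl⟩ := E.symm.surjective γ
  rw [neg_symm]
  by_cases hy : y = 0
  · subst hy
    rw [neg_zero]
    rcases char_neg_one_cases χ with h1 | h1
    · rw [h1, one_mul]
    · have hP : ∀ z x, punctSum E (f z) x = 0 := by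
        intro z x
        have h2 : f z (E.symm (x, 0)) = 0 := by
          have := hF.neg z (E.symm (x, 0))
          rw [neg_symm, neg_zero, h1] at this
          linear_combination this / 2
        have h3 : ∑ y : ZMod p, f z (E.symm (x, y)) = -∑ y : ZMod p, f z (E.symm (x, y)) := by
          rw [← Finset.sum_neg_distrib]
          refine Finset.sum_equiv (Equiv.neg (ZMod p)) (by simp) fun y _ => ?_
          rw [Equiv.neg_apply, ← neg_symm, hF.neg, h1]; ring
        rw [punctSum, h2]
        linear_combination h3 / 2
      have h2 : F τ (E.symm (x, 0)) = 0 := by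
        rw [hF.center]
        simp [hP, slashS]
      rw [h2, mul_zero]
  · rw [hF.off _ _ _ (neg_ne_zero.mpr hy), hF.off _ _ _ hy, ← neg_symm, hF.neg]

lemma IsCoord.weilS_mulVec_of_support (h : IsCoord Q δ α E) {v : A → ℂ}
    (hv : ∀ x y, y ≠ 0 → v (E.symm (x, y)) = 0) (x : ZMod 2) (y : ZMod p) :
    (weilS Q).mulVec v (E.symm (x, y)) =
      normConst Q * (v (E.symm (0, 0)) + sgnTwo x 1 * v (E.symm (1, 0))) := by
  rw [h.weilS_mulVec, Finset.sum_eq_single 0]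
  · rw [mul_zero, AddChar.map_zero_eq_one, one_mul]
  · intro y _ hy
    rw [hv _ _ hy, hv _ _ hy]; ring
  · simp

/-- An anti-equivariant function supported on `{0, p}` vanishes. -/
lemma IsCoord.eq_zero_of_support (h : IsCoord Q δ α E) {v : ℍ → A → ℂ}
    (hS : ∀ τ, slashV κ v τ = -(weilS Q).mulVec (v τ))
    (hv : ∀ τ x y, y ≠ 0 → v τ (E.symm (x, y)) = 0) (τ : ℍ) : v τ = 0 := by
  have h1 : ∀ x : ZMod 2, v τ (E.symm (0, 0)) + sgnTwo x 1 * v τ (E.symm (1, 0)) = 0 := by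
    intro x
    have h2 := congrFun (hS τ) (E.symm (x, 1))
    rw [slashV_apply, slashS, hv _ _ _ one_ne_zero, mul_zero, Pi.neg_apply,
      h.weilS_mulVec_of_support (hv τ)] at h2
    exact (mul_eq_zero.mp (neg_eq_zero.mp h2.symm)).resolve_left normConst_ne_zero
  have e0 := h1 0
  have e1 := h1 1
  rw [sgnTwo_zero_left] at e0
  rw [sgnTwo_one_one] at e1
  funext γ
  obtain ⟨⟨x, y⟩, rfl⟩ := E.symm.surjective γ
  by_cases hy : y = 0
  · subst hy
    rcases zmodTwo_cases x with rfl | rfl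
    · rw [Pi.zero_apply]; linear_combination (e0 + e1) / 2
    · rw [Pi.zero_apply]; linear_combination (e0 - e1) / 2
  · exact hv _ _ _ hy

/-- The Atkin-Lehner condition makes the completion equivariant under `S`. -/
lemma IsCompletion.map_S {f F : ℍ → A → ℂ} (hF : IsCompletion Q E χ κ f F) (h : IsCoord Q δ α E)
    (hκ : Odd κ) (hχ : χ (-1) = Complex.I ^ κ * eSig Q ^ 2)
    (hAL : ∀ ω : DirichletCharacter ℂ p, ω ≠ 1 → ∀ τ,
      slashS κ (fun z => ∑ y : ZMod p, ω y * (f z (E.symm (0, y)) + f z (E.symm (1, y)))) τ =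
      2 * normConst Q * (ω⁻¹ ((2 * α : ℤ) : ZMod p) * gaussSum ω ZMod.stdAddChar) *
        ∑ y : ZMod p, ω⁻¹ y * f τ (E.symm (0, y))) (τ : ℍ) :
    F (ModularGroup.S • τ) = Mp2Z.S.root τ ^ κ • (weilS Q).mulVec (F τ) := by
  have hp1 := natCast_sub_one_ne_zero p
  have hK := normConst_ne_zero (Q := Q)
  have hu : ∀ τ x {y y' : ZMod p}, y ≠ 0 → y' ≠ 0 →
      defectS Q κ f τ (E.symm (x, y)) = defectS Q κ f τ (E.symm (x, y')) := by
    refine fun τ x y y' => h.eq_of_sum_char (h.slashV_defectS hκ hχ hF.neg) (fun τ ω hω => ?_) τ x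
    have h1 := hAL ω hω τ
    rw [← h.sum_char_weilS_mulVec hω, slashS_sum] at h1
    rw [← sub_eq_zero] at h1
    rw [← h1, ← Finset.sum_sub_distrib]
    refine Finset.sum_congr rfl fun y _ => ?_
    rw [slashS_const_mul, slashS_add, defectS, Pi.sub_apply, Pi.sub_apply, slashV_apply,
      slashV_apply]
    ring
  have hv : ∀ τ x y, y ≠ 0 → defectS Q κ F τ (E.symm (x, y)) = 0 := by
    intro τ x
    -- the two defects differ by a constant on each parity class
    have hd : ∀ y, y ≠ 0 → defectS Q κ F τ (E.symm (x, y)) = defectS Q κ f τ (E.symm (x, y)) -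
        normConst Q * ((F τ - f τ) (E.symm (0, 0)) + sgnTwo x 1 * (F τ - f τ) (E.symm (1, 0))) := by
      intro y hy
      rw [← h.weilS_mulVec_of_support (v := F τ - f τ) (fun x y hy => by
        rw [Pi.sub_apply, hF.off _ _ _ hy, sub_self]) x y, Matrix.mulVec_sub, defectS, defectS,
        Pi.sub_apply, Pi.sub_apply, Pi.sub_apply, slashV_apply, slashV_apply, slashS, slashS,
        hF.off _ _ _ hy]
      ring
    have hconst : ∀ y, y ≠ 0 →
        defectS Q κ F τ (E.symm (x, y)) = defectS Q κ F τ (E.symm (x, 1)) := by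
      intro y hy
      rw [hd y hy, hd 1 one_ne_zero, hu τ x hy one_ne_zero]
    have hP : ∀ z x, punctSum E (F z) x = punctSum E (f z) x := fun z x =>
      punctSum_eq_of_forall fun y hy => hF.off z x y hy
    -- the values at `0` and `p` are chosen so that the sum of the defect vanishes
    have hsum : punctSum E (defectS Q κ F τ) x = 0 := by
      have h1 : punctSum E (defectS Q κ F τ) x =
          slashS κ (fun z => punctSum E (f z) x) τ - punctSum E ((weilS Q).mulVec (F τ)) x := by
        simp only [← hP]
        simp only [punctSum, defectS, Pi.sub_apply, Finset.sum_sub_distrib]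
        rw [slashS_sub, slashS_sum]
        simp only [slashV_apply]
        ring
      rw [h1, h.punctSum_weilS, hP, hP, hF.center, hF.center, sgnTwo_zero_left, sgnTwo_one_one]
      rcases zmodTwo_cases x with rfl | rfl
      · rw [sgnTwo_zero_left]; field_simp; ring
      · rw [sgnTwo_one_one]; field_simp; ring
    have hsum' : ((p : ℂ) - 1) * defectS Q κ F τ (E.symm (x, 1)) = 0 := by
      rw [← hsum, punctSum, ← Finset.sum_erase_eq_sub (Finset.mem_univ _),
        Finset.sum_congr rfl fun y hy => hconst y (Finset.ne_of_mem_erase hy), Finset.sum_const,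
        Finset.card_erase_of_mem (Finset.mem_univ _), Finset.card_univ, ZMod.card, nsmul_eq_mul,
        Nat.cast_sub (Fact.out (p := p.Prime)).one_le, Nat.cast_one]
    intro y hy
    rw [hconst y hy]
    exact (mul_eq_zero.mp hsum').resolve_left hp1
  have h0 := h.eq_zero_of_support (h.slashV_defectS hκ hχ hF.neg_eq) hv τ
  exact (slashV_eq_iff F τ _).mp (sub_eq_zero.mp h0)

end Completion

/-! ### Equivariance of the completed form under `T` -/

section Translation

variable {A : Type*} [AddCommGroup A] [Fintype A] [DecidableEq A] {p : ℕ} [Fact p.Prime]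
  {Q : QuadraticMap ℤ A (AddCircle (1 : ℚ))} {δ α : ℤ} {E : A ≃+ ZMod 2 × ZMod p}
  {χ : DirichletCharacter ℂ p} {κ : ℤ}

lemma T_S_T_smul (τ : ℍ) : ModularGroup.T • ModularGroup.S • ModularGroup.T • τ =
    ModularGroup.S • ModularGroup.T⁻¹ • ModularGroup.S • τ := by
  have h1 : ModularGroup.T * ModularGroup.S * ModularGroup.T =
      -(ModularGroup.S * ModularGroup.T⁻¹ * ModularGroup.S) := by
    decide
  rw [← mul_smul, ← mul_smul, ← mul_smul, ← mul_smul, h1, ModularGroup.SL_neg_smul]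

lemma root_S_T_S (τ : ℍ) : Mp2Z.S.root (ModularGroup.T⁻¹ • ModularGroup.S • τ) * Mp2Z.S.root τ =
    Complex.I * Mp2Z.S.root (ModularGroup.T • τ) := by
  set z := ModularGroup.T⁻¹ • ModularGroup.S • τ with hz
  have hτ := τ.ne_zero
  have hcd : ∀ w : ℍ, cd Mp2Z.S.mat w = w := fun w => by simp [cd, Mp2Z.S, ModularGroup.S]
  have hz1 : (z : ℂ) = -1 / τ - 1 := by
    have h1 := coe_T_smul z
    rw [hz, smul_inv_smul, coe_S_smul, ← hz] at h1
    linear_combination -h1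
  have h2 : (Mp2Z.S.root z * Mp2Z.S.root τ) ^ 2 =
      (Complex.I * Mp2Z.S.root (ModularGroup.T • τ)) ^ 2 := by
    rw [mul_pow, mul_pow, Mp2Z.root_sq, Mp2Z.root_sq, Mp2Z.root_sq, hcd, hcd, hcd, hz1, coe_T_smul,
      Complex.I_sq]
    field_simp
    ring
  rcases sq_eq_sq_iff_eq_or_eq_neg.mp h2 with h3 | h3
  · exact h3
  · exfalso
    have h4 := congrArg Complex.im h3
    obtain ⟨a1, a2⟩ := root_S z
    obtain ⟨b1, b2⟩ := root_S τ
    obtain ⟨c1, c2⟩ := root_S (ModularGroup.T • τ)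
    rw [Complex.mul_im, Complex.neg_im, Complex.I_mul_im] at h4
    have := mul_pos a1 b2
    have := mul_pos a2 b1
    linarith

/-- The braid relation between `ρ*(S)` and `ρ*(T)`, from `Q(μ) + ⟨β, μ⟩ + ⟨μ, γ⟩ =
Q(μ + β + γ) - Q(β + γ)`. -/
lemma IsCoord.weilS_braid (h : IsCoord Q δ α E) (v : A → ℂ) :
    (weilS Q).mulVec ((Matrix.diagonal fun γ => eQZ (Q γ)).mulVec ((weilS Q).mulVec v)) =
      eSig Q ^ 2 • (weilT Q).mulVec ((weilS Q).mulVec ((weilT Q).mulVec fun γ => v (-γ))) := by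
  have hA : ((Real.sqrt (Fintype.card A) : ℝ) : ℂ) ≠ 0 :=
    sqrt_ne_zero_complex Fintype.card_ne_zero
  have hsum : ∑ μ : A, eQZ (Q μ) = ((Real.sqrt (Fintype.card A) : ℝ) : ℂ) * eSig Q := by
    rw [h.eSig_eq_gauss, mul_inv_cancel_left₀ hA]
  have hK : normConst Q * ((Real.sqrt (Fintype.card A) : ℝ) : ℂ) = eSig Q :=
    div_mul_cancel₀ _ hA
  funext β
  have hentry : ∀ γ : A, ∑ μ : A, eQZ (QuadraticMap.polar Q β μ) * (eQZ (Q μ) *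
      eQZ (QuadraticMap.polar Q μ γ)) = ((Real.sqrt (Fintype.card A) : ℝ) : ℂ) * eSig Q *
      (eQZ (-Q β) * (eQZ (QuadraticMap.polar Q β (-γ)) * eQZ (-Q (-γ)))) := by
    intro γ
    rw [← hsum, ← Equiv.sum_comp (Equiv.addRight (β + γ)) fun μ => eQZ (Q μ), Finset.sum_mul]
    refine Finset.sum_congr rfl fun μ _ => ?_
    simp only [Equiv.coe_addRight, ← eQZ_add]
    congr 1
    rw [QuadraticMap.polar_neg_right, QuadraticMap.map_neg, QuadraticMap.polar_comm Q β μ]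
    have h1 : Q (μ + (β + γ)) = QuadraticMap.polar Q μ (β + γ) + Q μ + Q (β + γ) := by
      rw [QuadraticMap.polar]; abel
    have h2 : Q (β + γ) = QuadraticMap.polar Q β γ + Q β + Q γ := by
      rw [QuadraticMap.polar]; abel
    rw [h1, h2, QuadraticMap.polar_add_right]
    abel
  have hS : ∀ (v : A → ℂ) (β : A), (weilS Q).mulVec v β =
      normConst Q * ∑ γ : A, eQZ (QuadraticMap.polar Q β γ) * v γ := by
    intro v β
    rw [Matrix.mulVec, dotProduct, Finset.mul_sum]
    refine Finset.sum_congr rfl fun γ _ => ?_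
    rw [weilS, Matrix.of_apply, normConst]
    ring
  rw [Pi.smul_apply, smul_eq_mul, hS, weilT, Matrix.mulVec_diagonal, hS]
  simp only [Matrix.mulVec_diagonal, hS]
  have h1 : ∀ μ : A, eQZ (QuadraticMap.polar Q β μ) * (eQZ (Q μ) *
      (normConst Q * ∑ γ : A, eQZ (QuadraticMap.polar Q μ γ) * v γ)) =
      ∑ γ : A, normConst Q * (eQZ (QuadraticMap.polar Q β μ) * (eQZ (Q μ) *
        eQZ (QuadraticMap.polar Q μ γ))) * v γ := by
    intro μ
    rw [Finset.mul_sum, Finset.mul_sum, Finset.mul_sum]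
    exact Finset.sum_congr rfl fun γ _ => by ring
  simp only [h1]
  rw [Finset.sum_comm]
  simp only [← Finset.sum_mul, ← Finset.mul_sum, hentry]
  rw [← Equiv.sum_comp (Equiv.neg A) (fun γ => eQZ (QuadraticMap.polar Q β γ) * (eQZ (-Q γ) * v (-γ)))]
  simp only [Equiv.neg_apply, neg_neg, Finset.mul_sum]
  refine Finset.sum_congr rfl fun γ _ => ?_
  linear_combination (normConst Q * eSig Q * (eQZ (-Q β) * (eQZ (QuadraticMap.polar Q β (-γ)) *
    eQZ (-Q (-γ)))) * v γ) * hK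

/-- An `S`-equivariant function of the parity of `χ` that is `T`-equivariant away from `0` and `p`
is `T`-equivariant. The argument compares two values of `Q` on a parity class away from `0` and `p`;
for `p = 3` there is only one. -/
lemma IsCoord.map_T (h : IsCoord Q δ α E) (hκ : Odd κ)
    (hχ : χ (-1) = Complex.I ^ κ * eSig Q ^ 2) (hp3 : p ≠ 3 ∨ χ (-1) = -1) {F : ℍ → A → ℂ}
    (hneg : ∀ τ γ, F τ (-γ) = χ (-1) * F τ γ)
    (hS : ∀ τ, F (ModularGroup.S • τ) = Mp2Z.S.root τ ^ κ • (weilS Q).mulVec (F τ))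
    (hT : ∀ τ x y, y ≠ 0 → F (ModularGroup.T • τ) (E.symm (x, y)) =
      eQZ (-Q (E.symm (x, y))) * F τ (E.symm (x, y))) (τ : ℍ) :
    F (ModularGroup.T • τ) = (weilT Q).mulVec (F τ) := by
  set w : ℍ → A → ℂ := fun τ => F (ModularGroup.T • τ) - (weilT Q).mulVec (F τ) with hw
  have hFT : ∀ τ, F (ModularGroup.T • τ) = (weilT Q).mulVec (F τ) + w τ := fun τ =>
    (add_sub_cancel _ _).symm
  have hw0 : ∀ τ x y, y ≠ 0 → w τ (E.symm (x, y)) = 0 := by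
    intro τ x y hy
    rw [hw]
    simp only [Pi.sub_apply]
    rw [hT _ _ _ hy, weilT, Matrix.mulVec_diagonal, sub_self]
  suffices key : ∀ x, w τ (E.symm (x, 0)) = 0 by
    rw [hFT τ, add_eq_left]
    funext γ
    obtain ⟨⟨x, y⟩, rfl⟩ := E.symm.surjective γ
    by_cases hy : y = 0
    · rw [hy]; exact key x
    · exact hw0 _ _ _ hy
  by_cases hχ1 : χ (-1) = -1
  · intro x
    have h0 : ∀ τ, F τ (E.symm (x, 0)) = 0 := by
      intro τ
      have := hneg τ (E.symm (x, 0))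
      rw [neg_symm, neg_zero, hχ1] at this
      linear_combination this / 2
    rw [hw]
    simp only [Pi.sub_apply]
    rw [weilT, Matrix.mulVec_diagonal, h0, h0, mul_zero, sub_zero]
  have hp3' : p ≠ 3 := hp3.resolve_right hχ1
  set z := ModularGroup.T⁻¹ • ModularGroup.S • τ with hz
  have hTz : ModularGroup.T • z = ModularGroup.S • τ := by rw [hz, smul_inv_smul]
  set D : Matrix A A ℂ := Matrix.diagonal fun γ => eQZ (Q γ) with hD
  have hDT : ∀ v : A → ℂ, D.mulVec ((weilT Q).mulVec v) = v := by
    intro v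
    funext γ
    rw [hD, Matrix.mulVec_diagonal, weilT, Matrix.mulVec_diagonal, ← mul_assoc, ← eQZ_add,
      add_neg_cancel, eQZ_zero, one_mul]
  have hFz : F z = Mp2Z.S.root τ ^ κ • D.mulVec ((weilS Q).mulVec (F τ)) - D.mulVec (w z) := by
    have h1 := hFT z
    rw [hTz, hS] at h1
    have h2 := congrArg D.mulVec h1
    rw [Matrix.mulVec_add, hDT, Matrix.mulVec_smul] at h2
    rw [h2]; abel
  have hroot : Mp2Z.S.root z ^ κ * Mp2Z.S.root τ ^ κ * Complex.I ^ (-κ) =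
      Mp2Z.S.root (ModularGroup.T • τ) ^ κ := by
    rw [← mul_zpow, root_S_T_S, mul_zpow, mul_right_comm, ← zpow_add₀ Complex.I_ne_zero,
      add_neg_cancel, zpow_zero, one_mul]
  have hbraid : (weilS Q).mulVec (D.mulVec ((weilS Q).mulVec (F τ))) =
      Complex.I ^ (-κ) • (weilT Q).mulVec ((weilS Q).mulVec ((weilT Q).mulVec (F τ))) := by
    have h1 : (fun γ => F τ (-γ)) = χ (-1) • F τ := funext (hneg τ)
    rw [h.weilS_braid, h1, Matrix.mulVec_smul, Matrix.mulVec_smul, Matrix.mulVec_smul, smul_smul,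
      h.eSig_sq_mul_char hκ hχ]
  have hrel : Mp2Z.S.root (ModularGroup.T • τ) ^ κ • (weilT Q).mulVec ((weilS Q).mulVec (w τ)) +
      w (ModularGroup.S • ModularGroup.T • τ) =
      -(Mp2Z.S.root z ^ κ • (weilS Q).mulVec (D.mulVec (w z))) := by
    have h1 := congrArg F (T_S_T_smul τ)
    rw [← hz, hFT] at h1
    generalize w (ModularGroup.S • ModularGroup.T • τ) = w' at h1 ⊢
    rw [ hS (ModularGroup.T • τ), hS z, hFz, hFT τ, Matrix.mulVec_sub, Matrix.mulVec_smul,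
      Matrix.mulVec_smul, Matrix.mulVec_add, Matrix.mulVec_add, hbraid, smul_sub, smul_smul,
      smul_smul, hroot, smul_add] at h1
    have h2 := sub_eq_zero.mpr h1
    rw [← sub_eq_zero, ← h2]
    abel
  have hDw : ∀ x y, y ≠ 0 → D.mulVec (w z) (E.symm (x, y)) = 0 := by
    intro x y hy
    rw [hD, Matrix.mulVec_diagonal, hw0 _ _ _ hy, mul_zero]
  have hB : ∀ x : ZMod 2, w τ (E.symm (0, 0)) + sgnTwo x 1 * w τ (E.symm (1, 0)) = 0 := by
    intro x
    by_contra hne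
    have h1 : ∀ y : ZMod p, y ≠ 0 → Mp2Z.S.root (ModularGroup.T • τ) ^ κ *
        (eQZ (-Q (E.symm (x, y))) * (normConst Q *
          (w τ (E.symm (0, 0)) + sgnTwo x 1 * w τ (E.symm (1, 0))))) =
        -(Mp2Z.S.root z ^ κ * (normConst Q * (D.mulVec (w z) (E.symm (0, 0)) +
          sgnTwo x 1 * D.mulVec (w z) (E.symm (1, 0))))) := by
      intro y hy
      have := congrFun hrel (E.symm (x, y))
      rw [Pi.add_apply, hw0 _ _ _ hy, add_zero, Pi.smul_apply, smul_eq_mul, weilT,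
        Matrix.mulVec_diagonal, h.weilS_mulVec_of_support (hw0 τ), Pi.neg_apply, Pi.smul_apply,
        smul_eq_mul, h.weilS_mulVec_of_support hDw] at this
      exact this
    have h2 := (h1 1 one_ne_zero).trans (h1 2 h.two_ne_zero).symm
    have h3 := mul_left_cancel₀ (zpow_ne_zero κ (Mp2Z.root_ne_zero _ _)) h2
    have h4 := mul_right_cancel₀ (mul_ne_zero normConst_ne_zero hne) h3
    have h5 : Q (E.symm (x, 2)) = Q (E.symm (x, 1)) := by
      rw [eQZ_neg, eQZ_neg] at h4
      have h6 := inv_injective h4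
      rw [← sub_eq_zero, ← eQZ_eq_one_iff, sub_eq_add_neg, eQZ_add, eQZ_neg, ← h6,
        mul_inv_cancel₀ (eQZ_ne_zero _)]
    rcases h.eq_or_eq_neg h5 with h6 | h6
    · have h7 := congrArg Prod.snd (E.symm.injective h6)
      have h8 : (1 : ZMod p) = 0 := by
        change (2 : ZMod p) = 1 at h7
        linear_combination h7
      exact one_ne_zero h8
    · rw [neg_symm] at h6
      have h7 := congrArg Prod.snd (E.symm.injective h6)
      change (2 : ZMod p) = -1 at h7
      have h8 : ((3 : ℕ) : ZMod p) = 0 := by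
        push_cast
        linear_combination h7
      rw [ZMod.natCast_eq_zero_iff] at h8
      exact hp3' ((Nat.prime_dvd_prime_iff_eq Fact.out Nat.prime_three).mp h8)
  have e0 := hB 0
  have e1 := hB 1
  rw [sgnTwo_zero_left] at e0
  rw [sgnTwo_one_one] at e1
  intro x
  rcases zmodTwo_cases x with rfl | rfl
  · linear_combination (e0 + e1) / 2
  · linear_combination (e0 - e1) / 2

/-- Equivariance under the two generators implies equivariance under `Mp₂(ℤ)`. -/
lemma DualWeil.smul_eq {F : ℍ → A → ℂ}
    (hS : ∀ τ, F (ModularGroup.S • τ) = Mp2Z.S.root τ ^ κ • (weilS Q).mulVec (F τ))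
    (hT : ∀ τ, F (ModularGroup.T • τ) = (weilT Q).mulVec (F τ)) {g : Mp2Z} {L : Matrix A A ℂ}
    (hg : DualWeil Q g L) (τ : ℍ) : F (g.mat • τ) = g.root τ ^ κ • L.mulVec (F τ) := by
  induction hg generalizing τ with
  | one => simp
  | S => exact hS τ
  | T =>
    have h1 : Mp2Z.T.root τ = 1 := rfl
    rw [h1, one_zpow, one_smul]
    exact hT τ
  | @mul g h L L' _ _ ih1 ih2 =>
    rw [Mp2Z.mul_mat, mul_smul, ih1, ih2, Matrix.mulVec_smul, smul_smul, Matrix.mulVec_mulVec,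
      Mp2Z.mul_root, mul_zpow]
  | @inv g L L' _ h1 h2 ih =>
    have h3 := ih (g.mat⁻¹ • τ)
    rw [smul_inv_smul] at h3
    rw [Mp2Z.inv_mat, Mp2Z.inv_root, h3, Matrix.mulVec_smul, Matrix.mulVec_mulVec, h2,
      Matrix.one_mulVec, smul_smul, ← mul_zpow, inv_mul_cancel₀ (g.root_ne_zero _), one_zpow,
      one_smul]

end Translation

/-! ### From scalar-valued to vector-valued forms -/

section Backward

variable {A : Type*} [AddCommGroup A] [Fintype A] [DecidableEq A] {p : ℕ} [Fact p.Prime]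
  {Q : QuadraticMap ℤ A (AddCircle (1 : ℚ))} {δ α : ℤ} {E : A ≃+ ZMod 2 × ZMod p}
  {χ : DirichletCharacter ℂ p} {κ : ℤ} {G : ℍ → ℂ} {c : ℤ → ℂ}

/-- The untwisted components `conj(χ(γ)) G_γ(τ/4p)` of `G`. -/
def untwist (Q : QuadraticMap ℤ A (AddCircle (1 : ℚ))) (E : A ≃+ ZMod 2 × ZMod p)
    (χ : DirichletCharacter ℂ p) (G : ℍ → ℂ) (τ : ℍ) (γ : A) : ℂ :=
  χ⁻¹ (E γ).2 * component p Q G γ ((fourP p)⁻¹ • τ)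

lemma IsCoord.hasComponents_untwist (h : IsCoord Q δ α E) (hG : HasQExpansion G c)
    (hc : ∀ n : ℤ, c n ≠ 0 → ∃ γ : A, (E γ).2 ≠ 0 ∧ InSupport p Q γ n) :
    HasComponents Q E χ G (untwist Q E χ G) := by
  intro γ τ
  rw [untwist, inv_smul_smul]
  by_cases hγ : (E γ).2 = 0
  · rw [h.component_eq_zero hG hc hγ]; ring
  · rw [← mul_assoc, ← MulChar.mul_apply, mul_inv_cancel,
      MulChar.one_apply (isUnit_iff_ne_zero.mpr hγ), one_mul]

lemma untwist_neg (τ : ℍ) (γ : A) :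
    untwist Q E χ G τ (-γ) = χ (-1) * untwist Q E χ G τ γ := by
  have h1 : χ⁻¹ (-1) = χ (-1) := by
    rw [MulChar.inv_apply', inv_neg, inv_one]
  rw [untwist, untwist, component_neg, map_neg, Prod.snd_neg, ← neg_one_mul, map_mul, h1, mul_assoc]

lemma untwist_T (τ : ℍ) (γ : A) :
    untwist Q E χ G (ModularGroup.T • τ) γ = eQZ (-Q γ) * untwist Q E χ G τ γ := by
  classical
  rw [untwist, untwist, mul_left_comm (eQZ _)]
  congr 1
  rw [component, component, mul_left_comm (eQZ _), ← tsum_mul_left (a := eQZ (-Q γ))]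
  refine congrArg (1 / 2 * ·) (tsum_congr fun n => ?_)
  split_ifs with hn
  · have h1 : e (n * (((fourP p)⁻¹ • ModularGroup.T • τ : ℍ) : ℂ)) =
        eQZ (-Q γ) * e (n * (((fourP p)⁻¹ • τ : ℍ) : ℂ)) := by
      rw [← hn, eQZ_coe, ← e_add, coe_fourP_inv, coe_fourP_inv, coe_T_smul]
      congr 1; push_cast; ring
    rw [h1]; ring
  · rw [mul_zero]

lemma IsCoord.untwist_eq (h : IsCoord Q δ α E) (hG : HasQExpansion G c) (γ : A) (τ : ℍ) :
    untwist Q E χ G τ γ = ∑ j ∈ Finset.range (4 * p), χ⁻¹ (E γ).2 * (1 / (8 * (p : ℂ))) *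
      eQZ (Q γ) ^ j * G (aff (1 / (4 * (p : ℚ))) ((j : ℚ) / (4 * (p : ℚ))) div_fourP_pos τ) := by
  rw [untwist, h.component_eq hG, ← mul_assoc, Finset.mul_sum]
  exact Finset.sum_congr rfl fun j _ => by ring

lemma IsCoord.mdiff_untwist (h : IsCoord Q δ α E) (hG : HasQExpansion G c) (hM : MDiff G) (γ : A) :
    MDiff fun τ => untwist Q E χ G τ γ := by
  simp only [h.untwist_eq hG]
  exact mdiff_sum _ fun j _ => (mdiff_comp_aff hM _ _ _).const_smul _

lemma mdiff_slashS {f : ℍ → ℂ} (hf : MDiff f) : MDiff (slashS κ f) :=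
  (mdiff_root_S_zpow (-κ)).mul (mdiff_comp_S hf)

lemma MeromorphicAtCusps.hasFracExpansion_self (hG : MeromorphicAtCusps κ G) :
    HasFracExpansion G := by
  obtain ⟨h, c, hh, hc, hs⟩ := hG 1
  refine ⟨h, c, hh, hc, ?_⟩
  simpa [cd] using hs

lemma IsCoord.hasFracExpansion_untwist (h : IsCoord Q δ α E) (hG : HasQExpansion G c)
    (hM : MeromorphicAtCusps κ G) (γ : A) : HasFracExpansion fun τ => untwist Q E χ G τ γ := by
  simp only [h.untwist_eq hG]
  exact HasFracExpansion.sum fun j _ =>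
    (hM.hasFracExpansion_self.comp_aff _ _ _).const_mul _

lemma IsCoord.hasFracExpansion_slashS_untwist (h : IsCoord Q δ α E) (hG : HasQExpansion G c)
    (hM : MeromorphicAtCusps κ G) (γ : A) :
    HasFracExpansion (slashS κ fun τ => untwist Q E χ G τ γ) := by
  have hpp := (Fact.out (p := p.Prime)).pos
  have hp0 : (p : ℂ) ≠ 0 := by exact_mod_cast hpp.ne'
  have h1 : (slashS κ fun τ => untwist Q E χ G τ γ) = fun τ => ∑ j ∈ Finset.range (4 * p),
      χ⁻¹ (E γ).2 * (1 / (8 * (p : ℂ))) * eQZ (Q γ) ^ j * (Mp2Z.S.root τ ^ (-κ) *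
        G (aff (1 / (4 * (p : ℚ))) ((j : ℚ) / (4 * (p : ℚ))) div_fourP_pos
          (ModularGroup.S • τ))) := by
    funext τ
    rw [slashS, h.untwist_eq hG, Finset.mul_sum]
    exact Finset.sum_congr rfl fun j _ => by ring
  rw [h1]
  -- `-1/(4pτ) + j/(4p)` is the image of `τ` under the matrix `(j, -1; 4p, 0)`
  refine HasFracExpansion.sum fun j _ => HasFracExpansion.const_mul _
    (hM.hasFracExpansion (a := j) (b := -1) (c := 4 * p) (d := 0) (by simpa using hpp)
      (fun τ => ?_) Mp2Z.S.continuous_root (K := 1 / (4 * (p : ℂ))) ?_ fun τ => ?_)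
  · have hτ := τ.ne_zero
    rw [coe_aff, coe_S_smul]
    push_cast
    field_simp
    ring
  · exact one_div_ne_zero (mul_ne_zero (by norm_num) hp0)
  · rw [Mp2Z.root_sq]
    have : cd Mp2Z.S.mat τ = τ := by simp [cd, Mp2Z.S, ModularGroup.S]
    rw [this]
    push_cast
    field_simp
    ring

variable {ι : A ≃+ ZMod (2 * p)} {hp : p ≠ 2}

/-- The coefficients of a form in `A_k^ε` are supported on classes that are nonzero mod `p`. -/
lemma exists_expansion_of_mem_epsForms (hp : p ≠ 2) (hG : G ∈ epsForms Q ι χ κ) :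
    ∃ c : ℤ → ℂ, HasQExpansion G c ∧
      ∀ n : ℤ, c n ≠ 0 → ∃ γ : A, (coordEquiv hp ι γ).2 ≠ 0 ∧ InSupport p Q γ n := by
  obtain ⟨-, c, hc, hs⟩ := hG
  refine ⟨c, hc, fun n hn => ?_⟩
  obtain ⟨γ, h0, h1, h2⟩ := hs n hn
  exact ⟨γ, ((coord_cases hp ι γ).resolve_left h0).resolve_left h1, h2⟩

lemma IsCoord.isCompletion_inverseMap (h : IsCoord Q δ α (coordEquiv hp ι))
    (hG : G ∈ epsForms Q ι χ κ) : IsCompletion Q (coordEquiv hp ι) χ κ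
      (untwist Q (coordEquiv hp ι) χ G) (inverseMap Q ι χ κ G) := by
  obtain ⟨c, hc, hs⟩ := exists_expansion_of_mem_epsForms hp hG
  have hcomp := h.hasComponents_untwist (χ := χ) hc hs
  refine ⟨untwist_neg, fun τ x y hy => hcomp.inverseMap_eq (by simpa using hy) τ, fun τ x => ?_⟩
  rcases zmodTwo_cases x with rfl | rfl
  · rw [inverseMap_of_eq_zero ((coord_eq_zero hp ι _).mpr (by rw [AddEquiv.apply_symm_apply]; rfl)),
      hcomp.zeroPart_eq h, sgnTwo_zero_left, one_mul]
  · rw [inverseMap_of_eq_p hp ((coord_eq_p hp ι _).mpr (AddEquiv.apply_symm_apply _ _)),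
      hcomp.pPart_eq h, sgnTwo_one_one]
    ring

/-- A property of functions that is stable under linear combinations, and holds for the untwisted
components and their images under `S`, holds for the components of the completion. -/
lemma IsCompletion.induction {f F : ℍ → A → ℂ} (hF : IsCompletion Q E χ κ f F)
    {P : (ℍ → ℂ) → Prop} (hadd : ∀ g g' : ℍ → ℂ, P g → P g' → P fun τ => g τ + g' τ)
    (hmul : ∀ (a : ℂ) (g : ℍ → ℂ), P g → P fun τ => a * g τ)
    (hf : ∀ γ, P fun τ => f τ γ) (hS : ∀ γ, P (slashS κ fun τ => f τ γ)) (γ : A) :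
    P fun τ => F τ γ := by
  have h0 : P fun _ => 0 := by simpa using hmul 0 _ (hf 0)
  have hsum : ∀ (s : Finset (ZMod p)) (g : ZMod p → ℍ → ℂ), (∀ y, P (g y)) →
      P fun τ => ∑ y ∈ s, g y τ := by
    intro s g hg
    induction s using Finset.induction_on with
    | empty => simpa using h0
    | insert a s ha ih =>
      simp only [Finset.sum_insert ha]
      exact hadd _ _ (hg a) ih
  have hsub : ∀ g g' : ℍ → ℂ, P g → P g' → P fun τ => g τ - g' τ := by
    intro g g' hg hg'
    simpa [sub_eq_add_neg] using hadd _ _ hg (hmul (-1) _ hg')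
  have hP : ∀ x, P fun τ => punctSum E (f τ) x := fun x =>
    hsub _ _ (hsum _ (fun y τ => f τ (E.symm (x, y))) fun y => hf _) (hf _)
  have hPS : ∀ x, P (slashS κ fun τ => punctSum E (f τ) x) := by
    intro x
    have h1 : (slashS κ fun τ => punctSum E (f τ) x) = fun τ =>
        ∑ y : ZMod p, slashS κ (fun z => f z (E.symm (x, y))) τ -
          slashS κ (fun z => f z (E.symm (x, 0))) τ := by
      funext τ
      simp only [punctSum]
      rw [slashS_sub, slashS_sum]
    rw [h1]
    exact hsub _ _ (hsum _ (fun y => slashS κ fun z => f z (E.symm (x, y))) fun y => hS _) (hS _)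
  obtain ⟨⟨x, y⟩, rfl⟩ := E.symm.surjective γ
  by_cases hy : y = 0
  · subst hy
    simp only [hF.center]
    exact hadd _ _ (hmul _ _ (hadd _ _ (hPS 0) (hmul _ _ (hPS 1)))) (hmul _ _ (hP x))
  · simp only [hF.off _ _ _ hy]
    exact hf _

/-- The inverse map takes values in the vector-valued forms. -/
lemma IsCoord.inverseMap_mem (h : IsCoord Q δ α (coordEquiv hp ι)) (hκ : Odd κ)
    (hχ : χ (-1) = Complex.I ^ κ * eSig Q ^ 2) (hp3 : p ≠ 3 ∨ χ (-1) = -1)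
    (hG : G ∈ alForms Q α ι χ κ) : inverseMap Q ι χ κ G ∈ vectorForms Q κ := by
  obtain ⟨hG1, hAL⟩ := hG
  obtain ⟨⟨hM, -, hcusp⟩, -⟩ := id hG1
  obtain ⟨c, hc, hs⟩ := exists_expansion_of_mem_epsForms hp hG1
  have hcomp := h.hasComponents_untwist (χ := χ) hc hs
  have hF := h.isCompletion_inverseMap hG1
  have hS := hF.map_S h hκ hχ fun ω hω τ => by
    have h1 := (hcomp.atkinLehner_iff h κ (ω * χ⁻¹) ((fourP p)⁻¹ • τ)).mp
      (hAL (ω * χ⁻¹) (fun h0 => hω (mul_eq_right.mp h0)) _)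
    simpa only [smul_inv_smul, inv_mul_cancel_right] using h1
  have hT := h.map_T hκ hχ hp3 hF.neg_eq hS fun τ x y hy => by
    rw [hF.off _ _ _ hy, hF.off _ _ _ hy, untwist_T]
  refine ⟨fun γ => ?_, fun g L hg τ => DualWeil.smul_eq hS hT hg τ, fun γ => ?_⟩
  · exact hF.induction (P := fun g => MDiff g) (fun _ _ hg hg' => hg.add hg')
      (fun a _ hg => hg.const_smul a) (h.mdiff_untwist hc hM)
      (fun γ => mdiff_slashS (h.mdiff_untwist hc hM γ)) γ
  · have hfrac := hF.induction (P := HasFracExpansion) (fun _ _ hg hg' => hg.add hg')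
      (fun a _ hg => hg.const_mul a) (h.hasFracExpansion_untwist hc hcusp)
      (h.hasFracExpansion_slashS_untwist hc hcusp) γ
    obtain ⟨y, hy⟩ := QuotientAddGroup.mk_surjective (-Q γ)
    change (y : AddCircle (1 : ℚ)) = _ at hy
    obtain ⟨b, hb, hb'⟩ := hfrac.of_translation (y := y) fun τ => by
      rw [hT, weilT, Matrix.mulVec_diagonal, ← hy, eQZ_coe]
    refine ⟨b, fun n hn => ?_, hb'⟩
    obtain ⟨m, rfl⟩ := hb n hn
    rw [AddCircle.coe_add, hy, add_eq_left, AddCircle.coe_eq_zero_iff]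
    exact ⟨m, by simp⟩

lemma IsCoord.twistedComponentSum_inverseMap (h : IsCoord Q δ α (coordEquiv hp ι))
    (hG : G ∈ epsForms Q ι χ κ) : twistedComponentSum ι χ (inverseMap Q ι χ κ G) = G := by
  obtain ⟨c, hc, hs⟩ := exists_expansion_of_mem_epsForms hp hG
  have hcomp := h.hasComponents_untwist (χ := χ) hc hs
  funext τ
  rw [twistedComponentSum_apply hp, ← h.sum_component hc hs]
  refine Finset.sum_congr rfl fun γ _ => ?_
  by_cases hγ : (coordEquiv hp ι γ).2 = 0
  · rw [h.component_eq_zero hc hs hγ, hγ, MulChar.map_nonunit _ (by simp), zero_mul]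
  · rw [hcomp.inverseMap_eq hγ, hcomp]

end Backward

/-! ### Classification of the finite quadratic modules of order `2p` -/

section Classification

variable {A : Type*} [AddCommGroup A] {p : ℕ} [Fact p.Prime]
  {Q : QuadraticMap ℤ A (AddCircle (1 : ℚ))}

lemma exists_addEquiv_zmod [Fintype A] (hp : p ≠ 2) (hA : Fintype.card A = 2 * p) :
    Nonempty (A ≃+ ZMod (2 * p)) := by
  obtain ⟨a, ha⟩ := exists_prime_addOrderOf_dvd_card' (G := A) 2
    (by rw [Nat.card_eq_fintype_card, hA]; exact dvd_mul_right 2 p)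
  obtain ⟨b, hb⟩ := exists_prime_addOrderOf_dvd_card' (G := A) p
    (by rw [Nat.card_eq_fintype_card, hA]; exact dvd_mul_left p 2)
  have hab : addOrderOf (a + b) = 2 * p := by
    rw [(AddCommute.all a b).addOrderOf_add_eq_mul_addOrderOf_of_coprime, ha, hb]
    rw [ha, hb]
    exact (Nat.coprime_primes Nat.prime_two Fact.out).mpr hp.symm
  have hcyc : IsAddCyclic A := isAddCyclic_of_addOrderOf_eq_card (a + b)
    (by rw [hab, Nat.card_eq_fintype_card, hA])
  have e := zmodAddCyclicAddEquiv hcyc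
  rw [Nat.card_eq_fintype_card, hA] at e
  exact ⟨e.symm⟩

lemma exists_eq_div_of_nsmul {n : ℕ} (hn : n ≠ 0) {x : AddCircle (1 : ℚ)} (hx : n • x = 0) :
    ∃ m : ℤ, x = (((m : ℚ) / (n : ℚ) : ℚ) : AddCircle (1 : ℚ)) := by
  induction x using QuotientAddGroup.induction_on with | _ r
  have hn0 : (n : ℚ) ≠ 0 := by exact_mod_cast hn
  change n • (r : AddCircle (1 : ℚ)) = 0 at hx
  rw [← AddCircle.coe_nsmul, AddCircle.coe_eq_zero_iff] at hx
  obtain ⟨m, hm⟩ := hx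
  refine ⟨m, ?_⟩
  rw [zsmul_eq_mul, mul_one, nsmul_eq_mul] at hm
  rw [hm, mul_div_cancel_left₀ _ hn0]

lemma coe_add_int (r : ℚ) (n : ℤ) :
    ((r + n : ℚ) : AddCircle (1 : ℚ)) = (r : AddCircle (1 : ℚ)) := by
  rw [AddCircle.coe_add, add_eq_left, AddCircle.coe_eq_zero_iff]
  exact ⟨n, by simp⟩

lemma exists_isStandardForm [Fintype A] (hp : p ≠ 2) (hA : Fintype.card A = 2 * p)
    (hQ : Nondegenerate Q) :
    ∃ (δ α : ℤ) (ι : A ≃+ ZMod (2 * p)), IsStandardForm Q δ α ι := by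
  obtain ⟨ι⟩ := exists_addEquiv_zmod hp hA
  have hprime : p.Prime := Fact.out
  have hp0 : (p : ℚ) ≠ 0 := by exact_mod_cast hprime.ne_zero
  have hpodd := hprime.odd_of_ne_two hp
  set a := ι.symm (p : ZMod (2 * p)) with ha
  set b := ι.symm (2 : ZMod (2 * p)) with hb
  have h2a : (2 : ℕ) • a = 0 := by
    rw [ha, ← map_nsmul, nsmul_eq_mul, ← Nat.cast_mul, ZMod.natCast_self, map_zero]
  have hpb : p • b = 0 := by
    have : (p : ZMod (2 * p)) * 2 = 0 := by
      have h2 := ZMod.natCast_self (2 * p)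
      push_cast at h2
      linear_combination h2
    rw [hb, ← map_nsmul, nsmul_eq_mul, this, map_zero]
  have hrep : ∀ m k : ℤ, ι.symm (((p : ℤ) * m + 2 * k : ℤ) : ZMod (2 * p)) = m • a + k • b := by
    intro m k
    rw [ha, hb, ← map_zsmul, ← map_zsmul, ← map_add]
    congr 1
    push_cast
    rw [zsmul_eq_mul, zsmul_eq_mul]
    ring
  have hsurj : ∀ γ : A, ∃ m k : ℤ, γ = m • a + k • b := by
    intro γ
    obtain ⟨n, hn⟩ := ZMod.intCast_surjective (ι γ)
    obtain ⟨j, hj⟩ := hpodd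
    refine ⟨n, -(j * n), ?_⟩
    rw [← hrep, eq_comm, AddEquiv.symm_apply_eq, ← hn]
    congr 1
    rw [hj]; push_cast; ring
  have ha0 : a ≠ 0 := by
    rw [ha, Ne, AddEquiv.map_eq_zero_iff, ZMod.natCast_eq_zero_iff]
    intro h
    have := Nat.le_of_dvd hprime.pos h
    have := hprime.pos
    omega
  have hb0 : b ≠ 0 := by
    rw [hb, Ne, AddEquiv.map_eq_zero_iff]
    intro h
    replace h : ((2 : ℕ) : ZMod (2 * p)) = 0 := by exact_mod_cast h
    rw [ZMod.natCast_eq_zero_iff] at h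
    have := Nat.le_of_dvd two_pos h
    have := hprime.two_le
    omega
  have hpsmul : ∀ (x y : A) (m : ℤ), QuadraticMap.polar Q x (m • y) = m • QuadraticMap.polar Q x y :=
    fun x y m => QuadraticMap.polar_smul_right Q m x y
  have hpself : ∀ x, QuadraticMap.polar Q x x = (2 : ℤ) • Q x := by
    intro x
    rw [QuadraticMap.polar_self, ← natCast_zsmul]
    rfl
  have hsq : ∀ (m : ℤ) (x : A), Q (m • x) = (m * m) • Q x := fun m x => QuadraticMap.map_smul Q m x
  have hab : QuadraticMap.polar Q a b = 0 := by
    have h1 : (2 : ℤ) • QuadraticMap.polar Q a b = 0 := by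
      rw [← QuadraticMap.polar_smul_left, show (2 : ℤ) • a = (2 : ℕ) • a from by norm_cast, h2a,
        QuadraticMap.polar_zero_left]
    have h2 : (p : ℤ) • QuadraticMap.polar Q a b = 0 := by
      rw [← hpsmul, natCast_zsmul, hpb, QuadraticMap.polar_zero_right]
    obtain ⟨j, hj⟩ := hpodd
    have h3 : (p : ℤ) = j * 2 + 1 := by rw [hj]; push_cast; ring
    rw [h3, add_smul, mul_smul, h1, smul_zero, zero_add, one_smul] at h2
    exact h2
  -- the `2`-part
  obtain ⟨δ, hδ, hQa⟩ : ∃ δ : ℤ, (δ = 1 ∨ δ = -1) ∧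
      Q a = (((δ : ℚ) / 4 : ℚ) : AddCircle (1 : ℚ)) := by
    have h4 : (4 : ℕ) • Q a = 0 := by
      have h5 := hsq 2 a
      rw [show (2 : ℤ) • a = (2 : ℕ) • a from by norm_cast, h2a, QuadraticMap.map_zero] at h5
      rw [h5]; norm_cast
    obtain ⟨m, hm⟩ := exists_eq_div_of_nsmul four_ne_zero h4
    have hodd : ¬ Even m := by
      rintro ⟨j, rfl⟩
      apply ha0
      apply hQ
      intro γ
      obtain ⟨m', k, rfl⟩ := hsurj γ
      have h0 : (2 : ℤ) • Q a = 0 := by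
        rw [hm, ← AddCircle.coe_zsmul, AddCircle.coe_eq_zero_iff]
        refine ⟨j, ?_⟩
        simp only [zsmul_eq_mul]
        push_cast
        ring
      rw [QuadraticMap.polar_add_right, hpsmul, hpsmul, hpself, h0, hab, smul_zero, smul_zero,
        add_zero]
    have h1 := Int.emod_two_eq_zero_or_one m
    rw [Int.even_iff] at hodd
    rcases (by omega : m % 4 = 1 ∨ m % 4 = 3) with h4 | h4
    · refine ⟨1, Or.inl rfl, ?_⟩
      rw [hm, ← coe_add_int _ (-(m / 4))]
      congr 1
      have : (m : ℚ) = 4 * (m / 4 : ℤ) + 1 := by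
        have : m = 4 * (m / 4) + 1 := by omega
        exact_mod_cast this
      push_cast at this ⊢
      linarith
    · refine ⟨-1, Or.inr rfl, ?_⟩
      rw [hm, ← coe_add_int _ (-(m / 4 + 1))]
      congr 1
      have : (m : ℚ) = 4 * (m / 4 : ℤ) + 3 := by
        have : m = 4 * (m / 4) + 3 := by omega
        exact_mod_cast this
      push_cast at this ⊢
      linarith
  -- the `p`-part
  obtain ⟨m, hm⟩ : ∃ m : ℤ, Q b = (((m : ℚ) / (p : ℚ) : ℚ) : AddCircle (1 : ℚ)) := by
    refine exists_eq_div_of_nsmul hprime.ne_zero ?_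
    have h1 : (p : ℤ) • ((2 : ℤ) • Q b) = 0 := by
      rw [← hpself, ← hpsmul, natCast_zsmul, hpb, QuadraticMap.polar_zero_right]
    have h2 : ((p : ℤ) * p) • Q b = 0 := by
      rw [← hsq, natCast_zsmul, hpb, QuadraticMap.map_zero]
    obtain ⟨j, hj⟩ := hpodd
    have h3 : (p : ℤ) = p * p + -(j : ℤ) * (p * 2) := by
      have : (p : ℤ) = 2 * j + 1 := by exact_mod_cast hj
      linear_combination (-(p : ℤ)) * this
    rw [← natCast_zsmul, h3, add_smul, h2, mul_smul, mul_smul, h1, smul_zero, zero_add]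
  have hpm : ¬ (p : ℤ) ∣ m := by
    rintro ⟨j, rfl⟩
    apply hb0
    apply hQ
    intro γ
    obtain ⟨m', k, rfl⟩ := hsurj γ
    have h0 : Q b = 0 := by
      rw [hm, AddCircle.coe_eq_zero_iff]
      refine ⟨j, ?_⟩
      simp only [zsmul_eq_mul]
      push_cast
      field_simp
    rw [QuadraticMap.polar_add_right, hpsmul, hpsmul, hpself, h0, QuadraticMap.polar_comm, hab,
      smul_zero, smul_zero, smul_zero, add_zero]
  -- `2` represents the generator of the `p`-part, so `α` is a quarter of `m`
  have hcop : IsCoprime (4 : ℤ) (p : ℤ) := by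
    rw [Int.isCoprime_iff_gcd_eq_one]
    have : Nat.Coprime (2 ^ 2) p :=
      Nat.Coprime.pow_left 2 ((Nat.coprime_primes Nat.prime_two hprime).mpr hp.symm)
    exact_mod_cast this
  obtain ⟨u, v, huv⟩ := hcop
  refine ⟨δ, u * m, ι, hδ, ?_, ?_⟩
  · intro hd
    apply hpm
    have h1 : m = 4 * (u * m) + p * (v * m) := by linear_combination (-m) * huv
    rw [h1]
    exact dvd_add (hd.mul_left 4) (dvd_mul_right _ _)
  · intro γ₁ γ₂ hγ
    obtain ⟨k, rfl⟩ := hγ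
    rw [← two_mul, hrep]
    have h1 : Q (γ₁ • a + k • b) = Q (γ₁ • a) + Q (k • b) := by
      have h2 : QuadraticMap.polar Q (γ₁ • a) (k • b) = 0 := by
        rw [QuadraticMap.polar_smul_left, hpsmul, hab, smul_zero, smul_zero]
      rw [QuadraticMap.polar] at h2
      rw [← sub_eq_zero, ← h2]; abel
    rw [h1, hsq, hsq, hQa, hm, ← AddCircle.coe_zsmul, ← AddCircle.coe_zsmul, ← AddCircle.coe_add,
      ← coe_add_int _ (-(k * k * m * v))]
    congr 1
    have h3 : (u : ℚ) * 4 + v * p = 1 := by exact_mod_cast huv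
    simp only [zsmul_eq_mul]
    push_cast
    field_simp
    linear_combination (-4 * (k : ℚ) ^ 2 * m) * h3

end Classification

end TwistedSum

end

theorem proposition3p7 {A : Type*} [AddCommGroup A] [Fintype A] [DecidableEq A]
    (p : ℕ) [Fact p.Prime] (hp : p ≠ 2) (hA : Fintype.card A = 2 * p)
    (Q : QuadraticMap ℤ A (AddCircle (1 : ℚ))) (hQ : TwistedSum.Nondegenerate Q)
    (κ : ℤ) (hκ : Odd κ) (χ : DirichletCharacter ℂ p)
    (hχ : χ (-1) = Complex.exp
      (Real.pi * Complex.I * ((κ : ℂ) / 2 + ((TwistedSum.signature Q).val : ℂ) / 2))) :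
    (∃ (δ α : ℤ) (ι : A ≃+ ZMod (2 * p)), TwistedSum.IsStandardForm Q δ α ι) ∧
    ∀ (δ α : ℤ) (ι : A ≃+ ZMod (2 * p)), TwistedSum.IsStandardForm Q δ α ι →
      (∀ F ∈ TwistedSum.vectorForms Q κ,
        TwistedSum.twistedComponentSum ι χ F ∈ TwistedSum.alForms Q α ι χ κ ∧
        TwistedSum.inverseMap Q ι χ κ (TwistedSum.twistedComponentSum ι χ F) = F) ∧
      (p ≠ 3 ∨ χ (-1) = -1 →
        ∃ Φ : TwistedSum.vectorForms Q κ ≃ₗ[ℂ] TwistedSum.alForms Q α ι χ κ,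
          (∀ F, (Φ F : ℍ → ℂ) = TwistedSum.twistedComponentSum ι χ (F : ℍ → A → ℂ)) ∧
          ∀ G, (Φ.symm G : ℍ → A → ℂ) = TwistedSum.inverseMap Q ι χ κ (G : ℍ → ℂ)) := by
  have hχ' := TwistedSum.char_neg_one_eq hχ
  refine ⟨TwistedSum.exists_isStandardForm hp hA hQ, fun δ α ι hst => ?_⟩
  have h := TwistedSum.isCoord_of_standardForm hp hst
  refine ⟨fun F hF => ⟨h.twistedComponentSum_mem hκ hχ' hF,
    h.inverseMap_twistedComponentSum hχ' hF⟩, fun hp3 => ?_⟩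
  exact ⟨{ (TwistedSum.twistedComponentSum ι χ).restrict
            fun F hF => h.twistedComponentSum_mem hκ hχ' hF with
          invFun := fun G => ⟨TwistedSum.inverseMap Q ι χ κ G, h.inverseMap_mem hκ hχ' hp3 G.2⟩
          left_inv := fun F => Subtype.ext (h.inverseMap_twistedComponentSum hχ' F.2)
          right_inv := fun G => Subtype.ext (h.twistedComponentSum_inverseMap G.2.1) },
    fun F => rfl, fun G => rfl⟩
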